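/- **Setting.** Let $(M,\omega)$ be a compact symplectic manifold of dimension $2n$ and let $(L,h,\nabla)$ be a prequantization bundle: a Hermitian complex line bundle with a compatible connection of curvature $\frac1i\omega$. Let $\mathcal J$ be the set of smooth almost complex structures $j$ of $M$ that are compatible with $\omega$ and positive, i.e. $\omega(j\cdot,j\cdot)=\omega$ and $\omega(v,jv)>0$ for $v\neq0$. For $j_a,j_b\in\mathcal J$ let $\Psi_{j_a,j_b}:\Lambda^{n,0}_{j_a}T^*M\to\Lambda^{n,0}_{j_b}T^*M$ be the isomorphism determined by $\Psi_{j_a,j_b}(\alpha)\wedge\bar\beta=\alpha\wedge\bar\beta$ for all $\alpha,\beta\in\Lambda^{n,0}_{j_a}T^*M$. Fix $j_{\mathrm{ref}}\in\mathcal J$ and a half-form bundle $(\delta,\varphi)$ of $(M,j_{\mathrm{ref}})$, i.e. a complex line bundle $\delta$ with a line bundle isomorphism $\varphi:\delta^2\to\Lambda^{n,0}_{j_{\mathrm{ref}}}T^*M$. For $j\in\mathcal J$ put $\delta_j:=\delta$, $\varphi_j:=\Psi_{j_{\mathrm{ref}},j}\circ\varphi$. A half-form bundle morphism $\delta_{j_a}\to\delta_{j_b}$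 is a line bundle isomorphism $\Psi$ with $\varphi_{j_b}\circ\Psi^2=\Psi_{j_a,j_b}\circ\varphi_{j_a}$. For $k\ge1$ let $\mathcal P^{\mathrm m}_k\to\mathcal J$ be the bundle with fibre $\mathcal P^{\mathrm m}_{k,j}=C^\infty(M,L^k\otimes\delta_j)$ at $j$. *Connection.* The covariant derivative at time $t$ of a section $s$ of $\mathcal P^{\mathrm m}_k$ along a curve $u\mapsto j_u$ of $\mathcal J$ is $\nabla_{\partial_t}s:=\frac{d}{du}\big|_{u=t}\Psi_u^{-1}s_u$, where $\Psi_u:\delta_{j_t}\to\delta_{j_u}$ is the continuous family of half-form bundle morphisms with $\Psi_t=\mathrm{Id}$, and the derivative is taken in the fixed space $\mathcal P^{\mathrm m}_{k,j_t}$. *Operators.* Let $f\in C^\infty(M,\mathbb R)$, let $X$ be its Hamiltonian vector field, $\omega(X,\cdot)=-df$, and $\phi_t$ the flow of $X$. Let $\exp(tf)$ be the automorphism of $L$ covering $\phi_t$ given by $\exp(tf)\xi=e^{-itf(x)}\mathcal T_t\xi$ for $\xi\in L_x$, with $\mathcal T_t:L_x\to L_{\phi_t(x)}$ the parallel transport along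 the flow. On $\mathcal P^{\mathrm m}_{k,j}$ put $$\operatorname{Op}_k(f):=f+\frac1{ik}\bigl(\nabla^{L^k}_X\otimes\mathrm{Id}+\mathrm{Id}\otimes D_X\bigr),$$ where $D_X$ is the first order differential operator of $C^\infty(M,\delta_j)$ such that $p_j\mathcal L_X\varphi_j(\beta^2)=2\varphi_j(\beta\otimes D_X\beta)$ for all $\beta\in C^\infty(M,\delta_j)$, with $p_j$ the projection of $\Lambda^nT^*M\otimes\mathbb C$ onto $\Lambda^{n,0}_jT^*M$ with kernel $\Lambda^{n-1,1}_j\oplus\dots\oplus\Lambda^{0,n}_j$. *Action.* For $j\in\mathcal J$, one has $\phi_t^*j\in\mathcal J$ for all $t$, and there is a unique family of line bundle maps $\phi_t^*:\delta_j\to\delta_{\phi_t^*j}$, mapping $(\delta_j)_{\phi_t(x)}$ to $(\delta_{\phi_t^*j})_x$, that is continuous in $(t,x)$, is the identity at $t=0$ and satisfies $\varphi_{\phi_t^*j}\circ(\phi_t^*)^2=\phi_t^*\circ\varphi_j$. The action $U_t:\mathcal P^{\mathrm m}_{k,j}\to\mathcal P^{\mathrm m}_{k,\phi_t^*j}$ of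 $\exp(tf)$ is $(U_ts)(x)=\bigl((\exp(tf)^{k})^{-1}\otimes\phi_t^*\bigr)\bigl(s(\phi_t(x))\bigr)$. **Theorem.** Let $j_0\in\mathcal J$, $j_t=\phi_t^*j_0$ and $s_0\in\mathcal P^{\mathrm m}_{k,j_0}$. Then $s_t=U_ts_0$ is a smooth section of $\mathcal P^{\mathrm m}_k$ along the curve $t\mapsto j_t$ of $\mathcal J$, and for every $t\in\mathbb R$ $$\frac1{ik}\nabla_{\partial_t}s=\operatorname{Op}_k(f)\,s .$$ -/

import Mathlib

open Bundle Manifold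
open scoped ContDiff TensorProduct Topology

noncomputable section

namespace HalfForm

/-! ### Linear algebra of complex-valued forms on a real vector space -/

section LinearAlgebra

variable {V : Type*} [AddCommGroup V] [Module ℝ V] [TopologicalSpace V]

/-- Complex-valued alternating `n`-forms, i.e. `Λⁿ V* ⊗ ℂ`. -/
abbrev CForm (V : Type*) [AddCommGroup V] [Module ℝ V] (n : ℕ) : Type _ := V [⋀^Fin n]→ₗ[ℝ] ℂ

/-- The complex conjugate of a form. -/
def conjForm {n : ℕ} (α : CForm V n) : CForm V n :=
  Complex.conjAe.toLinearMap.compAlternatingMap α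

/-- The exterior product of two complex-valued `n`-forms; the `2n` arguments are indexed by
`Fin n ⊕ Fin n`. -/
def wedge {n : ℕ} (α β : CForm V n) : V [⋀^Fin n ⊕ Fin n]→ₗ[ℝ] ℂ :=
  (LinearMap.mul' ℝ ℂ).compAlternatingMap (α.domCoprod β)

/-- `Λ^{n,0}_j V*`: the `n`-forms that are `ℂ`-linear in each argument with respect to `j`. -/
def formsN0 (n : ℕ) (j : V →L[ℝ] V) : Submodule ℂ (CForm V n) where
  carrier := {α | ∀ (v : Fin n → V) (i : Fin n),
    α (Function.update v i (j (v i))) = Complex.I * α v}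
  add_mem' := by
    intro α β hα hβ v i
    simp only [AlternatingMap.add_apply, hα v i, hβ v i, mul_add]
  zero_mem' := by
    intro v i
    simp
  smul_mem' := by
    intro c α hα v i
    simp only [AlternatingMap.smul_apply, hα v i, smul_eq_mul]
    ring

open scoped Classical in
/-- The linear map `Ψ_{ja,jb} : Λ^{n,0}_{ja} → Λ^{n,0}_{jb}` determined by
`Ψ_{ja,jb}(α) ∧ β̄ = α ∧ β̄` for all `α, β ∈ Λ^{n,0}_{ja}`. (It exists and is unique when `ja` and
`jb` are both compatible with the same symplectic form and positive; the other branch is never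
relevant for those.) -/
def psi (n : ℕ) (ja jb : V →L[ℝ] V) : formsN0 n ja →ₗ[ℂ] formsN0 n jb :=
  if h : ∃ T : formsN0 n ja →ₗ[ℂ] formsN0 n jb, ∀ α β : formsN0 n ja,
      wedge (T α : CForm V n) (conjForm (β : CForm V n)) =
        wedge (α : CForm V n) (conjForm (β : CForm V n))
  then h.choose else 0

/-- The projection `p_j` of `Λⁿ V* ⊗ ℂ` onto `Λ^{n,0}_j` with kernel
`Λ^{n-1,1}_j ⊕ ... ⊕ Λ^{0,n}_j`. Writing `π v = (v - i j v) / 2` for the projection of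
`V ⊗ ℂ` onto vectors of type `(1,0)`, it is `(p_j γ)(v₁, …, vₙ) = γ (π v₁, …, π vₙ)`; the sum is
the multilinear expansion of the right-hand side. -/
def projN0 {n : ℕ} (j : V →L[ℝ] V) (γ : (Fin n → V) → ℂ) (v : Fin n → V) : ℂ :=
  ∑ S : Finset (Fin n), (1 / 2 : ℂ) ^ n * (-Complex.I) ^ S.card *
    γ (fun i => if i ∈ S then j (v i) else v i)

end LinearAlgebra

/-! ### Smooth vector fields, symplectic forms, compatible almost complex structures -/

section Symplectic

variable {E : Type*} [NormedAddCommGroup E] [NormedSpace ℝ E]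
  {M : Type*} [TopologicalSpace M] [ChartedSpace E M]

/-- Smoothness at a point of a vector field. -/
def SmoothFieldAt [IsManifold 𝓘(ℝ, E) ∞ M] (X : Π x : M, TangentSpace 𝓘(ℝ, E) x) (x : M) : Prop :=
  ContMDiffAt 𝓘(ℝ, E) 𝓘(ℝ, E).tangent ∞ (fun y => (⟨y, X y⟩ : TangentBundle 𝓘(ℝ, E) M)) x

/-- A symplectic form: a smooth, closed, nondegenerate alternating 2-form. Closedness is
`dΩ(X,Y,Z) = 0`, with Cartan's formula for `dΩ`. -/
structure IsSymplectic [IsManifold 𝓘(ℝ, E) ∞ M]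
    (Ω : Π x : M, TangentSpace 𝓘(ℝ, E) x →ₗ[ℝ] TangentSpace 𝓘(ℝ, E) x →ₗ[ℝ] ℝ) : Prop where
  smooth : ∀ (x : M) (X Y : Π y : M, TangentSpace 𝓘(ℝ, E) y),
    SmoothFieldAt X x → SmoothFieldAt Y x →
      ContMDiffAt 𝓘(ℝ, E) 𝓘(ℝ, ℝ) ∞ (fun y => Ω y (X y) (Y y)) x
  alternating : ∀ (x : M) (v : TangentSpace 𝓘(ℝ, E) x), Ω x v v = 0
  nondegenerate : ∀ (x : M) (v : TangentSpace 𝓘(ℝ, E) x), (∀ w, Ω x v w = 0) → v = 0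
  closed : ∀ (x : M) (X Y Z : Π y : M, TangentSpace 𝓘(ℝ, E) y),
    SmoothFieldAt X x → SmoothFieldAt Y x → SmoothFieldAt Z x →
      mvfderiv 𝓘(ℝ, E) (fun y => Ω y (Y y) (Z y)) x (X x)
        - mvfderiv 𝓘(ℝ, E) (fun y => Ω y (X y) (Z y)) x (Y x)
        + mvfderiv 𝓘(ℝ, E) (fun y => Ω y (X y) (Y y)) x (Z x)
        - Ω x (VectorField.mlieBracket 𝓘(ℝ, E) X Y x) (Z x)
        + Ω x (VectorField.mlieBracket 𝓘(ℝ, E) X Z x) (Y x)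
        - Ω x (VectorField.mlieBracket 𝓘(ℝ, E) Y Z x) (X x) = 0

/-- `j` belongs to the space `𝒥` of smooth almost complex structures that are compatible with `Ω`
and positive. -/
structure IsCompatible [IsManifold 𝓘(ℝ, E) ∞ M]
    (Ω : Π x : M, TangentSpace 𝓘(ℝ, E) x →ₗ[ℝ] TangentSpace 𝓘(ℝ, E) x →ₗ[ℝ] ℝ)
    (j : Π x : M, TangentSpace 𝓘(ℝ, E) x →L[ℝ] TangentSpace 𝓘(ℝ, E) x) : Prop where
  smooth : ∀ (x : M) (X : Π y : M, TangentSpace 𝓘(ℝ, E) y),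
    SmoothFieldAt X x → SmoothFieldAt (fun y => j y (X y)) x
  sq : ∀ (x : M) (v : TangentSpace 𝓘(ℝ, E) x), j x (j x v) = -v
  compatible : ∀ (x : M) (v w : TangentSpace 𝓘(ℝ, E) x), Ω x (j x v) (j x w) = Ω x v w
  positive : ∀ (x : M) (v : TangentSpace 𝓘(ℝ, E) x), v ≠ 0 → 0 < Ω x v (j x v)

/-- `X` is the Hamiltonian vector field of `f`, with the sign convention `Ω(X, ·) = -df`. -/
def IsHamiltonianField
    (Ω : Π x : M, TangentSpace 𝓘(ℝ, E) x →ₗ[ℝ] TangentSpace 𝓘(ℝ, E) x →ₗ[ℝ] ℝ)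
    (f : M → ℝ) (X : Π x : M, TangentSpace 𝓘(ℝ, E) x) : Prop :=
  ∀ (x : M) (w : TangentSpace 𝓘(ℝ, E) x), Ω x (X x) w = -(mvfderiv 𝓘(ℝ, E) f x w)

/-- `φ : ℝ × M → M` is the flow of the vector field `X`. -/
structure IsFlow (X : Π x : M, TangentSpace 𝓘(ℝ, E) x) (φ : ℝ → M → M) : Prop where
  smooth : ContMDiff (𝓘(ℝ, ℝ).prod 𝓘(ℝ, E)) 𝓘(ℝ, E) ∞ (fun p : ℝ × M => φ p.1 p.2)
  zero : ∀ x, φ 0 x = x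
  integral : ∀ x, IsMIntegralCurve (I := 𝓘(ℝ, E)) (fun t => φ t x) X

/-- The pull-back `φ^* j = (dφ)⁻¹ ∘ j ∘ dφ` of an almost complex structure. -/
def pullbackACS (φ : M → M)
    (j : Π x : M, TangentSpace 𝓘(ℝ, E) x →L[ℝ] TangentSpace 𝓘(ℝ, E) x) :
    Π x : M, TangentSpace 𝓘(ℝ, E) x →L[ℝ] TangentSpace 𝓘(ℝ, E) x :=
  fun x => (mfderiv 𝓘(ℝ, E) 𝓘(ℝ, E) φ x).inverse ∘L j (φ x) ∘L mfderiv 𝓘(ℝ, E) 𝓘(ℝ, E) φ x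

/-- The pull-back of a complex-valued `n`-form at `φ x` to `x`. -/
def pullbackForm {n : ℕ} (φ : M → M) (x : M) (α : CForm (TangentSpace 𝓘(ℝ, E) (φ x)) n) :
    CForm (TangentSpace 𝓘(ℝ, E) x) n :=
  α.compLinearMap (mfderiv 𝓘(ℝ, E) 𝓘(ℝ, E) φ x).toLinearMap

/-- The Lie derivative `d/dt|_{t=0} φ_t^* α` of an `n`-form along the flow `φ`, evaluated at `x` on
the tangent vectors `v`. -/
def lieForm {n : ℕ} (φ : ℝ → M → M) (α : Π x : M, CForm (TangentSpace 𝓘(ℝ, E) x) n) (x : M)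
    (v : Fin n → TangentSpace 𝓘(ℝ, E) x) : ℂ :=
  deriv (fun t => pullbackForm (φ t) x (α (φ t x)) v) 0

end Symplectic

/-! ### Complex line bundles

A smooth complex line bundle over `M` is a Mathlib fibre bundle with fibre `ℂ`, complex-linear
trivializations and (real) smooth transition maps. -/

section Line

variable {E : Type*} [NormedAddCommGroup E] [NormedSpace ℝ E]
  {M : Type*} [TopologicalSpace M] [ChartedSpace E M]
  {L : M → Type*} [TopologicalSpace (TotalSpace ℂ L)] [∀ x, TopologicalSpace (L x)]
  [∀ x, AddCommGroup (L x)] [∀ x, Module ℂ (L x)] [FiberBundle ℂ L]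

/-- Smoothness at a point of a section of a complex line bundle. -/
def SmoothSectionAt (σ : Π x : M, L x) (x : M) : Prop :=
  ContMDiffAt 𝓘(ℝ, E) (𝓘(ℝ, E).prod 𝓘(ℝ, ℂ)) ∞ (fun y => (⟨y, σ y⟩ : TotalSpace ℂ L)) x

variable (L) in
/-- The local frame, near `x₀`, given by the preferred trivialization at `x₀`. -/
def frameAt (x₀ y : M) : L y := (trivializationAt ℂ L x₀).symm y 1

variable (L) in
/-- The coordinate of a vector of `L y` with respect to `frameAt L x₀ y`, for `y` near `x₀`. -/
def coordAt [VectorBundle ℂ ℂ L] (x₀ y : M) : L y →ₗ[ℂ] ℂ :=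
  (trivializationAt ℂ L x₀).linearMapAt ℂ y

/-- `h` and `nabla` make `L` a prequantization bundle of `(M, Ω)`: `h` is a smooth Hermitian metric
and `nabla` is a smooth complex connection, compatible with `h`, whose curvature is `(1/i) Ω`.
Here `nabla σ x (X x)` is `(∇_X σ)(x)`. -/
structure IsPrequantum [IsManifold 𝓘(ℝ, E) ∞ M]
    (Ω : Π x : M, TangentSpace 𝓘(ℝ, E) x →ₗ[ℝ] TangentSpace 𝓘(ℝ, E) x →ₗ[ℝ] ℝ)
    [∀ x, IsTopologicalAddGroup (L x)] [∀ x, ContinuousSMul ℝ (L x)]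
    (h : Π x : M, L x →ₗ⋆[ℂ] L x →ₗ[ℂ] ℂ) (nabla : CovariantDerivative 𝓘(ℝ, E) ℂ L) : Prop where
  metric_symm : ∀ (x : M) (u v : L x), h x u v = starRingEnd ℂ (h x v u)
  metric_pos : ∀ (x : M) (u : L x), u ≠ 0 → 0 < (h x u u).re
  metric_smooth : ∀ (x : M) (σ τ : Π y : M, L y),
    SmoothSectionAt (E := E) σ x → SmoothSectionAt (E := E) τ x →
      ContMDiffAt 𝓘(ℝ, E) 𝓘(ℝ, ℂ) ∞ (fun y => h y (σ y) (τ y)) x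
  smooth : ∀ (x : M) (X : Π y : M, TangentSpace 𝓘(ℝ, E) y) (σ : Π y : M, L y),
    SmoothFieldAt X x → SmoothSectionAt (E := E) σ x →
      SmoothSectionAt (E := E) (fun y => nabla.toFun σ y (X y)) x
  complex_linear : ∀ (x : M) (c : ℂ) (σ : Π y : M, L y) (v : TangentSpace 𝓘(ℝ, E) x),
    SmoothSectionAt (E := E) σ x →
      nabla.toFun (fun y => c • σ y) x v = c • nabla.toFun σ x v
  metric_compatible : ∀ (x : M) (σ τ : Π y : M, L y) (v : TangentSpace 𝓘(ℝ, E) x),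
    SmoothSectionAt (E := E) σ x → SmoothSectionAt (E := E) τ x →
      mvfderiv 𝓘(ℝ, E) (fun y => h y (σ y) (τ y)) x v =
        h x (nabla.toFun σ x v) (τ x) + h x (σ x) (nabla.toFun τ x v)
  curvature : ∀ (x : M) (X Y : Π y : M, TangentSpace 𝓘(ℝ, E) y) (σ : Π y : M, L y),
    SmoothFieldAt X x → SmoothFieldAt Y x → SmoothSectionAt (E := E) σ x →
      nabla.toFun (fun y => nabla.toFun σ y (Y y)) x (X x)
        - nabla.toFun (fun y => nabla.toFun σ y (X y)) x (Y x)
        - nabla.toFun σ x (VectorField.mlieBracket 𝓘(ℝ, E) X Y x)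
      = ((1 / Complex.I) * (Ω x (X x) (Y x) : ℂ)) • σ x

/-- `T t x : L_x → L_{φ_t(x)}` is the parallel transport along `s ↦ φ_s(x)`, `s` from `0` to `t`,
where `φ` is the flow of `X`. In the frame `e` at `φ_{t₀}(x)`, with `∇_X e = θ e`, the curve
`T_t ξ = g(t) e` is parallel at `t₀` iff `g'(t₀) = -θ g(t₀)`. -/
structure IsParallelTransport [VectorBundle ℂ ℂ L]
    [∀ x, IsTopologicalAddGroup (L x)] [∀ x, ContinuousSMul ℝ (L x)] (nabla : CovariantDerivative 𝓘(ℝ, E) ℂ L)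
    (X : Π x : M, TangentSpace 𝓘(ℝ, E) x) (φ : ℝ → M → M)
    (T : Π (t : ℝ) (x : M), L x ≃ₗ[ℂ] L (φ t x)) : Prop where
  zero : ∀ (x : M) (ξ : L x), (⟨φ 0 x, T 0 x ξ⟩ : TotalSpace ℂ L) = ⟨x, ξ⟩
  parallel : ∀ (t₀ : ℝ) (x : M) (ξ : L x),
    HasDerivAt (fun t => coordAt L (φ t₀ x) (φ t x) (T t x ξ))
      (-(coordAt L (φ t₀ x) (φ t₀ x)
          (nabla.toFun (frameAt L (φ t₀ x)) (φ t₀ x) (X (φ t₀ x))))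
        * coordAt L (φ t₀ x) (φ t₀ x) (T t₀ x ξ)) t₀
  smooth : ∀ (t₀ : ℝ) (x₀ : M), ContMDiffAt (𝓘(ℝ, ℝ).prod 𝓘(ℝ, E)) 𝓘(ℝ, ℂ) ∞
    (fun p : ℝ × M => coordAt L (φ t₀ x₀) (φ p.1 p.2) (T p.1 p.2 (frameAt L x₀ p.2))) (t₀, x₀)

/-- The automorphism `Φ_t = exp(tf)` of `L`, lifting `φ_t`: `Φ_t(ξ) = e^{-itf(x)} T_t ξ` for
`ξ ∈ L_x`. -/
def expAut {φ : ℝ → M → M} (f : M → ℝ) (T : Π (t : ℝ) (x : M), L x ≃ₗ[ℂ] L (φ t x))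
    (t : ℝ) (x : M) : L x ≃ₗ[ℂ] L (φ t x) :=
  (T t x).trans (LinearEquiv.smulOfNeZero ℂ (L (φ t x))
    (Complex.exp (-(Complex.I * (t : ℂ) * (f x : ℂ)))) (Complex.exp_ne_zero _))

end Line

/-! ### Half-form bundles and their morphisms -/

section HalfFormBundle

variable {E : Type*} [NormedAddCommGroup E] [NormedSpace ℝ E]
  {M : Type*} [TopologicalSpace M] [ChartedSpace E M]
  {δ : M → Type*} [TopologicalSpace (TotalSpace ℂ δ)] [∀ x, TopologicalSpace (δ x)]
  [∀ x, AddCommGroup (δ x)] [∀ x, Module ℂ (δ x)] [FiberBundle ℂ δ]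

variable (E δ) in
/-- A half-form bundle `(δ, iso)` of `(M, j)`, with underlying complex line bundle `δ`: a smooth
isomorphism `iso : δ² → Λ^{n,0}_j T^*M` of complex line bundles covering the identity. -/
structure HalfFormBundle [IsManifold 𝓘(ℝ, E) ∞ M] (n : ℕ)
    (j : Π x : M, TangentSpace 𝓘(ℝ, E) x →L[ℝ] TangentSpace 𝓘(ℝ, E) x) where
  iso : Π x : M, (δ x ⊗[ℂ] δ x) ≃ₗ[ℂ] formsN0 n (j x)
  smooth : ∀ (x : M) (σ τ : Π y : M, δ y) (Y : Fin n → Π y : M, TangentSpace 𝓘(ℝ, E) y),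
    SmoothSectionAt (E := E) σ x → SmoothSectionAt (E := E) τ x →
    (∀ i, SmoothFieldAt (Y i) x) →
      ContMDiffAt 𝓘(ℝ, E) 𝓘(ℝ, ℂ) ∞
        (fun y => (iso y (σ y ⊗ₜ τ y) : CForm (TangentSpace 𝓘(ℝ, E) y) n) (fun i => Y i y)) x

variable [IsManifold 𝓘(ℝ, E) ∞ M] {n : ℕ}
  {jref : Π x : M, TangentSpace 𝓘(ℝ, E) x →L[ℝ] TangentSpace 𝓘(ℝ, E) x}

/-- The half-form bundles `(δ_j, φ_j)`, `j ∈ 𝒥`, attached to a reference half-form bundle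
`(jref, δ, φ_ref)`: `δ_j = δ` and `φ_j = Ψ_{jref, j} ∘ φ_ref`. -/
def HalfFormBundle.phi (B : HalfFormBundle E δ n jref)
    (j : Π x : M, TangentSpace 𝓘(ℝ, E) x →L[ℝ] TangentSpace 𝓘(ℝ, E) x) (x : M) :
    (δ x ⊗[ℂ] δ x) →ₗ[ℂ] formsN0 n (j x) :=
  psi n (jref x) (j x) ∘ₗ (B.iso x).toLinearMap

/-- `Ψ` is a half-form bundle morphism `(ja, δ_ja, φ_ja) → (jb, δ_jb, φ_jb)`:
`φ_jb ∘ Ψ² = Ψ_{ja,jb} ∘ φ_ja`. -/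
def HalfFormBundle.IsMorphism (B : HalfFormBundle E δ n jref)
    (ja jb : Π x : M, TangentSpace 𝓘(ℝ, E) x →L[ℝ] TangentSpace 𝓘(ℝ, E) x)
    (Ψ : Π x : M, δ x ≃ₗ[ℂ] δ x) : Prop :=
  ∀ x : M, B.phi jb x ∘ₗ TensorProduct.map (Ψ x).toLinearMap (Ψ x).toLinearMap =
    psi n (ja x) (jb x) ∘ₗ B.phi ja x

variable [VectorBundle ℂ ℂ δ]

/-- `Θ t x : δ_{φ_t(x)} → δ_x` is the lift `φ_t^* : δ_j → δ_{φ_t^* j}` of the pull-back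
`φ_t^* : Λ^{n,0}_j → Λ^{n,0}_{φ_t^* j}`, i.e. `φ_{φ_t^* j} ∘ (φ_t^*)² = φ_t^* ∘ φ_j`, where among
the two choices of sign the one is taken that is continuous and equal to the identity
at `t = 0`. -/
structure HalfFormBundle.IsLift (B : HalfFormBundle E δ n jref) (φ : ℝ → M → M)
    (j : Π x : M, TangentSpace 𝓘(ℝ, E) x →L[ℝ] TangentSpace 𝓘(ℝ, E) x)
    (Θ : Π (t : ℝ) (x : M), δ (φ t x) →ₗ[ℂ] δ x) : Prop where
  square : ∀ (t : ℝ) (x : M) (β β' : δ (φ t x)),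
    (B.phi (pullbackACS (φ t) j) x (Θ t x β ⊗ₜ Θ t x β') : CForm (TangentSpace 𝓘(ℝ, E) x) n) =
      pullbackForm (φ t) x (B.phi j (φ t x) (β ⊗ₜ β'))
  zero : ∀ (x : M) (β : δ (φ 0 x)), (⟨x, Θ 0 x β⟩ : TotalSpace ℂ δ) = ⟨φ 0 x, β⟩
  continuous : ∀ (t₀ : ℝ) (x₀ : M), ContinuousAt
    (fun p : ℝ × M => coordAt δ x₀ p.2 (Θ p.1 p.2 (frameAt δ (φ t₀ x₀) (φ p.1 p.2)))) (t₀, x₀)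

open scoped Classical in
/-- The half-form Lie derivative `D_X b` at `x` of the local frame `b = frameAt δ x` of `δ_j`:
the vector `d ∈ δ_x` such that `p_j (ℒ_X φ_j(b²)) = 2 φ_j(b ⊗ d)` at `x`. -/
def HalfFormBundle.lieFrame (B : HalfFormBundle E δ n jref) (φ : ℝ → M → M)
    (j : Π x : M, TangentSpace 𝓘(ℝ, E) x →L[ℝ] TangentSpace 𝓘(ℝ, E) x) (x : M) : δ x :=
  if h : ∃ d : δ x, ∀ v : Fin n → TangentSpace 𝓘(ℝ, E) x,
      projN0 (j x) (lieForm φ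
        (fun y => (B.phi j y (frameAt δ x y ⊗ₜ frameAt δ x y) :
          CForm (TangentSpace 𝓘(ℝ, E) y) n)) x) v =
      2 * (B.phi j x (frameAt δ x x ⊗ₜ d) : CForm (TangentSpace 𝓘(ℝ, E) x) n) v
  then h.choose else 0

/-- The half-form Lie derivative `D_X` on sections of `δ_j`, along the vector field `X` with flow
`φ`: the first order differential operator with `p_j ℒ_X φ_j(β²) = 2 φ_j(β ⊗ D_X β)`. For
`β = c b` near `x`, with `b` the local frame at `x`, it is `(X c) b + c D_X b`. -/
def HalfFormBundle.lie (B : HalfFormBundle E δ n jref)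
    (X : Π x : M, TangentSpace 𝓘(ℝ, E) x) (φ : ℝ → M → M)
    (j : Π x : M, TangentSpace 𝓘(ℝ, E) x →L[ℝ] TangentSpace 𝓘(ℝ, E) x)
    (β : Π x : M, δ x) (x : M) : δ x :=
  (mvfderiv 𝓘(ℝ, E) (fun y => coordAt δ x y (β y)) x (X x) : ℂ) • frameAt δ x x
    + coordAt δ x x (β x) • B.lieFrame φ j x

end HalfFormBundle

/-! ### Prequantum spaces: sections of `L^k ⊗ δ` -/

section Prequantum

variable {E : Type*} [NormedAddCommGroup E] [NormedSpace ℝ E]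
  {M : Type*} [TopologicalSpace M] [ChartedSpace E M]
  {L : M → Type*} [TopologicalSpace (TotalSpace ℂ L)] [∀ x, TopologicalSpace (L x)]
  [∀ x, AddCommGroup (L x)] [∀ x, Module ℂ (L x)] [FiberBundle ℂ L] [VectorBundle ℂ ℂ L]
  {δ : M → Type*} [TopologicalSpace (TotalSpace ℂ δ)] [∀ x, TopologicalSpace (δ x)]
  [∀ x, AddCommGroup (δ x)] [∀ x, Module ℂ (δ x)] [FiberBundle ℂ δ] [VectorBundle ℂ ℂ δ]

variable (L δ) in
/-- The fibre of `L^k ⊗ δ` at `x`. -/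
abbrev Fibre {M : Type*} (L δ : M → Type*) [∀ x, AddCommGroup (L x)] [∀ x, Module ℂ (L x)]
    [∀ x, AddCommGroup (δ x)] [∀ x, Module ℂ (δ x)] (k : ℕ) (x : M) : Type _ :=
  (⨂[ℂ]^k (L x)) ⊗[ℂ] δ x

variable (L δ) in
/-- The local frame `e^k ⊗ b` of `L^k ⊗ δ` near `x₀`. -/
def tensorFrame (k : ℕ) (x₀ y : M) : Fibre L δ k y :=
  (PiTensorProduct.tprod ℂ (fun _ : Fin k => frameAt L x₀ y)) ⊗ₜ[ℂ] frameAt δ x₀ y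

variable (L δ) in
/-- The coordinate with respect to `tensorFrame`, sending `(α₁ ⊗ ... ⊗ αₖ) ⊗ β` to the product of
the coordinates of the factors. -/
def tensorCoord (k : ℕ) (x₀ y : M) : Fibre L δ k y →ₗ[ℂ] ℂ :=
  LinearMap.mul' ℂ ℂ ∘ₗ TensorProduct.map
    (PiTensorProduct.lift ((MultilinearMap.mkPiAlgebra ℂ (Fin k) ℂ).compLinearMap
      (fun _ => coordAt L x₀ y)))
    (coordAt δ x₀ y)

/-- Smooth sections of `L^k ⊗ δ`, that is, elements of the prequantum space `𝒫_{k,j}` (for every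
`j`, because `δ_j = δ`). -/
def IsSmoothSection (E : Type*) [NormedAddCommGroup E] [NormedSpace ℝ E] [ChartedSpace E M] {k : ℕ}
    (s : Π x : M, Fibre L δ k x) : Prop :=
  ∀ x₀ : M, ContMDiffAt 𝓘(ℝ, E) 𝓘(ℝ, ℂ) ∞ (fun y => tensorCoord L δ k x₀ y (s y)) x₀

/-- A family `(s_t)` of sections of `L^k ⊗ δ` which is smooth jointly in `(t, x)`, i.e. a smooth
curve in the space of smooth sections. -/
def IsSmoothFamily (E : Type*) [NormedAddCommGroup E] [NormedSpace ℝ E] [ChartedSpace E M] {k : ℕ}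
    (s : ℝ → Π x : M, Fibre L δ k x) : Prop :=
  ∀ (t₀ : ℝ) (x₀ : M), ContMDiffAt (𝓘(ℝ, ℝ).prod 𝓘(ℝ, E)) 𝓘(ℝ, ℂ) ∞
    (fun p : ℝ × M => tensorCoord L δ k x₀ p.2 (s p.1 p.2)) (t₀, x₀)

/-- The action `U_t : 𝒫_{k,j} → 𝒫_{k,φ_t^* j}` of an automorphism `Φ_t` of `L` covering `φ_t` and of
the lift `Θ_t = φ_t^* : δ_j → δ_{φ_t^* j}`: `(U_t s)(x) = ((Φ_t^k)⁻¹ ⊗ φ_t^*) (s (φ_t x))`. -/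
def action {k : ℕ} {φ : ℝ → M → M} (Φ : Π (t : ℝ) (x : M), L x ≃ₗ[ℂ] L (φ t x))
    (Θ : Π (t : ℝ) (x : M), δ (φ t x) →ₗ[ℂ] δ x) (t : ℝ) (s : Π x : M, Fibre L δ k x) :
    Π x : M, Fibre L δ k x :=
  fun x => TensorProduct.map (PiTensorProduct.map (fun _ : Fin k => (Φ t x).symm.toLinearMap))
    (Θ t x) (s (φ t x))

variable [IsManifold 𝓘(ℝ, E) ∞ M] {n : ℕ}
  {jref : Π x : M, TangentSpace 𝓘(ℝ, E) x →L[ℝ] TangentSpace 𝓘(ℝ, E) x}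

/-- The operator `∇_X^{L^k} ⊗ Id + Id ⊗ D_X` on sections of `L^k ⊗ δ_j`. For `s = g e^k ⊗ b` near
`x`, with `e` and `b` the local frames at `x`, the Leibniz rule gives
`(X g) e^k ⊗ b + g ((∇_X^{L^k} e^k) ⊗ b + e^k ⊗ D_X b)` with
`∇_X^{L^k} e^k = ∑_i e ⊗ ... ⊗ ∇_X e ⊗ ... ⊗ e`. -/
def tensorDerivative [∀ x, IsTopologicalAddGroup (L x)] [∀ x, ContinuousSMul ℝ (L x)]
    (nabla : CovariantDerivative 𝓘(ℝ, E) ℂ L) (B : HalfFormBundle E δ n jref)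
    (X : Π x : M, TangentSpace 𝓘(ℝ, E) x) (φ : ℝ → M → M)
    (j : Π x : M, TangentSpace 𝓘(ℝ, E) x →L[ℝ] TangentSpace 𝓘(ℝ, E) x) {k : ℕ}
    (s : Π x : M, Fibre L δ k x) : Π x : M, Fibre L δ k x := fun x =>
  (mvfderiv 𝓘(ℝ, E) (fun y => tensorCoord L δ k x y (s y)) x (X x) : ℂ) • tensorFrame L δ k x x
    + tensorCoord L δ k x x (s x) •
      ((∑ i : Fin k, PiTensorProduct.tprod ℂ
          (Function.update (fun _ : Fin k => frameAt L x x) i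
            (nabla.toFun (frameAt L x) x (X x)))) ⊗ₜ[ℂ] frameAt δ x x
        + (PiTensorProduct.tprod ℂ (fun _ : Fin k => frameAt L x x)) ⊗ₜ[ℂ]
            B.lie X φ j (frameAt δ x) x)

/-- `Op_k(f) = f + (1/(ik)) (∇_X^{L^k} ⊗ Id + Id ⊗ D_X)` acting on `𝒫_{k,j}`. -/
def opK [∀ x, IsTopologicalAddGroup (L x)] [∀ x, ContinuousSMul ℝ (L x)]
    (nabla : CovariantDerivative 𝓘(ℝ, E) ℂ L) (B : HalfFormBundle E δ n jref)
    (f : M → ℝ) (X : Π x : M, TangentSpace 𝓘(ℝ, E) x) (φ : ℝ → M → M)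
    (j : Π x : M, TangentSpace 𝓘(ℝ, E) x →L[ℝ] TangentSpace 𝓘(ℝ, E) x) {k : ℕ}
    (s : Π x : M, Fibre L δ k x) : Π x : M, Fibre L δ k x := fun x =>
  (f x : ℂ) • s x + (1 / (Complex.I * (k : ℂ))) • tensorDerivative nabla B X φ j s x

/-- `v` is the covariant derivative at time `t` of the section `s` of `𝒫_k` along the curve `jc` of
almost complex structures: `v = d/du|_{u=t} (Ψ_u)⁻¹ s_u`, where `Ψ_u : δ_{jc t} → δ_{jc u}` is the
continuous family of half-form bundle morphisms with `Ψ_t = Id`. The curve `u ↦ (Ψ_u)⁻¹ s_u` is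
required to be smooth in the `u`-independent space of smooth sections; its derivative is computed
in each fibre. -/
def HasCovDerivAt (B : HalfFormBundle E δ n jref)
    (jc : ℝ → Π x : M, TangentSpace 𝓘(ℝ, E) x →L[ℝ] TangentSpace 𝓘(ℝ, E) x) {k : ℕ}
    (s : ℝ → Π x : M, Fibre L δ k x) (t : ℝ) (v : Π x : M, Fibre L δ k x) : Prop :=
  ∃ Ψ : ℝ → Π x : M, δ x ≃ₗ[ℂ] δ x,
    (∀ u, B.IsMorphism (jc t) (jc u) (Ψ u)) ∧
    (∀ x, Ψ t x = LinearEquiv.refl ℂ (δ x)) ∧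
    (∀ (u₀ : ℝ) (x₀ : M), ContinuousAt
      (fun p : ℝ × M => coordAt δ x₀ p.2 (Ψ p.1 p.2 (frameAt δ x₀ p.2))) (u₀, x₀)) ∧
    IsSmoothFamily E
      (fun u x => TensorProduct.map LinearMap.id (Ψ u x).symm.toLinearMap (s u x)) ∧
    ∀ (x : M) (l : Fibre L δ k x →ₗ[ℂ] ℂ), HasDerivAt
      (fun u => l (TensorProduct.map LinearMap.id (Ψ u x).symm.toLinearMap (s u x))) (l (v x)) t

end Prequantum

end HalfForm

end

/-!
The identity is checked pointwise, in the local frames `e` of `L` and `b` of `δ` centred at a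
point `x`. For `s_t = U_t s` the group law of the flow expresses `(U_{t+h} s)(x)` by the value of
`U_t s` at `φ_h(x)` and three scalar factors (`tensorCoord_action_add`): the phase `e^{ikhf(x)}`,
because `f` is constant along its flow; the inverse `k`-th power of the parallel transport along
the flow line of `x`; and the ratio `ρ_h` of the lifts of the flow to `δ` at the times `t + h` and
`t`. Differentiating in `h` gives the derivative of `s_t` in the fixed bundle `δ`
(`hasDerivAt_tensorCoord_action`): it is `X g + g (k (i f + θ) + ρ')`, where `g` is the coordinate
of `s_t` and `∇_X e = θ e`. The covariant derivative along the curve `j_t` subtracts the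
logarithmic derivative `ψ'` of the family `Ψ_u : δ_{j_t} → δ_{j_u}`. What remains is
`D_X b = (ρ' - ψ') b` (`lieFrame_eq`), and `hasCovDerivAt_action` collects the terms.

For `lieFrame_eq`, the map `½ (1 - j_b j_a)` intertwines `j_a` and `j_b`, and on `Λ^{n,0}_{j_b}`
the pull-back by it is the projection to `Λ^{n,0}_{j_a}` (`projN0_eq_comp_midMap`). Since a wedge
product with the conjugate of a form of type `(n,0)` for `j_a` only sees the `(n,0)`-part of the
other factor (`typeEval_wedge`), that projection is the inverse of `Ψ_{j_a,j_b}`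
(`psi_apply_midMap`), the map being bijective for two compatible positive structures
(`midMap_injective`). Hence `p_{j_t} φ_h^* φ_{j_t}(b²) = (ρ_h / ψ_{t+h})² φ_{j_t}(b²)`, and the
derivative at `h = 0` is `2 (ρ' - ψ') φ_{j_t}(b²)`.

The same description shows that `φ_j(b²)` depends smoothly on the point and on `j`
(`contMDiffAt_phi`). The lift of the flow and the family `Ψ_u` are therefore square roots of
smooth nowhere vanishing functions of time and space. The signs of the square roots are governed
by a two-sheeted covering of `ℝ × M`, whose sections over one time extend to all times
(`exists_sign_extension`); a continuous square root is then smooth (`contMDiffAt_of_sq`). This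
gives `exists_isLift` and `exists_morphism_family`; uniqueness of the lift,
`HalfFormBundle.IsLift.unique`, holds because a continuous sign on `ℝ` is constant.

The curve `j_t` stays in the space of compatible positive structures because the flow preserves
`Ω` (`form_mfderiv`), which in charts is Cartan's formula for `dΩ = 0` together with the symmetry
of the second derivative of `f` (`hasDerivAt_form_mfderiv_zero`).
-/

noncomputable section

namespace HalfForm

/-! ### The maps `Ψ` between lines of top-degree holomorphic forms -/

section LinearAlgebraLemmas

variable {V : Type*} [AddCommGroup V] [Module ℝ V] [TopologicalSpace V] {n : ℕ}

/-- On an `(n,0)`-form, substituting `j v` for `v` in the slots of `S` multiplies by `i^|S|`. -/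
theorem apply_toggle_of_mem_formsN0 {j : V →L[ℝ] V} {α : CForm V n} (hα : α ∈ formsN0 n j)
    (S : Finset (Fin n)) (v : Fin n → V) :
    α (fun i => if i ∈ S then j (v i) else v i) = Complex.I ^ S.card * α v := by
  induction S using Finset.induction_on with
  | empty => simp
  | insert a S ha ih =>
    have h := hα (fun i => if i ∈ S then j (v i) else v i) a
    have e : (fun i => if i ∈ insert a S then j (v i) else v i) =
        Function.update (fun i => if i ∈ S then j (v i) else v i) a
          (j ((fun i => if i ∈ S then j (v i) else v i) a)) := by
      funext i
      by_cases hi : i = a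
      · subst hi; simp [ha]
      · simp [hi]
    rw [e, h, ih, Finset.card_insert_of_notMem ha, pow_succ]
    ring

omit [TopologicalSpace V] in
theorem conjForm_apply (β : CForm V n) (v : Fin n → V) :
    conjForm β v = starRingEnd ℂ (β v) := rfl

theorem sum_finset_mul_pow {m : ℕ} (d : Fin m → ℂ) (z : ℂ) :
    ∑ S : Finset (Fin m), (∏ k ∈ S, d k) * z ^ S.card = ∏ k, (1 + d k * z) := by
  rw [Finset.prod_one_add, Finset.powerset_univ]
  refine Finset.sum_congr rfl fun S _ => ?_
  rw [Finset.prod_mul_distrib, Finset.prod_const]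

/-- The coefficients `-i` on the first block and `i` on the second block: weighting by them the
substitution of `j v` for `v` evaluates a form on `(1,0)`-vectors, resp. `(0,1)`-vectors. -/
def typeSign : Fin n ⊕ Fin n → ℂ := Sum.elim (fun _ => -Complex.I) (fun _ => Complex.I)

/-- The value (up to a power of two) of the complex-multilinear extension of a `2n`-form `Φ` on
the vectors `e₁^{1,0}, …, eₙ^{1,0}, e₁^{0,1}, …, eₙ^{0,1}`. -/
def typeEval (j : V →L[ℝ] V) (e : Fin n → V) (Φ : (Fin n ⊕ Fin n → V) → ℂ) : ℂ :=
  ∑ S : Finset (Fin n ⊕ Fin n), (∏ k ∈ S, typeSign k) *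
    Φ (fun k => if k ∈ S then j (Sum.elim e e k) else Sum.elim e e k)

omit [TopologicalSpace V] in
/-- The wedge product as an alternating sum over all permutations. Each shuffle is counted `n! n!`
times, hence the factor on the left; avoiding shuffles makes the sum easy to evaluate. -/
theorem factorial_smul_wedge (γ β : CForm V n) (w : Fin n ⊕ Fin n → V) :
    ((n.factorial * n.factorial : ℕ) : ℂ) * wedge γ β w =
      ∑ σ : Equiv.Perm (Fin n ⊕ Fin n), ((Equiv.Perm.sign σ : ℤ) : ℂ) *
        (γ (fun i => w (σ (Sum.inl i))) * β (fun i => w (σ (Sum.inr i)))) := by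
  have h := MultilinearMap.domCoprod_alternization_eq γ β
  have h2 := congrArg (fun F => LinearMap.mul' ℝ ℂ (F w)) h
  simp only [Fintype.card_fin] at h2
  rw [← nsmul_eq_mul]
  have e1 : wedge γ β w = LinearMap.mul' ℝ ℂ (γ.domCoprod β w) := rfl
  rw [e1, ← map_nsmul]
  rw [AlternatingMap.smul_apply] at h2
  rw [← h2, MultilinearMap.alternatization_apply, map_sum]
  refine Finset.sum_congr rfl fun σ _ => ?_
  rw [MultilinearMap.domDomCongr_apply, MultilinearMap.domCoprod_apply]
  rcases Int.units_eq_one_or (Equiv.Perm.sign σ) with hs | hs <;> simp [hs]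

end LinearAlgebraLemmas

section
variable {V : Type*} [AddCommGroup V] [Module ℝ V] [TopologicalSpace V] {n : ℕ}

/-- Only permutations preserving the two blocks contribute to the evaluation of a wedge product
`γ ∧ β̄` on vectors of type `(1,0)` followed by vectors of type `(0,1)`. -/
theorem typeEval_summand {j : V →L[ℝ] V} {γ γp β : CForm V n} (hβ : β ∈ formsN0 n j)
    (hγ : ∀ v, projN0 j γ v = γp v) (e : Fin n → V) (σ : Equiv.Perm (Fin n ⊕ Fin n)) :
    typeEval j e (fun w => ((Equiv.Perm.sign σ : ℤ) : ℂ) *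
        (γ (fun i => w (σ (Sum.inl i))) * conjForm β (fun i => w (σ (Sum.inr i))))) =
      (if ∀ i, (σ (Sum.inr i)).isRight then 1 else 0) * (4 ^ n * (γp e * conjForm β e)) := by
  set w : Fin n ⊕ Fin n → V := Sum.elim e e with hw
  have step : typeEval j e (fun w => ((Equiv.Perm.sign σ : ℤ) : ℂ) *
        (γ (fun i => w (σ (Sum.inl i))) * conjForm β (fun i => w (σ (Sum.inr i))))) =
      ((Equiv.Perm.sign σ : ℤ) : ℂ) *
       ((∑ S : Finset (Fin n), (∏ i ∈ S, typeSign (σ (Sum.inl i))) *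
          γ (fun i => if i ∈ S then j (w (σ (Sum.inl i))) else w (σ (Sum.inl i)))) *
        (∑ S : Finset (Fin n), (∏ i ∈ S, typeSign (σ (Sum.inr i))) *
          conjForm β (fun i => if i ∈ S then j (w (σ (Sum.inr i))) else w (σ (Sum.inr i))))) := by
    rw [Finset.sum_mul_sum, ← Finset.sum_product', Finset.univ_product_univ, Finset.mul_sum]
    unfold typeEval
    -- a subset of both blocks, transported by `σ`, is a pair of subsets of the blocks
    refine (Fintype.sum_equiv
      ((Finset.sumEquiv (α := Fin n) (β := Fin n)).symm.toEquiv.trans (Equiv.finsetCongr σ))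
      _ _ ?_).symm
    rintro ⟨S, R⟩
    have e1 : ((Finset.sumEquiv (α := Fin n) (β := Fin n)).symm.toEquiv.trans
        (Equiv.finsetCongr σ)) (S, R) = (S.disjSum R).map σ.toEmbedding := rfl
    rw [e1, Finset.prod_map, Finset.prod_disjSum]
    simp only [Equiv.coe_toEmbedding, Finset.mem_map_equiv, Equiv.symm_apply_apply,
      Finset.inl_mem_disjSum, Finset.inr_mem_disjSum]
    ring
  rw [step]
  -- `β̄` is antilinear, so its sum factors over the slots; a slot filled with a `(1,0)`-vector
  -- contributes `1 + (-i)(-i) = 0`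
  have hR : (∑ S : Finset (Fin n), (∏ i ∈ S, typeSign (σ (Sum.inr i))) *
          conjForm β (fun i => if i ∈ S then j (w (σ (Sum.inr i))) else w (σ (Sum.inr i)))) =
      (∏ i, (1 + typeSign (σ (Sum.inr i)) * (-Complex.I))) *
        conjForm β (fun i => w (σ (Sum.inr i))) := by
    rw [← sum_finset_mul_pow, Finset.sum_mul]
    refine Finset.sum_congr rfl fun S _ => ?_
    rw [conjForm_apply, apply_toggle_of_mem_formsN0 hβ, map_mul, map_pow, Complex.conj_I,
      conjForm_apply]
    ring
  rw [hR]
  by_cases hσ : ∀ i, (σ (Sum.inr i)).isRight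
  · have hmem : σ ∈ (Equiv.Perm.sumCongrHom (Fin n) (Fin n)).range := by
      -- a permutation preserving the second block preserves the first, by counting
      refine Equiv.Perm.mem_sumCongrHom_range_of_perm_mapsTo_inl ?_
      rintro _ ⟨a, rfl⟩
      have hex : ∀ i, ∃ b, σ (Sum.inr i) = Sum.inr b := fun i => Sum.isRight_iff.1 (hσ i)
      choose b hb using hex
      have hbs : Function.Surjective b := Finite.surjective_of_injective fun i i' h => by
        have := σ.injective (((hb i).trans (congrArg Sum.inr h)).trans (hb i').symm)
        exact Sum.inr_injective this
      cases h : σ (Sum.inl a) with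
      | inl c => exact ⟨c, rfl⟩
      | inr c =>
        obtain ⟨i, hi⟩ := hbs c
        have := σ.injective (h.trans ((congrArg Sum.inr hi.symm).trans (hb i).symm))
        simp at this
    obtain ⟨⟨σ₁, σ₂⟩, rfl⟩ := hmem
    simp only [hσ, implies_true, if_true, one_mul]
    have h1 : ∀ i, typeSign (n := n) ((Equiv.Perm.sumCongrHom (Fin n) (Fin n)) (σ₁, σ₂) (Sum.inl i))
      = -Complex.I := fun i => rfl
    have h2 : ∀ i, typeSign (n := n) ((Equiv.Perm.sumCongrHom (Fin n) (Fin n)) (σ₁, σ₂) (Sum.inr i))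
      = Complex.I := fun i => rfl
    have h3 : ∀ i, w ((Equiv.Perm.sumCongrHom (Fin n) (Fin n)) (σ₁, σ₂) (Sum.inl i)) = e (σ₁ i) :=
      fun i => rfl
    have h4 : ∀ i, w ((Equiv.Perm.sumCongrHom (Fin n) (Fin n)) (σ₁, σ₂) (Sum.inr i)) = e (σ₂ i) :=
      fun i => rfl
    simp only [h1, h2, h3, h4]
    have hL : ∑ S : Finset (Fin n), (∏ i ∈ S, -Complex.I) *
        γ (fun i => if i ∈ S then j (e (σ₁ i)) else e (σ₁ i)) = 2 ^ n * γp (fun i => e (σ₁ i)) := by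
      rw [← hγ, projN0, Finset.mul_sum]
      refine Finset.sum_congr rfl fun S _ => ?_
      rw [Finset.prod_const, ← mul_assoc, ← mul_assoc, ← mul_pow]
      norm_num
    rw [hL]
    have h5 := γp.map_perm e σ₁
    have h6 := (conjForm β).map_perm e σ₂
    simp only [Function.comp_def] at h5 h6
    rw [h5, h6]
    simp only [mul_neg, Complex.I_mul_I, neg_neg, Finset.prod_const, Finset.card_univ,
      Fintype.card_fin]
    have h7 : (4 : ℂ) ^ n = 2 ^ n * 2 ^ n := by rw [← mul_pow]; norm_num
    rw [h7]
    have h8 : (1 + 1 : ℂ) = 2 := by norm_num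
    rw [h8]
    rcases Int.units_eq_one_or (Equiv.Perm.sign σ₁) with hs | hs <;>
      rcases Int.units_eq_one_or (Equiv.Perm.sign σ₂) with hs' | hs' <;>
      simp [hs, hs'] <;> ring
  · rw [if_neg hσ]
    push Not at hσ
    obtain ⟨i, hi⟩ := hσ
    have h0 : 1 + typeSign (σ (Sum.inr i)) * (-Complex.I) = 0 := by
      cases h : σ (Sum.inr i) with
      | inl a => simp [typeSign]
      | inr a => simp [h] at hi
    rw [Finset.prod_eq_zero (Finset.mem_univ i) h0]
    ring

/-- The constant relating `γ ∧ β̄` on vectors of types `(1,0)` and `(0,1)` to the product of the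
values of `γ` and `β̄`. -/
def blockConst (n : ℕ) : ℂ :=
  4 ^ n * (∑ σ : Equiv.Perm (Fin n ⊕ Fin n),
    if ∀ i, (σ (Sum.inr i)).isRight then 1 else 0 : ℕ) / (n.factorial * n.factorial : ℕ)

theorem blockConst_ne_zero (n : ℕ) : blockConst n ≠ 0 := by
  unfold blockConst
  have h1 : ((n.factorial * n.factorial : ℕ) : ℂ) ≠ 0 := by
    exact_mod_cast Nat.mul_ne_zero n.factorial_ne_zero n.factorial_ne_zero
  have h2 : (∑ σ : Equiv.Perm (Fin n ⊕ Fin n),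
      if ∀ i, (σ (Sum.inr i)).isRight then 1 else 0 : ℕ) ≠ 0 := by
    refine (Finset.sum_pos' (fun _ _ => Nat.zero_le _) ⟨1, Finset.mem_univ _, ?_⟩).ne'
    simp
  have h3 : ((∑ σ : Equiv.Perm (Fin n ⊕ Fin n),
      if ∀ i, (σ (Sum.inr i)).isRight then 1 else 0 : ℕ) : ℂ) ≠ 0 := by exact_mod_cast h2
  exact div_ne_zero (mul_ne_zero (pow_ne_zero _ (by norm_num)) h3) h1

/-- The wedge product `γ ∧ β̄` with `β` of type `(n,0)` only sees the `(n,0)`-part `γp` of `γ`. -/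
theorem typeEval_wedge {j : V →L[ℝ] V} {γ γp β : CForm V n} (hβ : β ∈ formsN0 n j)
    (hγ : ∀ v, projN0 j γ v = γp v) (e : Fin n → V) :
    typeEval j e (wedge γ (conjForm β)) = blockConst n * (γp e * conjForm β e) := by
  have h1 : ((n.factorial * n.factorial : ℕ) : ℂ) ≠ 0 := by
    exact_mod_cast Nat.mul_ne_zero n.factorial_ne_zero n.factorial_ne_zero
  have h := Finset.sum_congr rfl fun σ (_ : σ ∈ (Finset.univ : Finset (Equiv.Perm (Fin n ⊕ Fin n))))
    => typeEval_summand hβ hγ e σ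
  have hl : ((n.factorial * n.factorial : ℕ) : ℂ) * typeEval j e (wedge γ (conjForm β)) =
      ∑ σ : Equiv.Perm (Fin n ⊕ Fin n), typeEval j e (fun w => ((Equiv.Perm.sign σ : ℤ) : ℂ) *
        (γ (fun i => w (σ (Sum.inl i))) * conjForm β (fun i => w (σ (Sum.inr i))))) := by
    unfold typeEval
    rw [Finset.sum_comm, Finset.mul_sum]
    refine Finset.sum_congr rfl fun S _ => ?_
    rw [← Finset.mul_sum]
    have hw := factorial_smul_wedge γ (conjForm β)
      (fun k => if k ∈ S then j (Sum.elim e e k) else Sum.elim e e k)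
    linear_combination (∏ k ∈ S, typeSign k) * hw
  rw [h, ← Finset.sum_mul] at hl
  rw [blockConst, div_mul_eq_mul_div, eq_div_iff h1, mul_comm, hl]
  push_cast
  ring

/-- A form of top degree is determined by its evaluation on vectors of types `(1,0)` and `(0,1)`,
as soon as that evaluation does not vanish identically. -/
theorem wedge_eq_of_typeEval_eq [FiniteDimensional ℝ V] (hV : Module.finrank ℝ V = 2 * n)
    {j : V →L[ℝ] V} {e : Fin n → V} {Φ₀ Φ₁ Φ₂ : V [⋀^Fin n ⊕ Fin n]→ₗ[ℝ] ℂ}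
    (h0 : typeEval j e Φ₀ ≠ 0) (h : typeEval j e Φ₁ = typeEval j e Φ₂) : Φ₁ = Φ₂ := by
  have hc : Module.finrank ℝ V = Fintype.card (Fin n ⊕ Fin n) := by simp [hV, two_mul]
  let b : Module.Basis (Fin n ⊕ Fin n) ℝ V := (Module.finBasisOfFinrankEq ℝ V hc).reindex
    (Fintype.equivFin (Fin n ⊕ Fin n)).symm
  -- forms of top degree are multiples of the determinant
  have key : ∀ (Φ : V [⋀^Fin n ⊕ Fin n]→ₗ[ℝ] ℂ) (v : Fin n ⊕ Fin n → V),
      Φ v = (b.det v : ℂ) * Φ b := by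
    intro Φ v
    have : Φ = (LinearMap.toSpanSingleton ℝ ℂ (Φ b)).compAlternatingMap b.det := by
      refine Module.Basis.ext_alternating b fun i hi => ?_
      let σ : Equiv.Perm (Fin n ⊕ Fin n) :=
        Equiv.ofBijective i (Finite.injective_iff_bijective.1 hi)
      change Φ (b ∘ σ) = LinearMap.toSpanSingleton ℝ ℂ (Φ b) (b.det (b ∘ σ))
      rw [AlternatingMap.map_perm, AlternatingMap.map_perm, Module.Basis.det_self]
      rcases Int.units_eq_one_or (Equiv.Perm.sign σ) with hs | hs <;> simp [hs]
    conv_lhs => rw [this]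
    simp
  have key2 : ∀ Φ : V [⋀^Fin n ⊕ Fin n]→ₗ[ℝ] ℂ,
      typeEval j e Φ = typeEval j e (fun v => (b.det v : ℂ)) * Φ b := by
    intro Φ
    unfold typeEval
    rw [Finset.sum_mul]
    refine Finset.sum_congr rfl fun S _ => ?_
    rw [key Φ, mul_assoc]
  have hne : typeEval j e (fun v => (b.det v : ℂ)) ≠ 0 := fun hz => h0 (by rw [key2, hz, zero_mul])
  rw [key2 Φ₁, key2 Φ₂] at h
  have hb := mul_left_cancel₀ hne h
  ext v
  rw [key Φ₁, key Φ₂, hb]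

/-- The map `(1 - j_b j_a) / 2`. It intertwines the complex structures `j_a` and `j_b`, and
pulling back by it is the projection of `Λ^{n,0}_{j_b}` to `Λ^{n,0}_{j_a}`. -/
def midMap (ja jb : V →L[ℝ] V) : V →ₗ[ℝ] V :=
  (1 / 2 : ℝ) • (LinearMap.id - jb.toLinearMap ∘ₗ ja.toLinearMap)

theorem midMap_apply (ja jb : V →L[ℝ] V) (v : V) :
    midMap ja jb v = (1 / 2 : ℝ) • (v - jb (ja v)) := rfl

theorem midMap_comm {ja jb : V →L[ℝ] V} (ha : ∀ v, ja (ja v) = -v) (hb : ∀ v, jb (jb v) = -v)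
    (v : V) : midMap ja jb (ja v) = jb (midMap ja jb v) := by
  simp only [midMap_apply, map_smul, map_sub, ha, hb, map_neg, sub_neg_eq_add]
  rw [add_comm]

/-- On `Λ^{n,0}_{j_b}` the projection to `Λ^{n,0}_{j_a}` is a pull-back: multilinear expansion of
`α(½ (v₁ - j_b j_a v₁), …)`, where `α(j_b ·) = i α` turns each `j_b` into the factor `i`. -/
theorem projN0_eq_comp_midMap {ja jb : V →L[ℝ] V} {α : CForm V n} (hα : α ∈ formsN0 n jb)
    (v : Fin n → V) : projN0 ja α v = α (fun i => midMap ja jb (v i)) := by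
  have e1 : (fun i => midMap ja jb (v i)) =
      (fun i => (-(1 / 2) : ℝ) • jb (ja (v i))) + fun i => (1 / 2 : ℝ) • v i := by
    funext i
    simp only [midMap_apply, Pi.add_apply, smul_sub, neg_smul]
    abel
  have e2 := α.toMultilinearMap.map_add_univ (fun i => (-(1 / 2) : ℝ) • jb (ja (v i)))
    (fun i => (1 / 2 : ℝ) • v i)
  rw [e1]
  refine Eq.trans ?_ e2.symm
  unfold projN0
  refine Finset.sum_congr rfl fun S _ => ?_
  have e3 : S.piecewise (fun i => (-(1 / 2) : ℝ) • jb (ja (v i))) (fun i => (1 / 2 : ℝ) • v i) =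
      fun i => (if i ∈ S then (-(1 / 2) : ℝ) else 1 / 2) •
        (if i ∈ S then jb ((fun i => if i ∈ S then ja (v i) else v i) i) else
          (fun i => if i ∈ S then ja (v i) else v i) i) := by
    funext i
    by_cases hi : i ∈ S <;> simp [hi, Finset.piecewise]
  rw [e3]
  rw [MultilinearMap.map_smul_univ, Finset.prod_ite]
  have e4 := apply_toggle_of_mem_formsN0 hα S (fun i => if i ∈ S then ja (v i) else v i)
  change _ = _ • α _
  rw [e4]
  simp only [Finset.prod_const, Finset.filter_mem_eq_inter, Finset.univ_inter, Complex.real_smul]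
  have e5 : (Finset.univ.filter fun x => x ∉ S).card = n - S.card := by
    rw [Finset.filter_not, Finset.filter_mem_eq_inter, Finset.univ_inter,
      ← Finset.compl_eq_univ_sdiff, Finset.card_compl, Fintype.card_fin]
  have e6 : S.card ≤ n := by simpa using Finset.card_le_univ S
  rw [e5]
  push_cast
  have e7 : (1 / 2 : ℂ) ^ n = (1 / 2) ^ S.card * (1 / 2) ^ (n - S.card) := by
    rw [← pow_add, Nat.add_sub_cancel' e6]
  have e8 : (-Complex.I) ^ S.card * (1 / 2) ^ S.card = (-(1 / 2)) ^ S.card * Complex.I ^ S.card := by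
    rw [← mul_pow, ← mul_pow]; congr 1; ring
  rw [e7]
  linear_combination (1 / 2) ^ (n - S.card) *
    (α fun i => if i ∈ S then ja (v i) else v i) * e8

theorem projN0_of_mem {j : V →L[ℝ] V} (hj : ∀ v, j (j v) = -v) {α : CForm V n}
    (hα : α ∈ formsN0 n j) (v : Fin n → V) : projN0 j α v = α v := by
  rw [projN0_eq_comp_midMap hα]
  congr 1
  funext i
  rw [midMap_apply, hj, sub_neg_eq_add, ← two_smul ℝ, smul_smul]
  norm_num

theorem comp_mem_formsN0 {W : Type*} [AddCommGroup W] [Module ℝ W] [TopologicalSpace W]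
    {ja : V →L[ℝ] V} {jb : W →L[ℝ] W} {A : V →ₗ[ℝ] W} (hA : ∀ v, A (ja v) = jb (A v))
    {α : CForm W n} (hα : α ∈ formsN0 n jb) : α.compLinearMap A ∈ formsN0 n ja := by
  intro v i
  have h := hα (fun i => A (v i)) i
  have e : (fun k => A (Function.update v i (ja (v i)) k)) =
      Function.update (fun i => A (v i)) i (jb (A (v i))) := by
    funext k
    by_cases hk : k = i
    · subst hk; simp [hA]
    · simp [hk]
  rw [AlternatingMap.compLinearMap_apply, AlternatingMap.compLinearMap_apply]
  change α (fun k => A (Function.update v i (ja (v i)) k)) = _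
  rw [e, h]

/-- `Ψ_{ja,jb}` is the inverse of the pull-back by `midMap ja jb`. -/
theorem psi_apply_midMap [FiniteDimensional ℝ V] (hV : Module.finrank ℝ V = 2 * n)
    {ja jb : V →L[ℝ] V} (ha : ∀ v, ja (ja v) = -v) (hb : ∀ v, jb (jb v) = -v)
    (hinj : Function.Injective (midMap ja jb)) (α : formsN0 n ja) (v : Fin n → V) :
    (psi n ja jb α : CForm V n) (fun i => midMap ja jb (v i)) = (α : CForm V n) v := by
  let A : V ≃ₗ[ℝ] V := LinearEquiv.ofInjectiveEndo _ hinj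
  have hAv : ∀ v, A v = midMap ja jb v := fun v => rfl
  have hAs : ∀ v, A.symm (jb v) = ja (A.symm v) := fun v => by
    rw [LinearEquiv.symm_apply_eq, hAv, midMap_comm ha hb, ← hAv, LinearEquiv.apply_symm_apply]
  -- the pull-back by the inverse of `midMap` has the defining property of `Ψ`, so `psi` is not zero
  -- by default
  let T : formsN0 n ja →ₗ[ℂ] formsN0 n jb :=
    { toFun := fun α => ⟨(α : CForm V n).compLinearMap A.symm.toLinearMap,
        comp_mem_formsN0 hAs α.2⟩
      map_add' := fun _ _ => rfl
      map_smul' := fun _ _ => rfl }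
  have hT : ∃ T : formsN0 n ja →ₗ[ℂ] formsN0 n jb, ∀ α β : formsN0 n ja,
      wedge (T α : CForm V n) (conjForm (β : CForm V n)) =
        wedge (α : CForm V n) (conjForm (β : CForm V n)) := by
    refine ⟨T, fun α β => ?_⟩
    by_cases hβ : ∃ e, (β : CForm V n) e ≠ 0
    · obtain ⟨e, he⟩ := hβ
      refine wedge_eq_of_typeEval_eq (Φ₀ := wedge (β : CForm V n) (conjForm (β : CForm V n)))
        (j := ja) (e := e) hV ?_ ?_
      · rw [typeEval_wedge β.2 (projN0_of_mem ha β.2)]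
        refine mul_ne_zero (blockConst_ne_zero n) (mul_ne_zero he ?_)
        rw [conjForm_apply]
        exact (map_ne_zero _).2 he
      · rw [typeEval_wedge β.2 (projN0_of_mem ha α.2), typeEval_wedge (γp := α) β.2]
        intro v
        rw [projN0_eq_comp_midMap (T α).2]
        change (α : CForm V n) (fun i => A.symm (A (v i))) = _
        simp
    · push Not at hβ
      have h0 : conjForm (β : CForm V n) = 0 := by
        ext v; rw [conjForm_apply, hβ]; simp
      have hz : ∀ γ : CForm V n, wedge γ (0 : CForm V n) = 0 := fun γ => by
        have e1 : γ.domCoprod (0 : CForm V n) = 0 := by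
          rw [← AlternatingMap.domCoprod'_apply, TensorProduct.tmul_zero, map_zero]
        rw [wedge, e1]
        ext v
        simp
      rw [h0, hz, hz]
  have hpsi : ∀ α β : formsN0 n ja,
      wedge (psi n ja jb α : CForm V n) (conjForm (β : CForm V n)) =
        wedge (α : CForm V n) (conjForm (β : CForm V n)) := by
    rw [psi, dif_pos hT]; exact hT.choose_spec
  -- if some `(n,0)`-form does not vanish on `v`, testing the defining property of `Ψ` against it
  -- determines the value; otherwise both sides vanish
  have hmem := comp_mem_formsN0 (midMap_comm ha hb) (psi n ja jb α).2
  by_cases hβ : ∃ β : formsN0 n ja, (β : CForm V n) v ≠ 0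
  · obtain ⟨β, hβ⟩ := hβ
    have h := congrArg (fun Φ : V [⋀^Fin n ⊕ Fin n]→ₗ[ℝ] ℂ => typeEval ja v Φ) (hpsi α β)
    rw [typeEval_wedge β.2 (projN0_of_mem ha α.2),
      typeEval_wedge (γp := (psi n ja jb α : CForm V n).compLinearMap (midMap ja jb)) β.2
        (projN0_eq_comp_midMap (psi n ja jb α).2)] at h
    refine mul_right_cancel₀ ?_ (mul_left_cancel₀ (blockConst_ne_zero n) h)
    rw [conjForm_apply]
    exact (map_ne_zero _).2 hβ
  · push Not at hβ
    rw [hβ α]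
    exact hβ ⟨_, hmem⟩

/-- Positivity of both structures makes `1 - j_b j_a` injective. -/
theorem midMap_injective {Ω : V →ₗ[ℝ] V →ₗ[ℝ] ℝ} {ja jb : V →L[ℝ] V}
    (hb : ∀ v, jb (jb v) = -v) (pa : ∀ v, v ≠ 0 → 0 < Ω v (ja v))
    (pb : ∀ v, v ≠ 0 → 0 < Ω v (jb v)) : Function.Injective (midMap ja jb) := by
  rw [← LinearMap.ker_eq_bot, LinearMap.ker_eq_bot']
  intro v hv
  by_contra hne
  rw [midMap_apply, smul_eq_zero_iff_right (by norm_num), sub_eq_zero] at hv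
  have h1 : jb v = -ja v := by
    conv_lhs => rw [hv]
    rw [hb]
  have h2 := pa v hne
  have h3 := pb v hne
  rw [h1, map_neg] at h3
  linarith

end

/-! ### Coordinates on complex line bundles -/

section LineCoordinates

variable {E : Type*} [NormedAddCommGroup E] [NormedSpace ℝ E]
  {M : Type*} [TopologicalSpace M] [ChartedSpace E M]
  {L : M → Type*} [TopologicalSpace (TotalSpace ℂ L)] [∀ x, TopologicalSpace (L x)]
  [∀ x, AddCommGroup (L x)] [∀ x, Module ℂ (L x)] [FiberBundle ℂ L] [VectorBundle ℂ ℂ L]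

variable (L) in
/-- The domain of `frameAt L x₀`. -/
abbrev frameDom (x₀ : M) : Set M := (trivializationAt ℂ L x₀).baseSet

variable (L) in
omit [∀ x, AddCommGroup (L x)] [∀ x, Module ℂ (L x)] [VectorBundle ℂ ℂ L] in
theorem mem_frameDom (x₀ : M) : x₀ ∈ frameDom L x₀ := mem_baseSet_trivializationAt ℂ L x₀

variable (L) in
omit [∀ x, AddCommGroup (L x)] [∀ x, Module ℂ (L x)] [VectorBundle ℂ ℂ L] in
theorem frameDom_mem_nhds (x₀ : M) : frameDom L x₀ ∈ 𝓝 x₀ :=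
  (trivializationAt ℂ L x₀).open_baseSet.mem_nhds (mem_frameDom L x₀)

theorem coordAt_frameAt {x₀ y : M} (hy : y ∈ frameDom L x₀) :
    coordAt L x₀ y (frameAt L x₀ y) = 1 := by
  rw [coordAt, Trivialization.coe_linearMapAt_of_mem _ hy]
  exact congrArg Prod.snd (Trivialization.apply_mk_symm _ hy 1)

theorem coordAt_smul_frameAt {x₀ y : M} (hy : y ∈ frameDom L x₀) (u : L y) :
    coordAt L x₀ y u • frameAt L x₀ y = u := by
  have h := (trivializationAt ℂ L x₀).symmₗ_linearMapAt (R := ℂ) hy u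
  have h2 : frameAt L x₀ y = (trivializationAt ℂ L x₀).symmₗ ℂ y 1 := by
    rw [Trivialization.coe_symmₗ _ hy, frameAt]
  rw [h2, ← map_smul, smul_eq_mul, mul_one]
  exact h

theorem frameAt_ne_zero {x₀ y : M} (hy : y ∈ frameDom L x₀) : frameAt L x₀ y ≠ 0 := by
  intro h
  have := coordAt_frameAt hy
  rw [h, map_zero] at this
  exact zero_ne_one this

theorem coordAt_eq_zero_iff {x₀ y : M} (hy : y ∈ frameDom L x₀) (u : L y) :
    coordAt L x₀ y u = 0 ↔ u = 0 := by
  refine ⟨fun h => ?_, fun h => by rw [h, map_zero]⟩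
  rw [← coordAt_smul_frameAt hy u, h, zero_smul]

theorem coordAt_change {x₁ y : M} (hy : y ∈ frameDom L x₁) (x₀ : M) (u : L y) :
    coordAt L x₀ y u = coordAt L x₁ y u * coordAt L x₀ y (frameAt L x₁ y) := by
  conv_lhs => rw [← coordAt_smul_frameAt hy u, map_smul, smul_eq_mul]

/-- A linear map between one-dimensional fibres is multiplication by its coordinate. -/
theorem map_eq_coord_smul {N : Type*} [AddCommGroup N] [Module ℂ N] {x₀ y : M}
    (hy : y ∈ frameDom L x₀) (F : L y →ₗ[ℂ] N) (u : L y) :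
    F u = coordAt L x₀ y u • F (frameAt L x₀ y) := by
  rw [← map_smul, coordAt_smul_frameAt hy]

theorem continuousOn_coordAt_frameAt (x₀ x₁ : M) :
    ContinuousOn (fun y => coordAt L x₀ y (frameAt L x₁ y)) (frameDom L x₀ ∩ frameDom L x₁) := by
  have h1 : ContinuousOn (fun y => (⟨y, frameAt L x₁ y⟩ : TotalSpace ℂ L)) (frameDom L x₁) := by
    have h := (trivializationAt ℂ L x₁).continuousOn_invFun
    have h2 : ContinuousOn
        (fun y : M => (trivializationAt ℂ L x₁).toOpenPartialHomeomorph.symm (y, (1 : ℂ)))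
        (frameDom L x₁) := by
      refine (trivializationAt ℂ L x₁).toOpenPartialHomeomorph.continuousOn_symm.comp
        (by fun_prop) ?_
      intro y hy
      exact (trivializationAt ℂ L x₁).mem_target.2 hy
    refine h2.congr fun y hy => ?_
    exact ((trivializationAt ℂ L x₁).mk_symm hy 1)
  have h3 : ContinuousOn (fun y => (trivializationAt ℂ L x₀ ⟨y, frameAt L x₁ y⟩).2)
      (frameDom L x₀ ∩ frameDom L x₁) := by
    refine continuous_snd.comp_continuousOn ?_
    refine (trivializationAt ℂ L x₀).continuousOn.comp (h1.mono Set.inter_subset_right) ?_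
    intro y hy
    exact (trivializationAt ℂ L x₀).mem_source.2 hy.1
  refine h3.congr fun y hy => ?_
  rw [coordAt, Trivialization.coe_linearMapAt_of_mem _ hy.1]

theorem smoothSectionAt_iff [VectorBundle ℝ ℂ L] [ContMDiffVectorBundle ∞ ℂ L 𝓘(ℝ, E)]
    {σ : Π x : M, L x} {x : M} :
    SmoothSectionAt (E := E) σ x ↔
      ContMDiffAt 𝓘(ℝ, E) 𝓘(ℝ, ℂ) ∞ (fun y => coordAt L x y (σ y)) x := by
  unfold SmoothSectionAt
  rw [contMDiffAt_section]
  refine Filter.EventuallyEq.contMDiffAt_iff ?_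
  filter_upwards [frameDom_mem_nhds L x] with y hy
  rw [coordAt, Trivialization.coe_linearMapAt_of_mem _ hy]

theorem smoothSectionAt_frameAt [VectorBundle ℝ ℂ L] [ContMDiffVectorBundle ∞ ℂ L 𝓘(ℝ, E)] (x : M) :
    SmoothSectionAt (E := E) (frameAt L x) x := by
  rw [smoothSectionAt_iff]
  refine (contMDiffAt_const (c := (1 : ℂ))).congr_of_eventuallyEq ?_
  filter_upwards [frameDom_mem_nhds L x] with y hy using coordAt_frameAt hy

end LineCoordinates

section TensorCoordinates

variable {M : Type*} [TopologicalSpace M]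
  {L : M → Type*} [TopologicalSpace (TotalSpace ℂ L)] [∀ x, TopologicalSpace (L x)]
  [∀ x, AddCommGroup (L x)] [∀ x, Module ℂ (L x)] [FiberBundle ℂ L] [VectorBundle ℂ ℂ L]
  {δ : M → Type*} [TopologicalSpace (TotalSpace ℂ δ)] [∀ x, TopologicalSpace (δ x)]
  [∀ x, AddCommGroup (δ x)] [∀ x, Module ℂ (δ x)] [FiberBundle ℂ δ] [VectorBundle ℂ ℂ δ]

theorem tensorCoord_tprod_tmul (k : ℕ) (x₀ y : M) (u : Fin k → L y) (b : δ y) :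
    tensorCoord L δ k x₀ y (PiTensorProduct.tprod ℂ u ⊗ₜ[ℂ] b) =
      (∏ i, coordAt L x₀ y (u i)) * coordAt δ x₀ y b := by
  simp [tensorCoord]

/-- `e^k ⊗ b` spans the fibres of `L^k ⊗ δ` near `x₀`, and `tensorCoord` is the coordinate in it. -/
theorem tensorCoord_smul_tensorFrame {k : ℕ} {x₀ y : M} (hL : y ∈ frameDom L x₀)
    (hδ : y ∈ frameDom δ x₀) (z : Fibre L δ k y) :
    tensorCoord L δ k x₀ y z • tensorFrame L δ k x₀ y = z := by
  induction z using TensorProduct.induction_on with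
  | zero => simp
  | add a b ha hb => rw [map_add, add_smul, ha, hb]
  | tmul a b =>
    induction a using PiTensorProduct.induction_on with
    | smul_tprod r u =>
      rw [← TensorProduct.smul_tmul', map_smul, smul_eq_mul, mul_smul, tensorCoord_tprod_tmul,
        tensorFrame, mul_smul, ← TensorProduct.tmul_smul, coordAt_smul_frameAt hδ,
        TensorProduct.smul_tmul', ← MultilinearMap.map_smul_univ]
      simp_rw [coordAt_smul_frameAt hL]
    | add a a' ha ha' => rw [TensorProduct.add_tmul, map_add, add_smul, ha, ha']

end TensorCoordinates

/-! ### Continuous and smooth square roots -/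

section SquareRoots

/-- Near a point, a continuous square root of `q` is given by the principal branch applied to
`q / q(p₀)`, which stays near `1`, away from the branch cut. -/
theorem eventually_eq_mul_sqrt {N : Type*} [TopologicalSpace N] {θ q : N → ℂ} {p₀ : N}
    (hθ : ContinuousAt θ p₀) (hq0 : q p₀ ≠ 0) (hsq : ∀ᶠ p in 𝓝 p₀, θ p ^ 2 = q p) :
    ∀ᶠ p in 𝓝 p₀, θ p = θ p₀ * (q p / q p₀) ^ (2⁻¹ : ℂ) := by
  have h0 : θ p₀ ≠ 0 := by
    intro h
    apply hq0
    rw [← hsq.self_of_nhds, h]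
    norm_num
  have hre : ∀ᶠ p in 𝓝 p₀, 0 < (θ p / θ p₀).re := by
    have hc : ContinuousAt (fun p => (θ p / θ p₀).re) p₀ :=
      Complex.continuous_re.continuousAt.comp (hθ.div_const _)
    refine hc.eventually_const_lt ?_
    simp [div_self h0]
  filter_upwards [hre, hsq] with p hp hs
  rw [← hs, ← hsq.self_of_nhds, ← div_pow]
  have h := Complex.sq_cpow_two_inv hp
  rw [h, mul_div_cancel₀ _ h0]

theorem contDiffAt_sqrt_one : ContDiffAt ℝ ∞ (fun z : ℂ => z ^ (2⁻¹ : ℂ)) 1 := by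
  have h : AnalyticAt ℂ (fun z : ℂ => z ^ (2⁻¹ : ℂ)) 1 :=
    analyticAt_id.cpow analyticAt_const (by simp)
  exact (h.contDiffAt (n := ∞)).restrict_scalars ℝ

/-- A square root of a nonvanishing smooth function is smooth at each of its points of
continuity. -/
theorem contMDiffAt_of_sq {E : Type*} [NormedAddCommGroup E] [NormedSpace ℝ E]
    {H : Type*} [TopologicalSpace H] {I : ModelWithCorners ℝ E H}
    {N : Type*} [TopologicalSpace N] [ChartedSpace H N] {θ q : N → ℂ} {p₀ : N}
    (hθ : ContinuousAt θ p₀) (hq : ContMDiffAt I 𝓘(ℝ, ℂ) ∞ q p₀) (hq0 : q p₀ ≠ 0)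
    (hsq : ∀ᶠ p in 𝓝 p₀, θ p ^ 2 = q p) : ContMDiffAt I 𝓘(ℝ, ℂ) ∞ θ p₀ := by
  have h := eventually_eq_mul_sqrt hθ hq0 hsq
  refine ContMDiffAt.congr_of_eventuallyEq ?_ h
  have hd : ContDiffAt ℝ ∞ (fun z : ℂ => θ p₀ * (z / q p₀) ^ (2⁻¹ : ℂ)) (q p₀) := by
    refine contDiffAt_const.mul ?_
    refine ContDiffAt.comp (q p₀) (g := fun z : ℂ => z ^ (2⁻¹ : ℂ)) ?_
      (contDiffAt_id.div_const _)
    simpa only [id, div_self hq0] using contDiffAt_sqrt_one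
  exact hd.comp_contMDiffAt hq

/-- Continuous local square roots of a nonvanishing continuous function. -/
theorem exists_local_sqrt {N : Type*} [TopologicalSpace N] {q : N → ℂ} {p₀ : N} {V : Set N}
    (hV : IsOpen V) (hp : p₀ ∈ V) (hq : ContinuousOn q V) (hq0 : q p₀ ≠ 0) :
    ∃ U ⊆ V, IsOpen U ∧ p₀ ∈ U ∧ ∃ σ : N → ℂ, ContinuousOn σ U ∧
      ∀ p ∈ U, q p ≠ 0 ∧ σ p ^ 2 = q p := by
  have hc : ContinuousOn (fun p => (q p / q p₀).re) V :=
    Complex.continuous_re.comp_continuousOn (hq.div_const _)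
  refine ⟨V ∩ (fun p => (q p / q p₀).re) ⁻¹' Set.Ioi 0, Set.inter_subset_left,
    hc.isOpen_inter_preimage hV isOpen_Ioi, ⟨hp, by simp [div_self hq0]⟩,
    fun p => (q p₀) ^ (2⁻¹ : ℂ) * (q p / q p₀) ^ (2⁻¹ : ℂ), ?_, ?_⟩
  · refine continuousOn_const.mul ?_
    refine ContinuousOn.cpow_const ((hq.div_const _).mono Set.inter_subset_left) ?_
    intro p hp
    exact Or.inl hp.2
  · rintro p ⟨-, hp⟩
    have hre : 0 < (q p / q p₀).re := hp
    refine ⟨fun h => by simp [h] at hre, ?_⟩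
    have h2 : ∀ z : ℂ, (z ^ (2⁻¹ : ℂ)) ^ 2 = z := fun z => by
      simp
    rw [mul_pow, h2, h2, mul_div_cancel₀ _ hq0]

/-- The two-element group of signs, as a discrete space. -/
abbrev Signs : Type := {z : ℂ // z ^ 2 = 1}

instance finite_signs : Finite Signs := by
  have : ({z : ℂ | z ^ 2 = 1} : Set ℂ).Finite := by
    refine Set.Finite.subset (Set.toFinite {1, -1}) fun z hz => ?_
    rcases mul_eq_zero.1 (show (z - 1) * (z + 1) = 0 by
      have hz' : z ^ 2 = 1 := hz
      linear_combination hz') with h | h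
    · exact Or.inl (sub_eq_zero.1 h)
    · exact Or.inr (eq_neg_of_add_eq_zero_left h)
  exact this

/-- Let `ε i`, defined on the open sets `U i`, be signs which differ from each other by locally
constant signs. Then the sign `a`, which at time `t₀` differs from them by a locally constant sign,
extends to all times with the same property. -/
theorem exists_sign_extension {M : Type*} [TopologicalSpace M] {ι : Type*} {U : ι → Set (ℝ × M)}
    (hU : ∀ i, IsOpen (U i)) (hcov : ∀ p, ∃ i, p ∈ U i) {ε : ι → ℝ × M → ℂ}
    (hε : ∀ i p, ε i p ^ 2 = 1)
    (hcont : ∀ i j, ContinuousOn (fun p => ε i p * ε j p) (U i ∩ U j)) (t₀ : ℝ) {a : M → ℂ}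
    (ha : ∀ x, a x ^ 2 = 1)
    (hac : ∀ i, ContinuousOn (fun x => a x * ε i (t₀, x)) {x | (t₀, x) ∈ U i}) :
    ∃ η : ℝ × M → ℂ, (∀ p, η p ^ 2 = 1) ∧ (∀ x, η (t₀, x) = a x) ∧
      ∀ i, ContinuousOn (fun p => η p * ε i p) (U i) := by
  choose idx hidx using hcov
  -- the signs `ε i` are the transition data of a two-sheeted covering `Z` of `ℝ × M`
  let Z : FiberBundleCore ι (ℝ × M) Signs :=
    { baseSet := U
      isOpen_baseSet := hU
      indexAt := idx
      mem_baseSet_at := hidx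
      coordChange := fun i j p v => ⟨ε i p * ε j p * v.1, by
        rw [mul_pow, mul_pow, hε, hε, v.2]; norm_num⟩
      coordChange_self := fun i p _ v => Subtype.ext (by
        change ε i p * ε i p * v.1 = v.1
        rw [← sq, hε, one_mul])
      continuousOn_coordChange := fun i j => by
        refine Topology.IsInducing.subtypeVal.continuousOn_iff.2 ?_
        refine ContinuousOn.mul (f := fun p : (ℝ × M) × Signs => ε i p.1 * ε j p.1)
          (g := fun p => p.2.1) ?_ (by fun_prop)
        exact (hcont i j).comp continuousOn_fst fun p hp => hp.1
      coordChange_comp := fun i j k p _ v => Subtype.ext (by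
        change ε j p * ε k p * (ε i p * ε j p * v.1) = ε i p * ε k p * v.1
        linear_combination (ε i p * ε k p * v.1) * hε j p) }
  have cov : IsCoveringMap (π Signs Z.Fiber) := FiberBundle.isCoveringMap
  -- the contraction of `ℝ × M` to the slice of time `t₀`; the section `a` over the slice is
  -- extended along it by the homotopy lifting property
  let H : C(unitInterval × (ℝ × M), ℝ × M) :=
    ⟨fun q => (t₀ + (q.1 : ℝ) * (q.2.1 - t₀), q.2.2), by fun_prop⟩
  have hmem : ∀ x, a x * ε (idx (t₀, x)) (t₀, x) ∈ {z : ℂ | z ^ 2 = 1} := fun x => by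
    change _ ^ 2 = (1 : ℂ)
    rw [mul_pow, ha, hε, one_mul]
  let f : C(ℝ × M, Z.TotalSpace) :=
    ⟨fun q => ⟨(t₀, q.2), (⟨a q.2 * ε (idx (t₀, q.2)) (t₀, q.2), hmem q.2⟩ : Signs)⟩, by
      rw [continuous_iff_continuousAt]
      intro q
      rw [FiberBundle.continuousAt_totalSpace]
      refine ⟨by fun_prop, ?_⟩
      set i := idx (t₀, q.2) with hi
      have hEq : (fun y : ℝ × M => (trivializationAt Signs Z.Fiber (t₀, q.2)
          ⟨(t₀, y.2), (⟨a y.2 * ε (idx (t₀, y.2)) (t₀, y.2), hmem y.2⟩ : Signs)⟩).2) =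
          fun y => ⟨a y.2 * ε i (t₀, y.2), by rw [mul_pow, ha, hε, one_mul]⟩ := by
        funext y
        refine Subtype.ext ?_
        change ε (idx (t₀, y.2)) (t₀, y.2) * ε i (t₀, y.2) *
          (a y.2 * ε (idx (t₀, y.2)) (t₀, y.2)) = a y.2 * ε i (t₀, y.2)
        linear_combination (ε i (t₀, y.2) * a y.2) * hε (idx (t₀, y.2)) (t₀, y.2)
      change ContinuousAt (fun y : ℝ × M => (trivializationAt Signs Z.Fiber (t₀, q.2)
          ⟨(t₀, y.2), (⟨a y.2 * ε (idx (t₀, y.2)) (t₀, y.2), hmem y.2⟩ : Signs)⟩).2) q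
      rw [hEq]
      refine Topology.IsInducing.subtypeVal.continuousAt_iff.2 ?_
      have h1 := (hac i).continuousAt (((hU i).preimage
        (by fun_prop : Continuous fun x : M => (t₀, x))).mem_nhds (hidx (t₀, q.2)))
      exact ContinuousAt.comp (f := fun y : ℝ × M => y.2) h1 continuousAt_snd⟩
  have H_0 : ∀ q, H (0, q) = π Signs Z.Fiber (f q) := fun q => by
    simp [H, f]
  let Γ := cov.liftHomotopy H f H_0
  have hΓ : ∀ q, (Γ q).proj = H q := fun q => congrFun (cov.liftHomotopy_lifts H f H_0) q
  have hΓ1 : ∀ p, (Γ (1, p)).proj = p := fun p => by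
    rw [hΓ]; simp [H]
  let val : Z.TotalSpace → ℂ := fun z => Subtype.val (p := fun z : ℂ => z ^ 2 = 1) z.2
  have hsq : ∀ z : Z.TotalSpace, val z ^ 2 = 1 := fun z =>
    Subtype.property (p := fun z : ℂ => z ^ 2 = 1) z.2
  refine ⟨fun p => val (Γ (1, p)) * ε (idx p) p, ?_, ?_, ?_⟩
  · intro p
    rw [mul_pow, hsq, hε, one_mul]
  · intro x
    -- over the slice the contraction is constant, and constant paths lift to constant paths
    have h1 : Γ (1, (t₀, x)) = f (t₀, x) := by
      have : Γ (1, (t₀, x)) = cov.liftPath (ContinuousMap.const _ (t₀, x)) (f (t₀, x)) rfl 1 := by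
        have hh : (H.comp <| (ContinuousMap.id unitInterval).prodMk <| .const unitInterval (t₀, x)) =
          ContinuousMap.const _ (t₀, x) := by ext <;> simp [H]
        simp only [Γ, IsCoveringMap.liftHomotopy_apply]
        congr 1
        simp only [hh]
      exact this.trans (DFunLike.congr_fun (cov.liftPath_const (x := (t₀, x)) rfl) 1)
    change val (Γ (1, (t₀, x))) * ε (idx (t₀, x)) (t₀, x) = a x
    rw [h1]
    change a x * ε (idx (t₀, x)) (t₀, x) * ε (idx (t₀, x)) (t₀, x) = a x
    linear_combination a x * hε (idx (t₀, x)) (t₀, x)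
  · intro i
    have hc : ContinuousOn (fun p => ((Z.localTriv i (Γ (1, p))).2 : ℂ)) (U i) := by
      refine continuous_subtype_val.comp_continuousOn (continuous_snd.comp_continuousOn ?_)
      refine (Z.localTriv i).continuousOn.comp (by fun_prop) ?_
      intro p hp
      rw [Z.mem_localTriv_source]
      rw [hΓ1]; exact hp
    refine hc.congr fun p hp => ?_
    have e : ((Z.localTriv i (Γ (1, p))).2 : ℂ) = ε (idx (Γ (1, p)).1) (Γ (1, p)).1 *
      ε i (Γ (1, p)).1 * val (Γ (1, p)) := rfl
    simp only [e]
    rw [hΓ1 p]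
    ring

end SquareRoots

/-! ### Tangent vectors, vector fields and endomorphisms in coordinates -/

section TangentCoordinates

variable {E : Type*} [NormedAddCommGroup E] [NormedSpace ℝ E]
  {M : Type*} [TopologicalSpace M] [ChartedSpace E M] [IsManifold 𝓘(ℝ, E) ∞ M]

instance isManifold_one : IsManifold 𝓘(ℝ, E) 1 M := IsManifold.of_le (n := ∞) (by norm_cast)

/-- The coordinates of a tangent vector at `y` in the chart at `x₀`. -/
def tc (x₀ y : M) : TangentSpace 𝓘(ℝ, E) y →L[ℝ] E :=
  (trivializationAt E (TangentSpace 𝓘(ℝ, E)) x₀).continuousLinearMapAt ℝ y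

/-- The tangent vector at `y` with given coordinates in the chart at `x₀`. -/
def ts (x₀ y : M) : E →L[ℝ] TangentSpace 𝓘(ℝ, E) y :=
  (trivializationAt E (TangentSpace 𝓘(ℝ, E)) x₀).symmL ℝ y

omit [NormedSpace ℝ E] [IsManifold 𝓘(ℝ, E) ∞ M] in
theorem source_mem_nhds (x₀ : M) : (chartAt E x₀).source ∈ 𝓝 x₀ :=
  (chartAt E x₀).open_source.mem_nhds (mem_chart_source E x₀)

theorem tc_ts {x₀ y : M} (hy : y ∈ (chartAt E x₀).source) (w : E) :
    tc (E := E) x₀ y (ts x₀ y w) = w :=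
  (trivializationAt E (TangentSpace 𝓘(ℝ, E)) x₀).continuousLinearMapAt_symmL (R := ℝ)
    (by simpa using hy) w

theorem ts_tc {x₀ y : M} (hy : y ∈ (chartAt E x₀).source) (v : TangentSpace 𝓘(ℝ, E) y) :
    ts (E := E) x₀ y (tc x₀ y v) = v :=
  (trivializationAt E (TangentSpace 𝓘(ℝ, E)) x₀).symmL_continuousLinearMapAt (R := ℝ)
    (by simpa using hy) v

theorem tc_self (x : M) (v : TangentSpace 𝓘(ℝ, E) x) : tc (E := E) x x v = v := by
  unfold tc
  rw [TangentBundle.continuousLinearMapAt_trivializationAt (mem_chart_source E x),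
    mfderiv_extChartAt_self]
  rfl

theorem ts_self (x : M) (w : E) : ts (E := E) x x w = w := by
  have h := ts_tc (mem_chart_source E x) (w : TangentSpace 𝓘(ℝ, E) x)
  exact (congrArg (ts (E := E) x x) (tc_self x w)).symm.trans h

theorem smoothFieldAt_iff {X : Π x : M, TangentSpace 𝓘(ℝ, E) x} {x : M} :
    SmoothFieldAt X x ↔ ContMDiffAt 𝓘(ℝ, E) 𝓘(ℝ, E) ∞ (fun y => tc x y (X y)) x := by
  unfold SmoothFieldAt
  refine (contMDiffAt_section (F := E) (E := TangentSpace 𝓘(ℝ, E)) (s := X) x).trans ?_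
  refine Filter.EventuallyEq.contMDiffAt_iff ?_
  filter_upwards [source_mem_nhds (E := E) x] with y hy
  unfold tc
  rw [Trivialization.continuousLinearMapAt_apply, Trivialization.coe_linearMapAt_of_mem]
  simpa using hy

theorem smoothFieldAt_ts (x : M) (w : E) : SmoothFieldAt (fun y => ts x y w) x := by
  rw [smoothFieldAt_iff]
  refine (contMDiffAt_const (c := w)).congr_of_eventuallyEq ?_
  filter_upwards [source_mem_nhds (E := E) x] with y hy using tc_ts hy w

variable {F : Type*} [NormedAddCommGroup F] [NormedSpace ℝ F]
  {E' : Type*} [NormedAddCommGroup E'] [NormedSpace ℝ E']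
  {H : Type*} [TopologicalSpace H] {I : ModelWithCorners ℝ E' H}
  {N : Type*} [TopologicalSpace N] [ChartedSpace H N]

omit [IsManifold 𝓘(ℝ, E) ∞ M] in
theorem contMDiffAt_clm_of_apply [FiniteDimensional ℝ E] {g : N → E →L[ℝ] F} {p₀ : N}
    (h : ∀ w, ContMDiffAt I 𝓘(ℝ, F) ∞ (fun p => g p w) p₀) :
    ContMDiffAt I 𝓘(ℝ, E →L[ℝ] F) ∞ g p₀ := by
  let b := Module.finBasis ℝ E
  have hg : g = fun p => ∑ a, ContinuousLinearMap.smulRightL ℝ E F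
      (LinearMap.toContinuousLinearMap (b.coord a)) (g p (b a)) := by
    funext p
    ext w
    conv_lhs => rw [← b.sum_repr w, map_sum]
    simp
  rw [hg]
  refine ContMDiffAt.sum fun a _ => ?_
  exact (ContinuousLinearMap.smulRightL ℝ E F
      (LinearMap.toContinuousLinearMap (b.coord a))).contDiff.contDiffAt.comp_contMDiffAt (h (b a))

/-- An endomorphism of the tangent bundle in the chart at `x₀`. -/
def endoCoord (j : Π x : M, TangentSpace 𝓘(ℝ, E) x →L[ℝ] TangentSpace 𝓘(ℝ, E) x) (x₀ y : M) :
    E →L[ℝ] E := tc x₀ y ∘L j y ∘L ts x₀ y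

theorem contMDiffAt_endoCoord [FiniteDimensional ℝ E]
    {j : Π x : M, TangentSpace 𝓘(ℝ, E) x →L[ℝ] TangentSpace 𝓘(ℝ, E) x} {x₀ : M}
    (hj : ∀ X : Π y : M, TangentSpace 𝓘(ℝ, E) y, SmoothFieldAt X x₀ →
      SmoothFieldAt (fun y => j y (X y)) x₀) :
    ContMDiffAt 𝓘(ℝ, E) 𝓘(ℝ, E →L[ℝ] E) ∞ (endoCoord j x₀) x₀ :=
  contMDiffAt_clm_of_apply fun w => smoothFieldAt_iff.1 (hj _ (smoothFieldAt_ts x₀ w))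

theorem smoothFieldAt_of_endoCoord
    {j : Π x : M, TangentSpace 𝓘(ℝ, E) x →L[ℝ] TangentSpace 𝓘(ℝ, E) x} {x₀ : M}
    (hj : ContMDiffAt 𝓘(ℝ, E) 𝓘(ℝ, E →L[ℝ] E) ∞ (endoCoord j x₀) x₀)
    {X : Π y : M, TangentSpace 𝓘(ℝ, E) y} (hX : SmoothFieldAt X x₀) :
    SmoothFieldAt (fun y => j y (X y)) x₀ := by
  rw [smoothFieldAt_iff] at hX ⊢
  refine (hj.clm_apply hX).congr_of_eventuallyEq ?_
  filter_upwards [source_mem_nhds (E := E) x₀] with y hy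
  simp only [endoCoord, ContinuousLinearMap.comp_apply]
  rw [ts_tc hy]

theorem endoCoord_tc (j : Π x : M, TangentSpace 𝓘(ℝ, E) x →L[ℝ] TangentSpace 𝓘(ℝ, E) x)
    {x₀ y : M} (hy : y ∈ (chartAt E x₀).source) (v : TangentSpace 𝓘(ℝ, E) y) :
    endoCoord j x₀ y (tc x₀ y v) = tc x₀ y (j y v) := by
  simp only [endoCoord, ContinuousLinearMap.comp_apply]
  rw [ts_tc hy]

/-- The differential of the partial map `φ t` in the charts at `x₀` and `φ t₀ x₀`. -/
def diffCoord (φ : ℝ → M → M) (t₀ : ℝ) (x₀ : M) (p : ℝ × M) : E →L[ℝ] E :=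
  tc (E := E) (φ t₀ x₀) (φ p.1 p.2) ∘L mfderiv 𝓘(ℝ, E) 𝓘(ℝ, E) (φ p.1) p.2 ∘L
    ts (E := E) x₀ p.2

theorem contMDiffAt_diffCoord {φ : ℝ → M → M}
    (hφ : ContMDiff (𝓘(ℝ, ℝ).prod 𝓘(ℝ, E)) 𝓘(ℝ, E) ∞ (fun p : ℝ × M => φ p.1 p.2))
    (t₀ : ℝ) (x₀ : M) :
    ContMDiffAt (𝓘(ℝ, ℝ).prod 𝓘(ℝ, E)) 𝓘(ℝ, E →L[ℝ] E) ∞ (diffCoord (E := E) φ t₀ x₀) (t₀, x₀) := by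
  have h : ContMDiffAt ((𝓘(ℝ, ℝ).prod 𝓘(ℝ, E)).prod 𝓘(ℝ, E)) 𝓘(ℝ, E) ∞
      (Function.uncurry fun (p : ℝ × M) (y : M) => φ p.1 y) ((t₀, x₀), x₀) := by
    have h1 : ContMDiffAt ((𝓘(ℝ, ℝ).prod 𝓘(ℝ, E)).prod 𝓘(ℝ, E)) (𝓘(ℝ, ℝ).prod 𝓘(ℝ, E)) ∞
        (fun q : (ℝ × M) × M => (q.1.1, q.2)) ((t₀, x₀), x₀) :=
      (contMDiffAt_fst.fst).prodMk contMDiffAt_snd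
    exact ContMDiffAt.comp ((t₀, x₀), x₀) (hφ (t₀, x₀)) h1
  have h3 := ContMDiffAt.mfderiv (m := ∞) (n := ∞) (I := 𝓘(ℝ, E)) (I' := 𝓘(ℝ, E))
    (fun (p : ℝ × M) (y : M) => φ p.1 y) Prod.snd h contMDiffAt_snd (by norm_cast)
  have h4 : diffCoord (E := E) φ t₀ x₀ = inTangentCoordinates 𝓘(ℝ, E) 𝓘(ℝ, E) Prod.snd
      (fun p : ℝ × M => φ p.1 p.2) (fun p => mfderiv 𝓘(ℝ, E) 𝓘(ℝ, E) (φ p.1) p.2) (t₀, x₀) := by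
    funext p
    rfl
  rw [h4]
  exact h3

end TangentCoordinates

/-! ### Derivatives in charts -/

section ChartDerivatives

variable {E : Type*} [NormedAddCommGroup E] [NormedSpace ℝ E]
  {M : Type*} [TopologicalSpace M] [ChartedSpace E M] [IsManifold 𝓘(ℝ, E) ∞ M]
  {F : Type*} [NormedAddCommGroup F] [NormedSpace ℝ F]

theorem hasMFDerivAt_extChartAt_symm {z y : M} (hy : y ∈ (chartAt E z).source) :
    HasMFDerivAt 𝓘(ℝ, E) 𝓘(ℝ, E) (extChartAt 𝓘(ℝ, E) z).symm (extChartAt 𝓘(ℝ, E) z y)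
      (ts (E := E) z ((extChartAt 𝓘(ℝ, E) z).symm (extChartAt 𝓘(ℝ, E) z y))) := by
  have hleft : (extChartAt 𝓘(ℝ, E) z).symm (extChartAt 𝓘(ℝ, E) z y) = y :=
    (extChartAt 𝓘(ℝ, E) z).left_inv (by rwa [extChartAt_source])
  have hmem : extChartAt 𝓘(ℝ, E) z y ∈ (extChartAt 𝓘(ℝ, E) z).target :=
    (extChartAt 𝓘(ℝ, E) z).map_source (by rwa [extChartAt_source])
  have h1 : MDifferentiableAt 𝓘(ℝ, E) 𝓘(ℝ, E) (extChartAt 𝓘(ℝ, E) z).symm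
      (extChartAt 𝓘(ℝ, E) z y) := by
    have := mdifferentiableWithinAt_extChartAt_symm (I := 𝓘(ℝ, E)) hmem
    rwa [ModelWithCorners.range_eq_univ, mdifferentiableWithinAt_univ] at this
  have h2 := TangentBundle.symmL_trivializationAt (I := 𝓘(ℝ, E)) hy
  rw [ModelWithCorners.range_eq_univ, mfderivWithin_univ] at h2
  have h3 := h1.hasMFDerivAt
  rw [← h2] at h3
  have h4 : ∀ y', y' = y → HasMFDerivAt 𝓘(ℝ, E) 𝓘(ℝ, E) (extChartAt 𝓘(ℝ, E) z).symm
    (extChartAt 𝓘(ℝ, E) z y) (ts (E := E) z y') := by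
    rintro _ rfl
    exact h3
  exact h4 _ hleft

theorem hasFDerivAt_comp_extChartAt_symm {g : M → F} {z y : M} (hy : y ∈ (chartAt E z).source)
    (hg : MDifferentiableAt 𝓘(ℝ, E) 𝓘(ℝ, F) g y) :
    HasFDerivAt (fun ξ => g ((extChartAt 𝓘(ℝ, E) z).symm ξ))
      (mvfderiv 𝓘(ℝ, E) g y ∘L ts (E := E) z y) (extChartAt 𝓘(ℝ, E) z y) := by
  have hleft : (extChartAt 𝓘(ℝ, E) z).symm (extChartAt 𝓘(ℝ, E) z y) = y :=
    (extChartAt 𝓘(ℝ, E) z).left_inv (by rwa [extChartAt_source])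
  have h1 := hasMFDerivAt_extChartAt_symm hy
  have key : ∀ y', (extChartAt 𝓘(ℝ, E) z).symm (extChartAt 𝓘(ℝ, E) z y) = y' →
      MDifferentiableAt 𝓘(ℝ, E) 𝓘(ℝ, F) g y' →
      HasFDerivAt (fun ξ => g ((extChartAt 𝓘(ℝ, E) z).symm ξ))
      (mvfderiv 𝓘(ℝ, E) g y' ∘L ts (E := E) z y') (extChartAt 𝓘(ℝ, E) z y) := by
    rintro _ rfl hg'
    exact (hg'.hasMFDerivAt.comp (extChartAt 𝓘(ℝ, E) z y) h1).hasFDerivAt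
  exact key y hleft hg

theorem mvfderiv_apply_ts {g : M → F} {z y : M} (hy : y ∈ (chartAt E z).source)
    (hg : MDifferentiableAt 𝓘(ℝ, E) 𝓘(ℝ, F) g y) (w : E) :
    mvfderiv 𝓘(ℝ, E) g y (ts z y w) =
      fderiv ℝ (fun ξ => g ((extChartAt 𝓘(ℝ, E) z).symm ξ)) (extChartAt 𝓘(ℝ, E) z y) w := by
  rw [(hasFDerivAt_comp_extChartAt_symm hy hg).fderiv]
  rfl

theorem mvfderiv_apply_self {g : M → F} {z : M}
    (hg : MDifferentiableAt 𝓘(ℝ, E) 𝓘(ℝ, F) g z) (w : E) :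
    mvfderiv 𝓘(ℝ, E) g z w =
      fderiv ℝ (fun ξ => g ((extChartAt 𝓘(ℝ, E) z).symm ξ)) (extChartAt 𝓘(ℝ, E) z z) w := by
  have h := mvfderiv_apply_ts (mem_chart_source E z) hg w
  rw [← h]
  exact congrArg _ (ts_self z w).symm

theorem hasMFDerivAt_extChartAt_tc {z y : M} (hy : y ∈ (chartAt E z).source) :
    HasMFDerivAt 𝓘(ℝ, E) 𝓘(ℝ, E) (extChartAt 𝓘(ℝ, E) z) y (tc (E := E) z y) := by
  have h := (mdifferentiableAt_extChartAt (I := 𝓘(ℝ, E)) hy).hasMFDerivAt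
  rwa [← TangentBundle.continuousLinearMapAt_trivializationAt hy] at h

/-- The chart expression of a curve is differentiated by the coordinates of its velocity. -/
theorem hasDerivAt_extChartAt_comp {γ : ℝ → M} {h₀ : ℝ} {V : TangentSpace 𝓘(ℝ, E) (γ h₀)} {z : M}
    (hγ : HasMFDerivAt 𝓘(ℝ, ℝ) 𝓘(ℝ, E) γ h₀ (ContinuousLinearMap.smulRight (1 : ℝ →L[ℝ] ℝ) V))
    (hz : γ h₀ ∈ (chartAt E z).source) :
    HasDerivAt (fun h => extChartAt 𝓘(ℝ, E) z (γ h)) (tc z (γ h₀) V) h₀ := by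
  have h := ((hasMFDerivAt_extChartAt_tc hz).comp h₀ hγ).hasFDerivAt
  rw [hasDerivAt_iff_hasFDerivAt]
  refine HasFDerivAt.congr_fderiv h (ContinuousLinearMap.ext fun r => ?_)
  exact map_smul (tc z (γ h₀)) (show ℝ from r) V

omit [IsManifold 𝓘(ℝ, E) ∞ M] in
/-- Derivative of a function along a curve. -/
theorem hasDerivAt_comp_curve {g : M → F} {γ : ℝ → M} {h₀ : ℝ} {V : TangentSpace 𝓘(ℝ, E) (γ h₀)}
    (hγ : HasMFDerivAt 𝓘(ℝ, ℝ) 𝓘(ℝ, E) γ h₀ (ContinuousLinearMap.smulRight (1 : ℝ →L[ℝ] ℝ) V))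
    (hg : MDifferentiableAt 𝓘(ℝ, E) 𝓘(ℝ, F) g (γ h₀)) :
    HasDerivAt (fun h => g (γ h)) (mvfderiv 𝓘(ℝ, E) g (γ h₀) V) h₀ := by
  have h := (hg.hasMFDerivAt.comp h₀ hγ).hasFDerivAt
  rw [hasDerivAt_iff_hasFDerivAt]
  refine HasFDerivAt.congr_fderiv h (ContinuousLinearMap.ext fun r => ?_)
  exact map_smul (mvfderiv 𝓘(ℝ, E) g (γ h₀)) (show ℝ from r) V

theorem mpullbackWithin_extChartAt_symm {z y : M} (hy : y ∈ (chartAt E z).source)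
    (V : Π y : M, TangentSpace 𝓘(ℝ, E) y) :
    VectorField.mpullbackWithin 𝓘(ℝ, E) 𝓘(ℝ, E) (extChartAt 𝓘(ℝ, E) z).symm V
      (Set.range 𝓘(ℝ, E)) (extChartAt 𝓘(ℝ, E) z y) = tc z y (V y) := by
  have hleft : (extChartAt 𝓘(ℝ, E) z).symm (extChartAt 𝓘(ℝ, E) z y) = y :=
    (extChartAt 𝓘(ℝ, E) z).left_inv (by rwa [extChartAt_source])
  rw [VectorField.mpullbackWithin_apply, ModelWithCorners.range_eq_univ, mfderivWithin_univ,
    (hasMFDerivAt_extChartAt_symm hy).mfderiv]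
  have key : ∀ y', y' = y → (ts (E := E) z y').inverse (V y') = tc z y (V y) := by
    intro y' hy'
    subst hy'
    have : (ts (E := E) z y').inverse = tc z y' :=
      ContinuousLinearMap.inverse_eq (by ext v; exact ts_tc hy v) (by ext v; exact tc_ts hy v)
    rw [this]
  exact key _ hleft

/-- The Lie bracket at `z` is the bracket of the coordinate expressions in the chart at `z`. -/
theorem mlieBracket_eq {z : M} (V W : Π y : M, TangentSpace 𝓘(ℝ, E) y) {Vc Wc : E → E}
    (hV : ∀ᶠ y in 𝓝 z, tc z y (V y) = Vc (extChartAt 𝓘(ℝ, E) z y))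
    (hW : ∀ᶠ y in 𝓝 z, tc z y (W y) = Wc (extChartAt 𝓘(ℝ, E) z y)) :
    VectorField.mlieBracket 𝓘(ℝ, E) V W z =
      VectorField.lieBracket ℝ Vc Wc (extChartAt 𝓘(ℝ, E) z z) := by
  have hev : ∀ (V : Π y : M, TangentSpace 𝓘(ℝ, E) y) (Vc : E → E),
      (∀ᶠ y in 𝓝 z, tc z y (V y) = Vc (extChartAt 𝓘(ℝ, E) z y)) →
      VectorField.mpullbackWithin 𝓘(ℝ, E) 𝓘(ℝ, E) (extChartAt 𝓘(ℝ, E) z).symm V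
        (Set.range 𝓘(ℝ, E)) =ᶠ[𝓝 (extChartAt 𝓘(ℝ, E) z z)] Vc := by
    intro V Vc hV
    have hc : Filter.Tendsto (extChartAt 𝓘(ℝ, E) z).symm (𝓝 (extChartAt 𝓘(ℝ, E) z z)) (𝓝 z) := by
      have := continuousAt_extChartAt_symm (I := 𝓘(ℝ, E)) z
      rwa [ContinuousAt, extChartAt_to_inv] at this
    filter_upwards [hc.eventually hV, hc.eventually (source_mem_nhds (E := E) z),
      extChartAt_target_mem_nhds (I := 𝓘(ℝ, E)) z] with ξ h1 h2 h3
    have hr := (extChartAt 𝓘(ℝ, E) z).right_inv h3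
    have h4 := mpullbackWithin_extChartAt_symm h2 V
    rw [hr] at h4 h1
    exact h4.trans h1
  have h0 : VectorField.mlieBracket 𝓘(ℝ, E) V W z = _ :=
    VectorField.mlieBracketWithin_apply (I := 𝓘(ℝ, E)) (V := V) (W := W) (s := Set.univ) (x₀ := z)
  rw [h0, mfderiv_extChartAt_self]
  have h5 := Filter.EventuallyEq.lieBracket_vectorField_eq (𝕜 := ℝ) (E := E) (hev V Vc hV)
    (hev W Wc hW)
  have h6 : (extChartAt 𝓘(ℝ, E) z).symm ⁻¹' Set.univ ∩ Set.range 𝓘(ℝ, E) = Set.univ := by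
    rw [ModelWithCorners.range_eq_univ, Set.preimage_univ, Set.univ_inter]
  rw [h6]
  refine Eq.trans (b := VectorField.lieBracket ℝ (E := E) _ _ _) ?_ h5
  have h7 : (ContinuousLinearMap.id ℝ E).inverse = ContinuousLinearMap.id ℝ E :=
    ContinuousLinearMap.inverse_id
  refine (congrArg (fun A : E →L[ℝ] E => A _) h7).trans ?_
  exact congrFun (VectorField.lieBracketWithin_univ (𝕜 := ℝ) (E := E)) _

end ChartDerivatives

/-! ### The flow of a vector field -/

/-- Symmetry of the mixed second derivative of a map of a time and a space variable. -/
theorem hasDerivAt_fderiv_swap {E F : Type*} [NormedAddCommGroup E] [NormedSpace ℝ E]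
    [NormedAddCommGroup F] [NormedSpace ℝ F] {G : ℝ × E → F} {t₀ : ℝ} {ξ₀ : E}
    (hG : ContDiffAt ℝ ∞ G (t₀, ξ₀)) (v : E) :
    HasDerivAt (fun h : ℝ => fderiv ℝ G (h, ξ₀) (0, v))
      (fderiv ℝ (fun ξ => fderiv ℝ G (t₀, ξ) (1, 0)) ξ₀ v) t₀ := by
  have hd : HasFDerivAt (fderiv ℝ G) (fderiv ℝ (fderiv ℝ G) (t₀, ξ₀)) (t₀, ξ₀) :=
    ((hG.fderiv_right (m := 1) (by norm_cast)).differentiableAt (by simp)).hasFDerivAt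
  have hsymm : IsSymmSndFDerivAt ℝ G (t₀, ξ₀) :=
    hG.isSymmSndFDerivAt (by rw [minSmoothness_of_isRCLikeNormedField]; norm_cast)
  have h1 : HasDerivAt (fun h : ℝ => (h, ξ₀)) ((1 : ℝ), (0 : E)) t₀ :=
    (hasDerivAt_id t₀).prodMk (hasDerivAt_const _ _)
  have h2 : HasDerivAt (fun h : ℝ => fderiv ℝ G (h, ξ₀))
      (fderiv ℝ (fderiv ℝ G) (t₀, ξ₀) (1, 0)) t₀ := hd.comp_hasDerivAt t₀ h1
  have h2' : HasDerivAt (fun h : ℝ => fderiv ℝ G (h, ξ₀) (0, v))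
      (fderiv ℝ (fderiv ℝ G) (t₀, ξ₀) (1, 0) (0, v)) t₀ :=
    (ContinuousLinearMap.apply ℝ F ((0 : ℝ), v)).hasFDerivAt.comp_hasDerivAt t₀ h2
  have h3 : HasFDerivAt (fun ξ : E => fderiv ℝ G (t₀, ξ))
      ((fderiv ℝ (fderiv ℝ G) (t₀, ξ₀)).comp (ContinuousLinearMap.inr ℝ ℝ E)) ξ₀ :=
    hd.comp ξ₀ (hasFDerivAt_prodMk_right t₀ ξ₀)
  have h3' : HasFDerivAt (fun ξ : E => fderiv ℝ G (t₀, ξ) (1, 0))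
      ((ContinuousLinearMap.apply ℝ F ((1 : ℝ), (0 : E))).comp
        ((fderiv ℝ (fderiv ℝ G) (t₀, ξ₀)).comp (ContinuousLinearMap.inr ℝ ℝ E))) ξ₀ :=
    (ContinuousLinearMap.apply ℝ F ((1 : ℝ), (0 : E))).hasFDerivAt.comp ξ₀ h3
  rw [h3'.fderiv]
  have h4 : ((ContinuousLinearMap.apply ℝ F ((1 : ℝ), (0 : E))).comp
      ((fderiv ℝ (fderiv ℝ G) (t₀, ξ₀)).comp (ContinuousLinearMap.inr ℝ ℝ E))) v =
      fderiv ℝ (fderiv ℝ G) (t₀, ξ₀) (1, 0) (0, v) := hsymm (0, v) (1, 0)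
  rw [h4]
  exact h2'

section Flow

variable {E : Type*} [NormedAddCommGroup E] [NormedSpace ℝ E]
  {M : Type*} [TopologicalSpace M] [ChartedSpace E M] [IsManifold 𝓘(ℝ, E) ∞ M]
  {X : Π x : M, TangentSpace 𝓘(ℝ, E) x} {φ : ℝ → M → M}

/-- The expression of a flow in the chart at `z`. -/
def flowChart (φ : ℝ → M → M) (z : M) (q : ℝ × E) : E :=
  extChartAt 𝓘(ℝ, E) z (φ q.1 ((extChartAt 𝓘(ℝ, E) z).symm q.2))

omit [IsManifold 𝓘(ℝ, E) ∞ M] in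
theorem tendsto_extChartAt_symm (z : M) : Filter.Tendsto (extChartAt 𝓘(ℝ, E) z).symm
    (𝓝 (extChartAt 𝓘(ℝ, E) z z)) (𝓝 z) := by
  have := continuousAt_extChartAt_symm (I := 𝓘(ℝ, E)) z
  rwa [ContinuousAt, extChartAt_to_inv] at this

theorem contMDiffAt_extChartAt_symm_self (z : M) :
    ContMDiffAt 𝓘(ℝ, E) 𝓘(ℝ, E) ∞ (extChartAt 𝓘(ℝ, E) z).symm (extChartAt 𝓘(ℝ, E) z z) :=
  (contMDiffOn_extChartAt_symm z).contMDiffAt (extChartAt_target_mem_nhds z)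

theorem contDiffAt_flowChart (hφ : IsFlow X φ) (z : M) :
    ContDiffAt ℝ ∞ (flowChart (E := E) φ z) (0, extChartAt 𝓘(ℝ, E) z z) := by
  rw [← contMDiffAt_iff_contDiffAt]
  set ξ₀ := extChartAt 𝓘(ℝ, E) z z with hξ
  have h1 : ContMDiffAt 𝓘(ℝ, ℝ × E) (𝓘(ℝ, ℝ).prod 𝓘(ℝ, E)) ∞
      (fun q : ℝ × E => (q.1, (extChartAt 𝓘(ℝ, E) z).symm q.2)) (0, ξ₀) := by
    refine ContMDiffAt.prodMk contDiff_fst.contMDiff.contMDiffAt ?_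
    exact ContMDiffAt.comp (0, ξ₀) (contMDiffAt_extChartAt_symm_self z)
      contDiff_snd.contMDiff.contMDiffAt
  have h2 : ContMDiffAt 𝓘(ℝ, ℝ × E) 𝓘(ℝ, E) ∞
      (fun q : ℝ × E => φ q.1 ((extChartAt 𝓘(ℝ, E) z).symm q.2)) (0, ξ₀) :=
    ContMDiffAt.comp (0, ξ₀) (hφ.smooth _) h1
  have hz : φ 0 ((extChartAt 𝓘(ℝ, E) z).symm ξ₀) = z := by
    rw [hφ.zero, hξ, extChartAt_to_inv]
  have h3 : ContMDiffAt 𝓘(ℝ, E) 𝓘(ℝ, E) ∞ (extChartAt 𝓘(ℝ, E) z)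
      (φ 0 ((extChartAt 𝓘(ℝ, E) z).symm ξ₀)) := by
    rw [hz]
    exact contMDiffAt_extChartAt
  exact ContMDiffAt.comp (0, ξ₀) h3 h2

theorem contDiffAt_fderiv_flowChart (hφ : IsFlow X φ) (z : M) :
    ContDiffAt ℝ ∞ (fderiv ℝ (flowChart (E := E) φ z)) (0, extChartAt 𝓘(ℝ, E) z z) :=
  (contDiffAt_flowChart hφ z).fderiv_right (by norm_cast)

theorem eventually_differentiableAt_flowChart (hφ : IsFlow X φ) (z : M) :
    ∀ᶠ q in 𝓝 ((0 : ℝ), extChartAt 𝓘(ℝ, E) z z),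
      DifferentiableAt ℝ (flowChart (E := E) φ z) q :=
  (((contDiffAt_flowChart hφ z).of_le (m := 1) (by norm_cast)).eventually (by simp)).mono
    fun _ h => h.differentiableAt (by simp)

/-- In the chart at `z`, the vector field is the time derivative of the flow. -/
theorem tc_field_eq_fderiv_flowChart (hφ : IsFlow X φ) (z : M) :
    ∀ᶠ y in 𝓝 z, tc z y (X y) =
      fderiv ℝ (flowChart (E := E) φ z) (0, extChartAt 𝓘(ℝ, E) z y) (1, 0) := by
  have hc : Filter.Tendsto (fun y => ((0 : ℝ), extChartAt 𝓘(ℝ, E) z y)) (𝓝 z)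
      (𝓝 (0, extChartAt 𝓘(ℝ, E) z z)) :=
    (continuousAt_const.prodMk (continuousAt_extChartAt z))
  filter_upwards [source_mem_nhds (E := E) z,
    hc.eventually (eventually_differentiableAt_flowChart hφ z)] with y hy hd
  have h1 := hφ.integral y 0
  have key : ∀ y', y' = y → y' ∈ (chartAt E z).source → tc z y' (X y') = tc z y (X y) := by
    rintro _ rfl _; rfl
  have h2 := hasDerivAt_extChartAt_comp h1 (z := z) (by rwa [hφ.zero])
  simp only at h2
  rw [key (φ 0 y) (hφ.zero y) (by rwa [hφ.zero])] at h2
  have h3 : HasDerivAt (fun h : ℝ => (h, extChartAt 𝓘(ℝ, E) z y)) ((1 : ℝ), (0 : E)) 0 :=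
    (hasDerivAt_id 0).prodMk (hasDerivAt_const _ _)
  have h4 := hd.hasFDerivAt.comp_hasDerivAt (0 : ℝ) h3
  have hleft : (extChartAt 𝓘(ℝ, E) z).symm (extChartAt 𝓘(ℝ, E) z y) = y :=
    (extChartAt 𝓘(ℝ, E) z).left_inv (by rwa [extChartAt_source])
  have h5 : (flowChart (E := E) φ z ∘ fun h : ℝ => (h, extChartAt 𝓘(ℝ, E) z y)) =
      fun h => extChartAt 𝓘(ℝ, E) z (φ h y) := by
    funext h
    simp only [Function.comp, flowChart, hleft]
  rw [h5] at h4
  exact h2.unique h4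

/-- The generator of a smooth flow is a smooth vector field. -/
theorem IsFlow.smoothFieldAt (hφ : IsFlow X φ) (z : M) : SmoothFieldAt X z := by
  rw [smoothFieldAt_iff]
  have h : ContMDiffAt 𝓘(ℝ, E) 𝓘(ℝ, E) ∞ (fun y => fderiv ℝ (flowChart (E := E) φ z)
      (0, extChartAt 𝓘(ℝ, E) z y) (1, 0)) z := by
    have h1 : ContDiffAt ℝ ∞ (fun ξ => fderiv ℝ (flowChart (E := E) φ z) (0, ξ) (1, 0))
        (extChartAt 𝓘(ℝ, E) z z) :=
      ((contDiffAt_fderiv_flowChart hφ z).comp _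
        (contDiffAt_const.prodMk contDiffAt_id)).clm_apply contDiffAt_const
    exact h1.comp_contMDiffAt (x := z) contMDiffAt_extChartAt
  exact h.congr_of_eventuallyEq (tc_field_eq_fderiv_flowChart hφ z)

theorem IsFlow.add [CompleteSpace E] [T2Space M] (hφ : IsFlow X φ) (s t : ℝ) (x : M) :
    φ (s + t) x = φ s (φ t x) := by
  have hX : ContMDiff 𝓘(ℝ, E) 𝓘(ℝ, E).tangent 1
      (fun x => (⟨x, X x⟩ : TangentBundle 𝓘(ℝ, E) M)) := fun x =>
    ContMDiffAt.of_le (hφ.smoothFieldAt x) (by norm_cast)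
  have h1 : IsMIntegralCurve (I := 𝓘(ℝ, E)) (fun s => φ (s + t) x) X :=
    (hφ.integral x).comp_add t
  have h2 := isMIntegralCurve_Ioo_eq_of_contMDiff_boundaryless (t₀ := 0) hX h1
    (hφ.integral (φ t x)) (by simp [hφ.zero])
  exact congrFun h2 s

theorem IsFlow.add_fun [CompleteSpace E] [T2Space M] (hφ : IsFlow X φ) (s t : ℝ) :
    φ (s + t) = φ s ∘ φ t := funext fun x => hφ.add s t x

omit [IsManifold 𝓘(ℝ, E) ∞ M] in
theorem IsFlow.contMDiff (hφ : IsFlow X φ) (t : ℝ) : ContMDiff 𝓘(ℝ, E) 𝓘(ℝ, E) ∞ (φ t) :=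
  hφ.smooth.comp (contMDiff_const.prodMk contMDiff_id)

omit [IsManifold 𝓘(ℝ, E) ∞ M] in
theorem IsFlow.mdifferentiableAt (hφ : IsFlow X φ) (t : ℝ) (x : M) :
    MDifferentiableAt 𝓘(ℝ, E) 𝓘(ℝ, E) (φ t) x :=
  (hφ.contMDiff t).mdifferentiableAt (by simp)

omit [IsManifold 𝓘(ℝ, E) ∞ M] in
theorem IsFlow.continuous (hφ : IsFlow X φ) : Continuous (fun p : ℝ × M => φ p.1 p.2) :=
  hφ.smooth.continuous

/-- The coordinates of `dφ_h v` in the chart at `z`. -/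
theorem tc_mfderiv_eq_fderiv_flowChart (hφ : IsFlow X φ) (z : M) (v : E) :
    ∀ᶠ h in 𝓝 (0 : ℝ), tc (E := E) z (φ h z) (mfderiv 𝓘(ℝ, E) 𝓘(ℝ, E) (φ h) z v) =
      fderiv ℝ (flowChart (E := E) φ z) (h, extChartAt 𝓘(ℝ, E) z z) (0, v) := by
  have hc : Filter.Tendsto (fun h : ℝ => (h, extChartAt 𝓘(ℝ, E) z z)) (𝓝 0)
      (𝓝 (0, extChartAt 𝓘(ℝ, E) z z)) := (continuousAt_id.prodMk continuousAt_const)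
  have hc2 : Filter.Tendsto (fun h : ℝ => φ h z) (𝓝 0) (𝓝 z) := by
    have : ContinuousAt (fun h : ℝ => φ h z) 0 :=
      (hφ.continuous.comp (by fun_prop : Continuous fun h : ℝ => (h, z))).continuousAt
    rwa [ContinuousAt, hφ.zero] at this
  filter_upwards [hc2.eventually (source_mem_nhds (E := E) z),
    hc.eventually (eventually_differentiableAt_flowChart hφ z)] with h hy hd
  have h1 : HasMFDerivAt 𝓘(ℝ, E) 𝓘(ℝ, E) (fun y => extChartAt 𝓘(ℝ, E) z (φ h y)) z
      (tc (E := E) z (φ h z) ∘L mfderiv 𝓘(ℝ, E) 𝓘(ℝ, E) (φ h) z) :=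
    (hasMFDerivAt_extChartAt_tc hy).comp z (hφ.mdifferentiableAt h z).hasMFDerivAt
  have h2 := mvfderiv_apply_self h1.mdifferentiableAt v
  have h3 : HasFDerivAt (fun ξ : E => (h, ξ)) (ContinuousLinearMap.inr ℝ ℝ E)
      (extChartAt 𝓘(ℝ, E) z z) := hasFDerivAt_prodMk_right _ _
  have h4 := hd.hasFDerivAt.comp (extChartAt 𝓘(ℝ, E) z z) h3
  have h5 : fderiv ℝ (fun ξ => extChartAt 𝓘(ℝ, E) z (φ h ((extChartAt 𝓘(ℝ, E) z).symm ξ)))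
    (extChartAt 𝓘(ℝ, E) z z) v =
      fderiv ℝ (flowChart (E := E) φ z) (h, extChartAt 𝓘(ℝ, E) z z) (0, v) := by
    have h6 := h4.fderiv
    exact congrArg (fun A : E →L[ℝ] E => A v) h6
  rw [← h5, ← h2]
  have h7 := h1.mfderiv
  exact (congrArg (fun A : E →L[ℝ] E => A v) h7).symm

/-- The differential of the flow is, infinitesimally, the differential of the vector field. -/
theorem hasDerivAt_fderiv_flowChart (hφ : IsFlow X φ) (z : M) (v : E) :
    HasDerivAt (fun h : ℝ => fderiv ℝ (flowChart (E := E) φ z) (h, extChartAt 𝓘(ℝ, E) z z) (0, v))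
      (fderiv ℝ (fun ξ => fderiv ℝ (flowChart (E := E) φ z) (0, ξ) (1, 0))
        (extChartAt 𝓘(ℝ, E) z z) v) 0 :=
  hasDerivAt_fderiv_swap (contDiffAt_flowChart hφ z) v

end Flow

/-! ### Hamiltonian flows preserve the symplectic form -/

section BilinearCalculus

variable {E : Type*} [NormedAddCommGroup E] [NormedSpace ℝ E]

set_option synthInstance.maxHeartbeats 200000 in
theorem fderiv_bilinear_apply {O : E → E →L[ℝ] E →L[ℝ] ℝ} {O' : E →L[ℝ] E →L[ℝ] E →L[ℝ] ℝ} {ξ₀ : E}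
    (hO : HasFDerivAt O O' ξ₀) (u v w : E) : fderiv ℝ (fun ξ => O ξ v w) ξ₀ u = O' u v w := by
  have h1 : HasFDerivAt (fun ξ => O ξ v) ((ContinuousLinearMap.apply ℝ (E →L[ℝ] ℝ) v).comp O') ξ₀ :=
    HasFDerivAt.comp (g := ⇑(ContinuousLinearMap.apply ℝ (E →L[ℝ] ℝ) v)) (f := O) ξ₀
      (ContinuousLinearMap.apply ℝ (E →L[ℝ] ℝ) v).hasFDerivAt hO
  have h2 : HasFDerivAt (fun ξ => O ξ v w) ((ContinuousLinearMap.apply ℝ ℝ w).comp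
      ((ContinuousLinearMap.apply ℝ (E →L[ℝ] ℝ) v).comp O')) ξ₀ :=
    HasFDerivAt.comp (g := ⇑(ContinuousLinearMap.apply ℝ ℝ w)) (f := fun ξ => O ξ v) ξ₀
      (ContinuousLinearMap.apply ℝ ℝ w).hasFDerivAt h1
  rw [h2.fderiv]
  rfl

set_option synthInstance.maxHeartbeats 200000 in
theorem hasDerivAt_bilinear {O : E → E →L[ℝ] E →L[ℝ] ℝ} {O' : E →L[ℝ] E →L[ℝ] E →L[ℝ] ℝ} {ξ₀ : E}
    (hO : HasFDerivAt O O' ξ₀) {γ a b : ℝ → E} {γ' a' b' : E} {t : ℝ} (hγ : HasDerivAt γ γ' t)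
    (hγt : γ t = ξ₀) (ha : HasDerivAt a a' t) (hb : HasDerivAt b b' t) :
    HasDerivAt (fun h => O (γ h) (a h) (b h))
      (O' γ' (a t) (b t) + O ξ₀ a' (b t) + O ξ₀ (a t) b') t := by
  subst hγt
  have h1 : HasDerivAt (fun h => O (γ h)) (O' γ') t :=
    HasFDerivAt.comp_hasDerivAt (l := O) (f := γ) t hO hγ
  exact (h1.clm_apply ha).clm_apply hb

end BilinearCalculus

section Hamiltonian

variable {E : Type*} [NormedAddCommGroup E] [NormedSpace ℝ E] [FiniteDimensional ℝ E]
  {M : Type*} [TopologicalSpace M] [ChartedSpace E M] [IsManifold 𝓘(ℝ, E) ∞ M]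
  {X : Π x : M, TangentSpace 𝓘(ℝ, E) x} {φ : ℝ → M → M}
  {Ω : Π x : M, TangentSpace 𝓘(ℝ, E) x →ₗ[ℝ] TangentSpace 𝓘(ℝ, E) x →ₗ[ℝ] ℝ} {f : M → ℝ}

/-- A bilinear form on the tangent bundle in the chart at `z`. -/
def formCoord (Ω : Π x : M, TangentSpace 𝓘(ℝ, E) x →ₗ[ℝ] TangentSpace 𝓘(ℝ, E) x →ₗ[ℝ] ℝ)
    (z y : M) : E →L[ℝ] E →L[ℝ] ℝ :=
  LinearMap.toContinuousLinearMap
    ((LinearMap.toContinuousLinearMap (𝕜 := ℝ) (E := E) (F' := ℝ)).toLinearMap ∘ₗ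
      (Ω y).compl₁₂ (ts (E := E) z y).toLinearMap (ts (E := E) z y).toLinearMap)

theorem formCoord_apply (z y : M) (v w : E) :
    formCoord Ω z y v w = Ω y (ts z y v) (ts z y w) := rfl

theorem contMDiffAt_formCoord (hΩ : IsSymplectic Ω) (z : M) :
    ContMDiffAt 𝓘(ℝ, E) 𝓘(ℝ, E →L[ℝ] E →L[ℝ] ℝ) ∞ (formCoord Ω z) z :=
  contMDiffAt_clm_of_apply fun v => contMDiffAt_clm_of_apply fun w =>
    hΩ.smooth z _ _ (smoothFieldAt_ts z v) (smoothFieldAt_ts z w)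

omit [FiniteDimensional ℝ E] in
theorem IsSymplectic.antisymm (hΩ : IsSymplectic Ω) (x : M) (v w : TangentSpace 𝓘(ℝ, E) x) :
    Ω x v w = -Ω x w v := by
  have h := hΩ.alternating x (v + w)
  simp only [map_add, LinearMap.add_apply, hΩ.alternating, zero_add, add_zero] at h
  linarith

omit [FiniteDimensional ℝ E] in
theorem contDiffAt_comp_extChartAt_symm {F : Type*} [NormedAddCommGroup F] [NormedSpace ℝ F]
    {g : M → F} {z : M} (hg : ContMDiffAt 𝓘(ℝ, E) 𝓘(ℝ, F) ∞ g z) :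
    ContDiffAt ℝ ∞ (fun ξ => g ((extChartAt 𝓘(ℝ, E) z).symm ξ)) (extChartAt 𝓘(ℝ, E) z z) := by
  rw [← contMDiffAt_iff_contDiffAt]
  refine ContMDiffAt.comp (extChartAt 𝓘(ℝ, E) z z) (g := g) ?_
    (contMDiffAt_extChartAt_symm_self z)
  rwa [extChartAt_to_inv]

omit [FiniteDimensional ℝ E] in
/-- Mixed second derivatives of `f`, expressed by the form `Ω` and the Hamiltonian field. -/
theorem mvfderiv_hamiltonian (hΩ : IsSymplectic Ω) (hf : ContMDiff 𝓘(ℝ, E) 𝓘(ℝ, ℝ) ∞ f)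
    (hX : IsHamiltonianField Ω f X) (hφ : IsFlow X φ) (z : M) (v w : E) :
    mvfderiv 𝓘(ℝ, E) (fun y => Ω y (X y) (ts z y w)) z v =
      -fderiv ℝ (fderiv ℝ (fun ξ => f ((extChartAt 𝓘(ℝ, E) z).symm ξ)))
        (extChartAt 𝓘(ℝ, E) z z) v w := by
  have hd : MDifferentiableAt 𝓘(ℝ, E) 𝓘(ℝ, ℝ) (fun y => Ω y (X y) (ts z y w)) z :=
    (hΩ.smooth z _ _ (hφ.smoothFieldAt z) (smoothFieldAt_ts z w)).mdifferentiableAt (by simp)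
  rw [mvfderiv_apply_self hd v]
  have hev : (fun ξ => Ω ((extChartAt 𝓘(ℝ, E) z).symm ξ) (X ((extChartAt 𝓘(ℝ, E) z).symm ξ))
      (ts z ((extChartAt 𝓘(ℝ, E) z).symm ξ) w)) =ᶠ[𝓝 (extChartAt 𝓘(ℝ, E) z z)]
      fun ξ => -fderiv ℝ (fun ξ => f ((extChartAt 𝓘(ℝ, E) z).symm ξ)) ξ w := by
    filter_upwards [(tendsto_extChartAt_symm z).eventually (source_mem_nhds (E := E) z),
      extChartAt_target_mem_nhds (I := 𝓘(ℝ, E)) z] with ξ h2 h3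
    rw [hX, mvfderiv_apply_ts h2 ((hf _).mdifferentiableAt (by simp)),
      (extChartAt 𝓘(ℝ, E) z).right_inv h3]
  rw [hev.fderiv_eq]
  have hc := contDiffAt_comp_extChartAt_symm (hf z)
  have hd2 : HasFDerivAt (fderiv ℝ (fun ξ => f ((extChartAt 𝓘(ℝ, E) z).symm ξ))) _
      (extChartAt 𝓘(ℝ, E) z z) :=
    ((hc.fderiv_right (m := 1) (by norm_cast)).differentiableAt (by simp)).hasFDerivAt
  have hd3 := ((ContinuousLinearMap.apply ℝ ℝ w).hasFDerivAt.comp _ hd2).neg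
  have := hd3.fderiv
  exact congrArg (fun A : E →L[ℝ] ℝ => A v) this

set_option synthInstance.maxHeartbeats 200000 in
set_option maxHeartbeats 1000000 in
/-- `ℒ_X Ω = 0` at time zero. In the chart at `z`, the derivative of `Ω(dφ_h v, dφ_h w)` has three
terms, which form the left-hand side of Cartan's formula for `dΩ(X, v, w) = 0` with `v` and `w`
extended as constant fields, up to the terms `v(Ω(X, w)) - w(Ω(X, v))`. Those cancel because
`Ω(X, ·) = -df` and the second derivative of `f` is symmetric. -/
theorem hasDerivAt_form_mfderiv_zero (hΩ : IsSymplectic Ω) (hf : ContMDiff 𝓘(ℝ, E) 𝓘(ℝ, ℝ) ∞ f)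
    (hX : IsHamiltonianField Ω f X) (hφ : IsFlow X φ) (z : M) (v w : E) :
    HasDerivAt (fun h : ℝ => Ω (φ h z) (mfderiv 𝓘(ℝ, E) 𝓘(ℝ, E) (φ h) z v)
      (mfderiv 𝓘(ℝ, E) 𝓘(ℝ, E) (φ h) z w)) 0 0 := by
  let ξ₀ := extChartAt 𝓘(ℝ, E) z z
  let G := flowChart (E := E) φ z
  let Xc : E → E := fun ξ => fderiv ℝ G (0, ξ) (1, 0)
  let O : E → E →L[ℝ] E →L[ℝ] ℝ := fun ξ => formCoord Ω z ((extChartAt 𝓘(ℝ, E) z).symm ξ)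
  have hO : HasFDerivAt O (fderiv ℝ O ξ₀) ξ₀ :=
    ((contDiffAt_comp_extChartAt_symm (contMDiffAt_formCoord hΩ z)).differentiableAt
      (by simp)).hasFDerivAt
  have hXc : DifferentiableAt ℝ Xc ξ₀ := by
    have h1 : ContDiffAt ℝ ∞ Xc ξ₀ :=
      ((contDiffAt_fderiv_flowChart hφ z).comp _
        (contDiffAt_const.prodMk contDiffAt_id)).clm_apply contDiffAt_const
    exact h1.differentiableAt (by simp)
  have hXev := tc_field_eq_fderiv_flowChart hφ z
  have hVev : ∀ v : E, ∀ᶠ y in 𝓝 z, tc z y (ts z y v) = (fun _ : E => v) (extChartAt 𝓘(ℝ, E) z y) :=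
    fun v => by filter_upwards [source_mem_nhds (E := E) z] with y hy using tc_ts hy v
  have hX0 : (X z : E) = Xc ξ₀ := (tc_self z (X z)).symm.trans hXev.self_of_nhds
  -- the Lie brackets with constant fields
  have hb : ∀ v : E, (VectorField.mlieBracket 𝓘(ℝ, E) X (fun y => ts z y v) z : E) =
      -fderiv ℝ Xc ξ₀ v := fun v => by
    rw [mlieBracket_eq X (fun y => ts z y v) (Vc := Xc) (Wc := fun _ => v) hXev (hVev v)]
    simp [VectorField.lieBracket, ξ₀]
    rfl
  have hb0 : (VectorField.mlieBracket 𝓘(ℝ, E) (fun y => ts z y v) (fun y => ts z y w) z : E) =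
      0 := by
    rw [mlieBracket_eq (fun y => ts z y v) (fun y => ts z y w) (Vc := fun _ => v)
      (Wc := fun _ => w) (hVev v) (hVev w)]
    simp [VectorField.lieBracket]
    rfl
  have hOz : ∀ a b : E, Ω z a b = O ξ₀ a b := fun a b => by
    change _ = formCoord Ω z ((extChartAt 𝓘(ℝ, E) z).symm (extChartAt 𝓘(ℝ, E) z z)) a b
    rw [extChartAt_to_inv, formCoord_apply]
    have e1 := ts_self z a
    have e2 := ts_self z b
    exact (congrArg₂ (fun p q : E => Ω z p q) e1 e2).symm
  have hOanti : ∀ a b : E, O ξ₀ a b = -O ξ₀ b a := fun a b => by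
    rw [← hOz, ← hOz]; exact hΩ.antisymm z a b
  -- Cartan's formula for `dΩ(X, V, W) = 0` with constant fields `V`, `W`
  have hcl := hΩ.closed z X (fun y => ts z y v) (fun y => ts z y w) (hφ.smoothFieldAt z)
    (smoothFieldAt_ts z v) (smoothFieldAt_ts z w)
  have ev : (ts z z v : E) = v := ts_self z v
  have ew : (ts z z w : E) = w := ts_self z w
  have h1 : mvfderiv 𝓘(ℝ, E) (fun y => Ω y (ts z y v) (ts z y w)) z (X z) =
      fderiv ℝ O ξ₀ (Xc ξ₀) v w := by
    have hd : MDifferentiableAt 𝓘(ℝ, E) 𝓘(ℝ, ℝ) (fun y => Ω y (ts z y v) (ts z y w)) z :=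
      (hΩ.smooth z _ _ (smoothFieldAt_ts z v) (smoothFieldAt_ts z w)).mdifferentiableAt (by simp)
    rw [mvfderiv_apply_self hd (X z)]
    have h3 := fderiv_bilinear_apply hO (Xc ξ₀) v w
    refine Eq.trans ?_ h3
    exact congrArg _ hX0
  have h2 := mvfderiv_hamiltonian hΩ hf hX hφ z v w
  have h3 := mvfderiv_hamiltonian hΩ hf hX hφ z w v
  have hsymm : IsSymmSndFDerivAt ℝ (fun ξ => f ((extChartAt 𝓘(ℝ, E) z).symm ξ))
      (extChartAt 𝓘(ℝ, E) z z) :=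
    (contDiffAt_comp_extChartAt_symm (hf z)).isSymmSndFDerivAt (by
      rw [minSmoothness_of_isRCLikeNormedField]; norm_cast)
  have h4 := hsymm v w
  have hsum : fderiv ℝ O ξ₀ (Xc ξ₀) v w + O ξ₀ (fderiv ℝ Xc ξ₀ v) w +
      O ξ₀ v (fderiv ℝ Xc ξ₀ w) = 0 := by
    have i1 : Ω z (VectorField.mlieBracket 𝓘(ℝ, E) X (fun y => ts z y v) z) (ts z z w) =
        -O ξ₀ (fderiv ℝ Xc ξ₀ v) w := by
      have := congrArg₂ (fun p q : E => Ω z p q) (hb v) ew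
      refine this.trans ?_
      refine (hOz _ _).trans ?_
      simp
    have i2 : Ω z (VectorField.mlieBracket 𝓘(ℝ, E) X (fun y => ts z y w) z) (ts z z v) =
        O ξ₀ v (fderiv ℝ Xc ξ₀ w) := by
      have := congrArg₂ (fun p q : E => Ω z p q) (hb w) ev
      refine this.trans ?_
      refine (hOz _ _).trans ?_
      rw [hOanti]; simp
    have i3 : Ω z (VectorField.mlieBracket 𝓘(ℝ, E) (fun y => ts z y v) (fun y => ts z y w) z)
        (X z) = 0 := by
      have := congrArg (fun p : E => Ω z p (X z)) hb0
      refine this.trans ?_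
      exact LinearMap.congr_fun (map_zero (Ω z)) _
    have i4 := congrArg (fun u : E => mvfderiv 𝓘(ℝ, E) (fun y => Ω y (X y) (ts z y w)) z u) ev
    have i5 := congrArg (fun u : E => mvfderiv 𝓘(ℝ, E) (fun y => Ω y (X y) (ts z y v)) z u) ew
    rw [i1, i2, i3, h1] at hcl
    have j4 := i4.trans h2
    have j5 := i5.trans h3
    linarith
  -- the derivative of the pulled back form in the chart
  have hev : (fun h : ℝ => Ω (φ h z) (mfderiv 𝓘(ℝ, E) 𝓘(ℝ, E) (φ h) z v)
      (mfderiv 𝓘(ℝ, E) 𝓘(ℝ, E) (φ h) z w)) =ᶠ[𝓝 0]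
      fun h => O (G (h, ξ₀)) (fderiv ℝ G (h, ξ₀) (0, v)) (fderiv ℝ G (h, ξ₀) (0, w)) := by
    have hc2 : Filter.Tendsto (fun h : ℝ => φ h z) (𝓝 0) (𝓝 z) := by
      have : ContinuousAt (fun h : ℝ => φ h z) 0 :=
        (hφ.continuous.comp (by fun_prop : Continuous fun h : ℝ => (h, z))).continuousAt
      rwa [ContinuousAt, hφ.zero] at this
    filter_upwards [hc2.eventually (source_mem_nhds (E := E) z),
      tc_mfderiv_eq_fderiv_flowChart hφ z v, tc_mfderiv_eq_fderiv_flowChart hφ z w] with h k1 k2 k3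
    have hleft : (extChartAt 𝓘(ℝ, E) z).symm (G (h, ξ₀)) = φ h z := by
      change (extChartAt 𝓘(ℝ, E) z).symm (extChartAt 𝓘(ℝ, E) z (φ h
        ((extChartAt 𝓘(ℝ, E) z).symm (extChartAt 𝓘(ℝ, E) z z)))) = φ h z
      rw [extChartAt_to_inv]
      exact (extChartAt 𝓘(ℝ, E) z).left_inv (by rwa [extChartAt_source])
    change _ = formCoord Ω z ((extChartAt 𝓘(ℝ, E) z).symm (G (h, ξ₀))) _ _
    rw [hleft, ← k2, ← k3, formCoord_apply, ts_tc k1, ts_tc k1]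
  have hG : DifferentiableAt ℝ G (0, ξ₀) := (contDiffAt_flowChart hφ z).differentiableAt (by simp)
  have hG0 : G (0, ξ₀) = ξ₀ := by
    change extChartAt 𝓘(ℝ, E) z (φ 0 ((extChartAt 𝓘(ℝ, E) z).symm (extChartAt 𝓘(ℝ, E) z z))) = _
    rw [hφ.zero, extChartAt_to_inv]
  have hγ : HasDerivAt (fun h : ℝ => (h, ξ₀)) ((1 : ℝ), (0 : E)) 0 :=
    (hasDerivAt_id 0).prodMk (hasDerivAt_const _ _)
  have hGd : HasDerivAt (fun h : ℝ => G (h, ξ₀)) (Xc ξ₀) 0 :=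
    HasFDerivAt.comp_hasDerivAt (l := G) (f := fun h : ℝ => (h, ξ₀)) 0 hG.hasFDerivAt hγ
  have hfin := hasDerivAt_bilinear hO hGd hG0 (hasDerivAt_fderiv_flowChart hφ z v)
    (hasDerivAt_fderiv_flowChart hφ z w)
  have i0 : ∀ v : E, fderiv ℝ G (0, ξ₀) (0, v) = v := fun v => by
    have := (tc_mfderiv_eq_fderiv_flowChart hφ z v).self_of_nhds
    refine this.symm.trans ?_
    have hid : φ 0 = id := funext hφ.zero
    have key : ∀ ψ : M → M, ψ = id → tc (E := E) z (ψ z) (mfderiv 𝓘(ℝ, E) 𝓘(ℝ, E) ψ z v) = v := by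
      rintro _ rfl
      rw [mfderiv_id]
      exact tc_self z v
    exact key _ hid
  refine HasDerivAt.congr_of_eventuallyEq ?_ hev
  have e : fderiv ℝ O ξ₀ (Xc ξ₀) (fderiv ℝ G (0, ξ₀) (0, v)) (fderiv ℝ G (0, ξ₀) (0, w)) +
      O ξ₀ (fderiv ℝ Xc ξ₀ v) (fderiv ℝ G (0, ξ₀) (0, w)) +
      O ξ₀ (fderiv ℝ G (0, ξ₀) (0, v)) (fderiv ℝ Xc ξ₀ w) = 0 := by
    rw [i0, i0]; exact hsum
  exact hfin.congr_deriv e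

end Hamiltonian

/-! ### Pulling back almost complex structures by a Hamiltonian flow -/

section Pullback

variable {E : Type*} [NormedAddCommGroup E] [NormedSpace ℝ E] [FiniteDimensional ℝ E]
  {M : Type*} [TopologicalSpace M] [ChartedSpace E M] [IsManifold 𝓘(ℝ, E) ∞ M] [T2Space M]
  {X : Π x : M, TangentSpace 𝓘(ℝ, E) x} {φ : ℝ → M → M}
  {Ω : Π x : M, TangentSpace 𝓘(ℝ, E) x →ₗ[ℝ] TangentSpace 𝓘(ℝ, E) x →ₗ[ℝ] ℝ} {f : M → ℝ}
  {j : Π x : M, TangentSpace 𝓘(ℝ, E) x →L[ℝ] TangentSpace 𝓘(ℝ, E) x}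

/-- The cocycle identity `dφ_{s+t} = dφ_s ∘ dφ_t`. It is stated in the model space `E`, to which
every tangent space reduces, because `φ (s + t) x` and `φ s (φ t x)` are only propositionally equal.
-/
theorem IsFlow.mfderiv_add (hφ : IsFlow X φ) (s t : ℝ) (x : M) (v : TangentSpace 𝓘(ℝ, E) x) :
    (mfderiv 𝓘(ℝ, E) 𝓘(ℝ, E) (φ (s + t)) x v : E) =
      mfderiv 𝓘(ℝ, E) 𝓘(ℝ, E) (φ s) (φ t x) (mfderiv 𝓘(ℝ, E) 𝓘(ℝ, E) (φ t) x v) := by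
  have : CompleteSpace E := FiniteDimensional.complete ℝ E
  have key : ∀ ψ : M → M, ψ = φ s ∘ φ t → (mfderiv 𝓘(ℝ, E) 𝓘(ℝ, E) ψ x v : E) =
      mfderiv 𝓘(ℝ, E) 𝓘(ℝ, E) (φ s) (φ t x) (mfderiv 𝓘(ℝ, E) 𝓘(ℝ, E) (φ t) x v) := by
    rintro _ rfl
    have := mfderiv_comp x (hφ.mdifferentiableAt s (φ t x)) (hφ.mdifferentiableAt t x)
    exact congrArg (fun A : E →L[ℝ] E => A v) this
  exact key _ (hφ.add_fun s t)

omit [FiniteDimensional ℝ E] [IsManifold 𝓘(ℝ, E) ∞ M] [T2Space M] in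
theorem IsFlow.mfderiv_zero (hφ : IsFlow X φ) (x : M) (v : TangentSpace 𝓘(ℝ, E) x) :
    (mfderiv 𝓘(ℝ, E) 𝓘(ℝ, E) (φ 0) x v : E) = v := by
  have key : ∀ ψ : M → M, ψ = id → (mfderiv 𝓘(ℝ, E) 𝓘(ℝ, E) ψ x v : E) = v := by
    rintro _ rfl
    rw [mfderiv_id]
    rfl
  exact key _ (funext hφ.zero)

/-- The flow of a Hamiltonian field consists of symplectomorphisms. -/
theorem form_mfderiv (hΩ : IsSymplectic Ω) (hf : ContMDiff 𝓘(ℝ, E) 𝓘(ℝ, ℝ) ∞ f)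
    (hX : IsHamiltonianField Ω f X) (hφ : IsFlow X φ) (t : ℝ) (x : M)
    (v w : TangentSpace 𝓘(ℝ, E) x) :
    Ω (φ t x) (mfderiv 𝓘(ℝ, E) 𝓘(ℝ, E) (φ t) x v) (mfderiv 𝓘(ℝ, E) 𝓘(ℝ, E) (φ t) x w) =
      Ω x v w := by
  have : CompleteSpace E := FiniteDimensional.complete ℝ E
  have base : ∀ (y y' : M) (a b : E), y = y' → Ω y a b = Ω y' a b := by
    rintro y _ a b rfl; rfl
  let F : ℝ → ℝ := fun t => Ω (φ t x) (mfderiv 𝓘(ℝ, E) 𝓘(ℝ, E) (φ t) x v)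
    (mfderiv 𝓘(ℝ, E) 𝓘(ℝ, E) (φ t) x w)
  have hF : ∀ t, HasDerivAt F 0 t := fun t => by
    have h := hasDerivAt_form_mfderiv_zero hΩ hf hX hφ (φ t x)
      (mfderiv 𝓘(ℝ, E) 𝓘(ℝ, E) (φ t) x v) (mfderiv 𝓘(ℝ, E) 𝓘(ℝ, E) (φ t) x w)
    have h' : HasDerivAt (fun h => F (h + t)) 0 0 := by
      refine h.congr_of_eventuallyEq (Filter.Eventually.of_forall fun h => ?_)
      have e1 := hφ.mfderiv_add h t x v
      have e2 := hφ.mfderiv_add h t x w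
      refine (congrArg₂ (fun a b : E => Ω (φ (h + t) x) a b) e1 e2).trans ?_
      exact base _ _ _ _ (hφ.add h t x)
    have h2 := HasDerivAt.comp_sub_const t t (f := fun h => F (h + t)) (by rwa [sub_self])
    simpa using h2
  have hc : F t = F 0 := is_const_of_deriv_eq_zero (fun t => (hF t).differentiableAt)
    (fun t => (hF t).deriv) t 0
  refine hc.trans ?_
  have e1 := hφ.mfderiv_zero x v
  have e2 := hφ.mfderiv_zero x w
  refine (congrArg₂ (fun a b : E => Ω (φ 0 x) a b) e1 e2).trans ?_
  exact base _ _ _ _ (hφ.zero x)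

omit [FiniteDimensional ℝ E] [T2Space M] in
/-- Conservation of energy. -/
theorem hamiltonian_flow (hΩ : IsSymplectic Ω) (hf : ContMDiff 𝓘(ℝ, E) 𝓘(ℝ, ℝ) ∞ f)
    (hX : IsHamiltonianField Ω f X) (hφ : IsFlow X φ) (t : ℝ) (x : M) : f (φ t x) = f x := by
  have hF : ∀ t, HasDerivAt (fun t => f (φ t x)) 0 t := fun t => by
    have h := hasDerivAt_comp_curve (hφ.integral x t) ((hf (φ t x)).mdifferentiableAt (by simp))
    have h0 : mvfderiv 𝓘(ℝ, E) f (φ t x) (X (φ t x)) = 0 := by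
      have := hX (φ t x) (X (φ t x))
      rw [hΩ.alternating] at this
      linarith
    exact h0 ▸ h
  have hc := is_const_of_deriv_eq_zero (fun t => (hF t).differentiableAt)
    (fun t => (hF t).deriv) t 0
  simpa [hφ.zero] using hc

theorem IsFlow.mfderiv_neg_apply (hφ : IsFlow X φ) (t : ℝ) (x : M) (v : TangentSpace 𝓘(ℝ, E) x) :
    (mfderiv 𝓘(ℝ, E) 𝓘(ℝ, E) (φ (-t)) (φ t x) (mfderiv 𝓘(ℝ, E) 𝓘(ℝ, E) (φ t) x v) : E) = v := by
  refine (hφ.mfderiv_add (-t) t x v).symm.trans ?_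
  have key : ∀ s : ℝ, s = 0 → (mfderiv 𝓘(ℝ, E) 𝓘(ℝ, E) (φ s) x v : E) = v := by
    rintro _ rfl; exact hφ.mfderiv_zero x v
  exact key _ (neg_add_cancel t)

theorem IsFlow.mfderiv_injective (hφ : IsFlow X φ) (t : ℝ) (x : M) :
    Function.Injective (mfderiv 𝓘(ℝ, E) 𝓘(ℝ, E) (φ t) x) := fun v w h =>
  (hφ.mfderiv_neg_apply t x v).symm.trans
    ((congrArg (fun u : E => (mfderiv 𝓘(ℝ, E) 𝓘(ℝ, E) (φ (-t)) (φ t x) u : E)) h).trans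
      (hφ.mfderiv_neg_apply t x w))

theorem exists_equiv_of_injective (D : E →L[ℝ] E) (hD : Function.Injective D) :
    ∃ e : E ≃L[ℝ] E, (e : E →L[ℝ] E) = D :=
  ⟨(LinearEquiv.ofInjectiveEndo (D : E →ₗ[ℝ] E) hD).toContinuousLinearEquiv, by ext v; rfl⟩

/-- `dφ_t` intertwines `φ_t^* j` and `j`. -/
theorem mfderiv_pullbackACS (hφ : IsFlow X φ) (t : ℝ) (x : M) (v : TangentSpace 𝓘(ℝ, E) x) :
    mfderiv 𝓘(ℝ, E) 𝓘(ℝ, E) (φ t) x (pullbackACS (φ t) j x v) =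
      j (φ t x) (mfderiv 𝓘(ℝ, E) 𝓘(ℝ, E) (φ t) x v) := by
  obtain ⟨e, he⟩ := exists_equiv_of_injective (E := E) (mfderiv 𝓘(ℝ, E) 𝓘(ℝ, E) (φ t) x)
    (hφ.mfderiv_injective t x)
  have key : ∀ (D : E →L[ℝ] E) (J : E →L[ℝ] E), (e : E →L[ℝ] E) = D →
      D ((D.inverse ∘L J ∘L D) v) = J (D v) := by
    rintro _ J rfl
    rw [ContinuousLinearMap.inverse_equiv]
    exact e.apply_symm_apply _
  exact key _ (j (φ t x)) he

/-- The pull-back of an almost complex structure along a flow is smooth jointly in time and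
space. -/
theorem contMDiffAt_endoCoord_pullbackACS (hφ : IsFlow X φ)
    (hj : ∀ (x : M) (X : Π y : M, TangentSpace 𝓘(ℝ, E) y),
      SmoothFieldAt X x → SmoothFieldAt (fun y => j y (X y)) x) (t₀ : ℝ) (x₀ : M) :
    ContMDiffAt (𝓘(ℝ, ℝ).prod 𝓘(ℝ, E)) 𝓘(ℝ, E →L[ℝ] E) ∞
      (fun p : ℝ × M => endoCoord (pullbackACS (φ p.1) j) x₀ p.2) (t₀, x₀) := by
  have hD := contMDiffAt_diffCoord hφ.smooth t₀ x₀
  have hJ : ContMDiffAt (𝓘(ℝ, ℝ).prod 𝓘(ℝ, E)) 𝓘(ℝ, E →L[ℝ] E) ∞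
      (fun p : ℝ × M => endoCoord j (φ t₀ x₀) (φ p.1 p.2)) (t₀, x₀) :=
    ContMDiffAt.comp (t₀, x₀) (g := endoCoord j (φ t₀ x₀)) (f := fun p : ℝ × M => φ p.1 p.2)
      (contMDiffAt_endoCoord (hj (φ t₀ x₀))) (hφ.smooth (t₀, x₀))
  have hinj : Function.Injective ((diffCoord (E := E) φ t₀ x₀ (t₀, x₀) : E →L[ℝ] E) :
      E →ₗ[ℝ] E) := by
    intro v w hvw
    have h1 : ∀ v : E, diffCoord (E := E) φ t₀ x₀ (t₀, x₀) v =
        (mfderiv 𝓘(ℝ, E) 𝓘(ℝ, E) (φ t₀) x₀ v : E) := fun v => by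
      refine (tc_self (φ t₀ x₀) _).trans ?_
      exact congrArg (fun u : E => (mfderiv 𝓘(ℝ, E) 𝓘(ℝ, E) (φ t₀) x₀ u : E)) (ts_self x₀ v)
    exact hφ.mfderiv_injective t₀ x₀ ((h1 v).symm.trans (Eq.trans hvw (h1 w)))
  obtain ⟨e, he⟩ := exists_equiv_of_injective _ hinj
  have hinv : ContMDiffAt (𝓘(ℝ, ℝ).prod 𝓘(ℝ, E)) 𝓘(ℝ, E →L[ℝ] E) ∞
      (fun p : ℝ × M => (diffCoord (E := E) φ t₀ x₀ p).inverse) (t₀, x₀) := by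
    have : CompleteSpace E := FiniteDimensional.complete ℝ E
    refine ContMDiffAt.comp (t₀, x₀) (g := ContinuousLinearMap.inverse)
      (f := diffCoord (E := E) φ t₀ x₀) ?_ hD
    rw [← he]
    exact (contDiffAt_map_inverse e).contMDiffAt
  have hcomp := (hinv.clm_comp (hJ.clm_comp hD))
  refine hcomp.congr_of_eventuallyEq ?_
  have : CompleteSpace E := FiniteDimensional.complete ℝ E
  have hnhds : ∀ᶠ p in 𝓝 (t₀, x₀), diffCoord (E := E) φ t₀ x₀ p ∈
      Set.range ((↑) : (E ≃L[ℝ] E) → E →L[ℝ] E) := by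
    refine hD.continuousAt.eventually ?_
    rw [← he]
    exact e.nhds
  have hs1 : ∀ᶠ p : ℝ × M in 𝓝 (t₀, x₀), p.2 ∈ (chartAt E x₀).source :=
    continuous_snd.continuousAt.eventually (source_mem_nhds x₀)
  have hs2 : ∀ᶠ p : ℝ × M in 𝓝 (t₀, x₀), φ p.1 p.2 ∈ (chartAt E (φ t₀ x₀)).source :=
    hφ.continuous.continuousAt.eventually (source_mem_nhds (φ t₀ x₀))
  filter_upwards [hnhds, hs1, hs2] with p hp1 hp2 hp3
  obtain ⟨e', he'⟩ := hp1
  ext w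
  have hkey : diffCoord (E := E) φ t₀ x₀ p (endoCoord (pullbackACS (φ p.1) j) x₀ p.2 w) =
      endoCoord j (φ t₀ x₀) (φ p.1 p.2) (diffCoord (E := E) φ t₀ x₀ p w) := by
    have h1 : ts (E := E) x₀ p.2 (endoCoord (pullbackACS (φ p.1) j) x₀ p.2 w) =
        pullbackACS (φ p.1) j p.2 (ts x₀ p.2 w) := ts_tc hp2 _
    have h2 : diffCoord (E := E) φ t₀ x₀ p (endoCoord (pullbackACS (φ p.1) j) x₀ p.2 w) =
        tc (E := E) (φ t₀ x₀) (φ p.1 p.2) (mfderiv 𝓘(ℝ, E) 𝓘(ℝ, E) (φ p.1) p.2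
          (pullbackACS (φ p.1) j p.2 (ts x₀ p.2 w))) := by
      rw [← h1]; rfl
    rw [h2, mfderiv_pullbackACS hφ]
    exact (endoCoord_tc j hp3 _).symm
  change _ = (diffCoord (E := E) φ t₀ x₀ p).inverse (endoCoord j (φ t₀ x₀) (φ p.1 p.2)
    (diffCoord (E := E) φ t₀ x₀ p w))
  rw [← hkey, ← he', ContinuousLinearMap.inverse_equiv]
  simp

/-- The space of compatible positive almost complex structures is preserved by Hamiltonian
flows. -/
theorem IsCompatible.pullbackACS (hΩ : IsSymplectic Ω) (hf : ContMDiff 𝓘(ℝ, E) 𝓘(ℝ, ℝ) ∞ f)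
    (hX : IsHamiltonianField Ω f X) (hφ : IsFlow X φ) (hj : IsCompatible Ω j) (t : ℝ) :
    IsCompatible Ω (pullbackACS (φ t) j) where
  smooth x Y hY := by
    refine smoothFieldAt_of_endoCoord ?_ hY
    exact ContMDiffAt.comp x (g := fun p : ℝ × M => endoCoord (HalfForm.pullbackACS (φ p.1) j) x p.2)
      (f := fun y => (t, y)) (contMDiffAt_endoCoord_pullbackACS hφ hj.smooth t x)
      (contMDiffAt_const.prodMk contMDiffAt_id)
  sq x v := by
    apply hφ.mfderiv_injective t x
    rw [mfderiv_pullbackACS hφ, mfderiv_pullbackACS hφ, hj.sq, map_neg]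
  compatible x v w := by
    rw [← form_mfderiv hΩ hf hX hφ t x, mfderiv_pullbackACS hφ, mfderiv_pullbackACS hφ,
      hj.compatible, form_mfderiv hΩ hf hX hφ]
  positive x v hv := by
    rw [← form_mfderiv hΩ hf hX hφ t x, mfderiv_pullbackACS hφ]
    refine hj.positive _ _ fun h => hv (hφ.mfderiv_injective t x ?_)
    rw [h, map_zero]

end Pullback

/-! ### The canonical forms of a half-form bundle in local frames -/

section MultilinearSmooth

variable {E : Type*} [NormedAddCommGroup E] [NormedSpace ℝ E] [FiniteDimensional ℝ E]
  {E' : Type*} [NormedAddCommGroup E'] [NormedSpace ℝ E'] {H : Type*} [TopologicalSpace H]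
  {I : ModelWithCorners ℝ E' H} {N : Type*} [TopologicalSpace N] [ChartedSpace H N]

/-- A family of multilinear maps that is smooth on constant arguments is smooth on smooth
arguments. -/
theorem contMDiffAt_multilinear_apply {n : ℕ} {F : N → MultilinearMap ℝ (fun _ : Fin n => E) ℂ}
    {p₀ : N} (hF : ∀ w : Fin n → E, ContMDiffAt I 𝓘(ℝ, ℂ) ∞ (fun p => F p w) p₀)
    {w : Fin n → N → E} (hw : ∀ i, ContMDiffAt I 𝓘(ℝ, E) ∞ (w i) p₀) :
    ContMDiffAt I 𝓘(ℝ, ℂ) ∞ (fun p => F p (fun i => w i p)) p₀ := by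
  classical
  let b := Module.finBasis ℝ E
  have e : (fun p => F p (fun i => w i p)) = fun p =>
      ∑ r : Fin n → Fin (Module.finrank ℝ E),
        (∏ i, b.coord (r i) (w i p)) • F p (fun i => b (r i)) := by
    funext p
    have h1 : (fun i => w i p) = fun i => ∑ a, b.coord a (w i p) • b a := by
      funext i
      exact (b.sum_repr (w i p)).symm
    rw [h1, MultilinearMap.map_sum]
    refine Finset.sum_congr rfl fun r _ => ?_
    rw [MultilinearMap.map_smul_univ]
  rw [e]
  refine ContMDiffAt.sum fun r _ => ?_
  have hprod : ContMDiffAt I 𝓘(ℝ, ℝ) ∞ (fun p => ∏ i, b.coord (r i) (w i p)) p₀ := by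
    refine contMDiffAt_finsetProd fun i _ => ?_
    have hl : ContMDiff 𝓘(ℝ, E) 𝓘(ℝ, ℝ) ∞ (b.coord (r i)) := by
      have := (LinearMap.toContinuousLinearMap (b.coord (r i))).contDiff (n := ∞)
      exact this.contMDiff
    exact hl.contMDiffAt.comp p₀ (hw i)
  exact (contDiff_smul (𝕜 := ℝ) (F := ℂ)).contDiffAt.comp_contMDiffAt (hprod.prodMk_space (hF _))

end MultilinearSmooth

section Tensor

variable {M : Type*} [TopologicalSpace M]
  {δ : M → Type*} [TopologicalSpace (TotalSpace ℂ δ)] [∀ x, TopologicalSpace (δ x)]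
  [∀ x, AddCommGroup (δ x)] [∀ x, Module ℂ (δ x)] [FiberBundle ℂ δ] [VectorBundle ℂ ℂ δ]

theorem frame_tmul_ne_zero {x₀ y : M} (hy : y ∈ frameDom δ x₀) :
    frameAt δ x₀ y ⊗ₜ[ℂ] frameAt δ x₀ y ≠ 0 := by
  intro h
  have := congrArg (LinearMap.mul' ℂ ℂ ∘ₗ TensorProduct.map (coordAt δ x₀ y) (coordAt δ x₀ y)) h
  simp [coordAt_frameAt hy] at this

theorem tmul_eq_smul_frame {x₀ y : M} (hy : y ∈ frameDom δ x₀) (u v : δ y) :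
    u ⊗ₜ[ℂ] v = (coordAt δ x₀ y u * coordAt δ x₀ y v) • (frameAt δ x₀ y ⊗ₜ[ℂ] frameAt δ x₀ y) := by
  conv_lhs => rw [← coordAt_smul_frameAt hy u, ← coordAt_smul_frameAt hy v]
  rw [TensorProduct.smul_tmul_smul]

theorem exists_eq_smul_frame {x₀ y : M} (hy : y ∈ frameDom δ x₀) (z : δ y ⊗[ℂ] δ y) :
    ∃ c : ℂ, z = c • (frameAt δ x₀ y ⊗ₜ[ℂ] frameAt δ x₀ y) := by
  induction z using TensorProduct.induction_on with
  | zero => exact ⟨0, by simp⟩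
  | tmul u v => exact ⟨_, tmul_eq_smul_frame hy u v⟩
  | add a b ha hb =>
    obtain ⟨c, hc⟩ := ha
    obtain ⟨d, hd⟩ := hb
    exact ⟨c + d, by rw [add_smul, ← hc, ← hd]⟩

end Tensor

section Phi

variable {E : Type*} [NormedAddCommGroup E] [NormedSpace ℝ E] [FiniteDimensional ℝ E]
  {M : Type*} [TopologicalSpace M] [ChartedSpace E M] [IsManifold 𝓘(ℝ, E) ∞ M]
  {δ : M → Type*} [TopologicalSpace (TotalSpace ℂ δ)] [∀ x, TopologicalSpace (δ x)]
  [∀ x, AddCommGroup (δ x)] [∀ x, Module ℂ (δ x)] [FiberBundle ℂ δ]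
  {n : ℕ} {Ω : Π x : M, TangentSpace 𝓘(ℝ, E) x →ₗ[ℝ] TangentSpace 𝓘(ℝ, E) x →ₗ[ℝ] ℝ}
  {jref j ja jb : Π x : M, TangentSpace 𝓘(ℝ, E) x →L[ℝ] TangentSpace 𝓘(ℝ, E) x}

omit [FiniteDimensional ℝ E] in
theorem IsCompatible.midMap_injective (ha : IsCompatible Ω ja) (hb : IsCompatible Ω jb) (x : M) :
    Function.Injective (midMap (ja x) (jb x)) :=
  HalfForm.midMap_injective (Ω := Ω x) (hb.sq x) (ha.positive x) (hb.positive x)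

omit [IsManifold 𝓘(ℝ, E) ∞ M] in
theorem finiteDimensional_tangentSpace (x : M) : FiniteDimensional ℝ (TangentSpace 𝓘(ℝ, E) x) :=
  inferInstanceAs (FiniteDimensional ℝ E)

theorem IsCompatible.midMap_surjective (ha : IsCompatible Ω ja) (hb : IsCompatible Ω jb) (x : M) :
    Function.Surjective (midMap (ja x) (jb x)) := by
  have := finiteDimensional_tangentSpace (E := E) x
  exact @LinearMap.surjective_of_injective ℝ (TangentSpace 𝓘(ℝ, E) x) _ _ _ this
    (midMap (ja x) (jb x)) (ha.midMap_injective hb x)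

/-- `psi_apply_midMap` on the tangent spaces: `Ψ_{j_a,j_b}` is inverse to the pull-back by
`½ (1 - j_b j_a)`, which for two compatible positive structures is bijective. -/
theorem psi_midMap (hn : Module.finrank ℝ E = 2 * n) (ha : IsCompatible Ω ja)
    (hb : IsCompatible Ω jb) (x : M) (α : formsN0 n (ja x)) (v : Fin n → TangentSpace 𝓘(ℝ, E) x) :
    (psi n (ja x) (jb x) α : CForm (TangentSpace 𝓘(ℝ, E) x) n)
      (fun i => midMap (ja x) (jb x) (v i)) = (α : CForm (TangentSpace 𝓘(ℝ, E) x) n) v := by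
  have := finiteDimensional_tangentSpace (E := E) x
  exact @psi_apply_midMap (TangentSpace 𝓘(ℝ, E) x) _ _ _ n this hn (ja x) (jb x) (ha.sq x)
    (hb.sq x) (ha.midMap_injective hb x) α v

theorem phi_midMap (hn : Module.finrank ℝ E = 2 * n) (hr : IsCompatible Ω jref)
    (hj : IsCompatible Ω j) (B : HalfFormBundle E δ n jref) (x : M) (z : δ x ⊗[ℂ] δ x)
    (v : Fin n → TangentSpace 𝓘(ℝ, E) x) :
    (B.phi j x z : CForm (TangentSpace 𝓘(ℝ, E) x) n) (fun i => midMap (jref x) (j x) (v i)) =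
      (B.iso x z : CForm (TangentSpace 𝓘(ℝ, E) x) n) v :=
  psi_midMap hn hr hj x (B.iso x z) v

/-- `φ_j : δ² → Λ^{n,0}_j` is onto; in terms of a frame `b` of `δ`, every `(n,0)`-form is a multiple
of `φ_j(b²)`. -/
theorem exists_eq_smul_phi [VectorBundle ℂ ℂ δ] (hn : Module.finrank ℝ E = 2 * n)
    (hr : IsCompatible Ω jref)
    (hj : IsCompatible Ω j) (B : HalfFormBundle E δ n jref) {x₀ x : M} (hx : x ∈ frameDom δ x₀)
    {γ : CForm (TangentSpace 𝓘(ℝ, E) x) n} (hγ : γ ∈ formsN0 n (j x)) :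
    ∃ c : ℂ, γ = c • (B.phi j x (frameAt δ x₀ x ⊗ₜ frameAt δ x₀ x) :
      CForm (TangentSpace 𝓘(ℝ, E) x) n) := by
  have hm : γ.compLinearMap (midMap (jref x) (j x)) ∈ formsN0 n (jref x) :=
    comp_mem_formsN0 (midMap_comm (hr.sq x) (hj.sq x)) hγ
  obtain ⟨c, hc⟩ := exists_eq_smul_frame hx ((B.iso x).symm ⟨_, hm⟩)
  refine ⟨c, ?_⟩
  ext v
  choose u hu using fun i => hr.midMap_surjective hj x (v i)
  obtain rfl : (fun i => midMap (jref x) (j x) (u i)) = v := funext hu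
  rw [AlternatingMap.smul_apply, phi_midMap hn hr hj]
  have h1 : B.iso x (c • (frameAt δ x₀ x ⊗ₜ frameAt δ x₀ x)) = ⟨_, hm⟩ := by
    rw [← hc, LinearEquiv.apply_symm_apply]
  have h2 := congrArg (fun a : formsN0 n (jref x) => (a : CForm (TangentSpace 𝓘(ℝ, E) x) n) u) h1
  simp only [map_smul] at h2
  exact h2.symm

theorem phi_frame_ne_zero [VectorBundle ℂ ℂ δ] (hn : Module.finrank ℝ E = 2 * n)
    (hr : IsCompatible Ω jref)
    (hj : IsCompatible Ω j) (B : HalfFormBundle E δ n jref) {x₀ x : M} (hx : x ∈ frameDom δ x₀) :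
    ∃ v, (B.phi j x (frameAt δ x₀ x ⊗ₜ frameAt δ x₀ x) :
      CForm (TangentSpace 𝓘(ℝ, E) x) n) v ≠ 0 := by
  by_contra! h
  refine frame_tmul_ne_zero hx ((B.iso x).map_eq_zero_iff.mp (Subtype.ext ?_))
  ext v
  rw [← phi_midMap hn hr hj, h]
  rfl

omit [FiniteDimensional ℝ E] in
theorem phi_tmul [VectorBundle ℂ ℂ δ] (B : HalfFormBundle E δ n jref) {x₀ x : M}
    (hx : x ∈ frameDom δ x₀) (u v : δ x) :
    (B.phi j x (u ⊗ₜ v) : CForm (TangentSpace 𝓘(ℝ, E) x) n) =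
      (coordAt δ x₀ x u * coordAt δ x₀ x v) • (B.phi j x (frameAt δ x₀ x ⊗ₜ frameAt δ x₀ x) :
        CForm (TangentSpace 𝓘(ℝ, E) x) n) := by
  rw [tmul_eq_smul_frame hx u v, map_smul]
  rfl

variable [VectorBundle ℂ ℂ δ] [VectorBundle ℝ ℂ δ] [ContMDiffVectorBundle ∞ ℂ δ 𝓘(ℝ, E)]
  {E' : Type*} [NormedAddCommGroup E'] [NormedSpace ℝ E'] {H : Type*} [TopologicalSpace H]
  {I : ModelWithCorners ℝ E' H} {N : Type*} [TopologicalSpace N] [ChartedSpace H N]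

theorem contMDiffAt_iso (B : HalfFormBundle E δ n jref) {y : N → M} {p₀ : N}
    (hy : ContMDiffAt I 𝓘(ℝ, E) ∞ y p₀) {w : Fin n → N → E}
    (hw : ∀ i, ContMDiffAt I 𝓘(ℝ, E) ∞ (w i) p₀) :
    ContMDiffAt I 𝓘(ℝ, ℂ) ∞ (fun p => (B.iso (y p) (frameAt δ (y p₀) (y p) ⊗ₜ
      frameAt δ (y p₀) (y p)) : CForm (TangentSpace 𝓘(ℝ, E) (y p)) n)
        (fun i => ts (y p₀) (y p) (w i p))) p₀ := by
  refine contMDiffAt_multilinear_apply (F := fun p =>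
    ((B.iso (y p) (frameAt δ (y p₀) (y p) ⊗ₜ frameAt δ (y p₀) (y p)) :
      CForm (TangentSpace 𝓘(ℝ, E) (y p)) n).compLinearMap
        (ts (E := E) (y p₀) (y p)).toLinearMap).toMultilinearMap) (fun w => ?_) hw
  exact ContMDiffAt.comp p₀ (g := fun x => (B.iso x (frameAt δ (y p₀) x ⊗ₜ
      frameAt δ (y p₀) x) : CForm (TangentSpace 𝓘(ℝ, E) x) n) (fun i => ts (y p₀) x (w i)))
    (B.smooth (y p₀) _ _ (fun i x => ts (y p₀) x (w i)) (smoothSectionAt_frameAt _)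
      (smoothSectionAt_frameAt _) fun i => smoothFieldAt_ts _ _) hy

/-- The map `½ (1 - j_b j_a)` in the chart at `x₀`. -/
def midCoord (ja jb : Π x : M, TangentSpace 𝓘(ℝ, E) x →L[ℝ] TangentSpace 𝓘(ℝ, E) x) (x₀ y : M) :
    E →L[ℝ] E :=
  (1 / 2 : ℝ) • (ContinuousLinearMap.id ℝ E - endoCoord jb x₀ y ∘L endoCoord ja x₀ y)

omit [FiniteDimensional ℝ E] in
theorem ts_midCoord {x₀ y : M} (hy : y ∈ (chartAt E x₀).source) (w : E) :
    ts (E := E) x₀ y (midCoord ja jb x₀ y w) = midMap (ja y) (jb y) (ts x₀ y w) := by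
  have h1 : ts (E := E) x₀ y (endoCoord jb x₀ y (endoCoord ja x₀ y w)) =
      jb y (ja y (ts x₀ y w)) := by
    refine (ts_tc hy _).trans ?_
    exact congrArg (jb y) (ts_tc hy _)
  change ts (E := E) x₀ y ((1 / 2 : ℝ) • (w - endoCoord jb x₀ y (endoCoord ja x₀ y w))) = _
  rw [map_smul, map_sub, h1, midMap_apply]

omit [FiniteDimensional ℝ E] in
theorem contMDiffAt_midCoord {y : N → M} {p₀ : N} {x₀ : M}
    {Ja Jb : N → Π x : M, TangentSpace 𝓘(ℝ, E) x →L[ℝ] TangentSpace 𝓘(ℝ, E) x}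
    (hJa : ContMDiffAt I 𝓘(ℝ, E →L[ℝ] E) ∞ (fun p => endoCoord (Ja p) x₀ (y p)) p₀)
    (hJb : ContMDiffAt I 𝓘(ℝ, E →L[ℝ] E) ∞ (fun p => endoCoord (Jb p) x₀ (y p)) p₀) :
    ContMDiffAt I 𝓘(ℝ, E →L[ℝ] E) ∞ (fun p => midCoord (Ja p) (Jb p) x₀ (y p)) p₀ := by
  have h1 : ContMDiffAt I 𝓘(ℝ, E →L[ℝ] E) ∞ (fun p => ContinuousLinearMap.id ℝ E -
      endoCoord (Jb p) x₀ (y p) ∘L endoCoord (Ja p) x₀ (y p)) p₀ :=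
    ContMDiffAt.sub contMDiffAt_const (hJb.clm_comp hJa)
  exact (contDiff_const_smul (𝕜 := ℝ) (F := E →L[ℝ] E) (1 / 2 : ℝ)).contDiffAt.comp_contMDiffAt h1

/-- The form `φ_j(b²)`, evaluated on smooth vector fields, is smooth in the point and in the
parameters on which `j` depends. By `phi_midMap` it is the reference form evaluated on the images of
the vector fields under the inverse of `½ (1 - j j_ref)`, and inversion of linear maps is smooth. -/
theorem contMDiffAt_phi (hn : Module.finrank ℝ E = 2 * n) (hr : IsCompatible Ω jref)
    (B : HalfFormBundle E δ n jref) {y : N → M} {p₀ : N}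
    {J : N → Π x : M, TangentSpace 𝓘(ℝ, E) x →L[ℝ] TangentSpace 𝓘(ℝ, E) x}
    (hJ : ∀ p, IsCompatible Ω (J p))
    (hJs : ContMDiffAt I 𝓘(ℝ, E →L[ℝ] E) ∞ (fun p => endoCoord (J p) (y p₀) (y p)) p₀)
    (hy : ContMDiffAt I 𝓘(ℝ, E) ∞ y p₀) {w : Fin n → N → E}
    (hw : ∀ i, ContMDiffAt I 𝓘(ℝ, E) ∞ (w i) p₀) :
    ContMDiffAt I 𝓘(ℝ, ℂ) ∞ (fun p => (B.phi (J p) (y p) (frameAt δ (y p₀) (y p) ⊗ₜ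
      frameAt δ (y p₀) (y p)) : CForm (TangentSpace 𝓘(ℝ, E) (y p)) n)
        (fun i => ts (y p₀) (y p) (w i p))) p₀ := by
  have : CompleteSpace E := FiniteDimensional.complete ℝ E
  have hrs : ContMDiffAt I 𝓘(ℝ, E →L[ℝ] E) ∞ (fun p => endoCoord jref (y p₀) (y p)) p₀ :=
    ContMDiffAt.comp p₀ (g := endoCoord jref (y p₀)) (contMDiffAt_endoCoord (hr.smooth _)) hy
  have hA := contMDiffAt_midCoord (Ja := fun _ => jref) hrs hJs
  have hinj : Function.Injective (midCoord jref (J p₀) (y p₀) (y p₀)) := fun v w hvw => by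
    have h := congrArg (ts (E := E) (y p₀) (y p₀)) hvw
    rw [ts_midCoord (mem_chart_source E _), ts_midCoord (mem_chart_source E _)] at h
    have h2 := hr.midMap_injective (hJ p₀) (y p₀) h
    exact (ts_self (y p₀) v).symm.trans (Eq.trans h2 (ts_self (y p₀) w))
  obtain ⟨e, he⟩ := exists_equiv_of_injective _ hinj
  have hinv : ContMDiffAt I 𝓘(ℝ, E →L[ℝ] E) ∞
      (fun p => (midCoord jref (J p) (y p₀) (y p)).inverse) p₀ := by
    refine ContMDiffAt.comp p₀ (g := ContinuousLinearMap.inverse)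
      (f := fun p => midCoord jref (J p) (y p₀) (y p)) ?_ hA
    rw [← he]
    exact (contDiffAt_map_inverse e).contMDiffAt
  have hnhds : ∀ᶠ p in 𝓝 p₀, midCoord jref (J p) (y p₀) (y p) ∈
      Set.range ((↑) : (E ≃L[ℝ] E) → E →L[ℝ] E) := by
    have h := hA.continuousAt
    refine h.eventually (p := fun A : E →L[ℝ] E => A ∈ Set.range
      ((↑) : (E ≃L[ℝ] E) → E →L[ℝ] E)) ?_
    change ∀ᶠ A in 𝓝 (midCoord jref (J p₀) (y p₀) (y p₀)), A ∈ _
    rw [← he]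
    exact e.nhds
  refine (contMDiffAt_iso B hy fun i => hinv.clm_apply (hw i)).congr_of_eventuallyEq ?_
  filter_upwards [hnhds, Filter.Tendsto.eventually hy.continuousAt
    (source_mem_nhds (E := E) (y p₀))] with p hp hp2
  obtain ⟨e', he'⟩ := hp
  have h1 : (fun i => ts (E := E) (y p₀) (y p) (w i p)) = fun i =>
      midMap (jref (y p)) (J p (y p)) (ts (E := E) (y p₀) (y p)
        ((midCoord jref (J p) (y p₀) (y p)).inverse (w i p))) := by
    funext i
    rw [← ts_midCoord hp2, ← he', ContinuousLinearMap.inverse_equiv]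
    congr 1
    exact (e'.apply_symm_apply _).symm
  rw [h1, phi_midMap hn hr (hJ p)]

end Phi

/-! ### Continuous families of half-form bundle morphisms -/

/-- Given, on a cover of `ℝ × M` by coordinate patches `V i ∋ i`, the coordinates `θ i` of a family
of square roots, with transition functions `g i j`, the signs of the square roots can be changed,
without affecting the time `t₀`, so as to make them continuous. -/
theorem exists_sign_continuousAt {M : Type*} [TopologicalSpace M] {V : ℝ × M → Set (ℝ × M)}
    {θ q : ℝ × M → ℝ × M → ℂ} {g : ℝ × M → ℝ × M → ℝ × M → ℂ} (hV : ∀ i, IsOpen (V i))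
    (hmem : ∀ i, i ∈ V i) (hq : ∀ i, ContinuousOn (q i) (V i)) (hq0 : ∀ i, q i i ≠ 0)
    (hsq : ∀ i, ∀ p ∈ V i, θ i p ^ 2 = q i p) (hg : ∀ i j, ContinuousOn (g i j) (V i ∩ V j))
    (hθ : ∀ i j, ∀ p ∈ V i ∩ V j, θ i p = g i j p * θ j p) (t₀ : ℝ)
    (h0 : ∀ i, ContinuousOn (fun x => θ i (t₀, x)) {x | (t₀, x) ∈ V i}) :
    ∃ η : ℝ × M → ℂ, (∀ p, η p ^ 2 = 1) ∧ (∀ x, η (t₀, x) = 1) ∧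
      ∀ i, ContinuousAt (fun p => η p * θ i p) i := by
  classical
  choose U hUV hUo hUm σ hσ hσq using fun i => exists_local_sqrt (hV i) (hmem i) (hq i) (hq0 i)
  have hne : ∀ i, ∀ p ∈ U i, θ i p ≠ 0 := fun i p hp h => by
    have h1 := hsq i p (hUV i hp)
    rw [h] at h1
    exact (hσq i p hp).1 (by rw [← h1]; norm_num)
  have hσθ : ∀ i, ∀ p ∈ U i, σ i p ^ 2 = θ i p ^ 2 := fun i p hp => by
    rw [(hσq i p hp).2, hsq i p (hUV i hp)]
  -- the sign by which the given root differs from a continuous local root `σ i`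
  let ε : ℝ × M → ℝ × M → ℂ := fun i p => if p ∈ U i then σ i p / θ i p else 1
  have hεU : ∀ i, ∀ p ∈ U i, ε i p = σ i p / θ i p := fun i p hp => if_pos hp
  have hε : ∀ i p, ε i p ^ 2 = 1 := fun i p => by
    by_cases hp : p ∈ U i
    · rw [hεU i p hp, div_pow, hσθ i p hp, div_self (pow_ne_zero 2 (hne i p hp))]
    · simp [ε, hp]
  obtain ⟨η, h1, h2, h3⟩ := exists_sign_extension (U := U) hUo (fun p => ⟨p, hUm p⟩) hε
    (fun i j => by
      have hc : ContinuousOn (fun p => σ i p * σ j p / (g i j p * q j p)) (U i ∩ U j) := by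
        refine ContinuousOn.div (((hσ i).mono Set.inter_subset_left).mul
          ((hσ j).mono Set.inter_subset_right))
          (((hg i j).mono (Set.inter_subset_inter (hUV i) (hUV j))).mul
            ((hq j).mono (Set.inter_subset_right.trans (hUV j)))) fun p hp => ?_
        refine mul_ne_zero (fun h => hne i p hp.1 ?_) (hσq j p hp.2).1
        rw [hθ i j p ⟨hUV i hp.1, hUV j hp.2⟩, h, zero_mul]
      refine hc.congr fun p hp => ?_
      change ε i p * ε j p = σ i p * σ j p / (g i j p * q j p)
      rw [hεU i p hp.1, hεU j p hp.2, div_mul_div_comm, ← hsq j p (hUV j hp.2),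
        hθ i j p ⟨hUV i hp.1, hUV j hp.2⟩, sq, mul_assoc (g i j p)]) t₀ (a := fun _ => 1) (by simp)
    (fun i => by
      have hc : ContinuousOn (fun x => σ i (t₀, x) / θ i (t₀, x)) {x | (t₀, x) ∈ U i} :=
        (ContinuousOn.comp (g := σ i) (f := fun x => (t₀, x)) (hσ i) (by fun_prop)
          fun x hx => hx).div ((h0 i).mono fun x hx => hUV i hx)
          fun x hx => hne i _ hx
      refine hc.congr fun x hx => ?_
      rw [hεU i _ hx, one_mul])
  refine ⟨η, h1, h2, fun i => ?_⟩
  have hc : ContinuousOn (fun p => η p * θ i p) (U i) := by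
    refine ((h3 i).mul (hσ i)).congr fun p hp => ?_
    change _ = η p * ε i p * σ i p
    rw [hεU i p hp, mul_assoc, div_mul_eq_mul_div, ← sq, hσθ i p hp, sq,
      mul_div_cancel_right₀ _ (hne i p hp)]
  exact hc.continuousAt ((hUo i).mem_nhds (hUm i))

/-- Quotients of smooth functions are smooth. -/
theorem contMDiffAt_of_eq_mul {E' : Type*} [NormedAddCommGroup E'] [NormedSpace ℝ E'] {H : Type*}
    [TopologicalSpace H] {I : ModelWithCorners ℝ E' H} {N : Type*} [TopologicalSpace N]
    [ChartedSpace H N] {a b c : N → ℂ} {p₀ : N} (ha : ContMDiffAt I 𝓘(ℝ, ℂ) ∞ a p₀)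
    (hb : ContMDiffAt I 𝓘(ℝ, ℂ) ∞ b p₀) (hb0 : b p₀ ≠ 0) (h : ∀ᶠ p in 𝓝 p₀, a p = c p * b p) :
    ContMDiffAt I 𝓘(ℝ, ℂ) ∞ c p₀ := by
  have hd : ContDiffAt ℝ ∞ (fun z : ℂ × ℂ => z.1 * z.2⁻¹) (a p₀, b p₀) :=
    contDiffAt_fst.mul (contDiffAt_snd.inv hb0)
  refine (ContDiffAt.comp_contMDiffAt (f := fun p => (a p, b p)) (x := p₀) hd
    (ha.prodMk_space hb)).congr_of_eventuallyEq ?_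
  filter_upwards [h, hb.continuousAt.eventually_ne hb0] with p hp hp0
  change c p = a p * (b p)⁻¹
  rw [hp, mul_assoc, mul_inv_cancel₀ hp0, mul_one]

section Morphisms

variable {E : Type*} [NormedAddCommGroup E] [NormedSpace ℝ E] [FiniteDimensional ℝ E]
  {M : Type*} [TopologicalSpace M] [ChartedSpace E M] [IsManifold 𝓘(ℝ, E) ∞ M]
  {δ : M → Type*} [TopologicalSpace (TotalSpace ℂ δ)] [∀ x, TopologicalSpace (δ x)]
  [∀ x, AddCommGroup (δ x)] [∀ x, Module ℂ (δ x)] [FiberBundle ℂ δ]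
  [VectorBundle ℂ ℂ δ] [VectorBundle ℝ ℂ δ] [ContMDiffVectorBundle ∞ ℂ δ 𝓘(ℝ, E)]
  {n : ℕ} {Ω : Π x : M, TangentSpace 𝓘(ℝ, E) x →ₗ[ℝ] TangentSpace 𝓘(ℝ, E) x →ₗ[ℝ] ℝ}
  {jref : Π x : M, TangentSpace 𝓘(ℝ, E) x →L[ℝ] TangentSpace 𝓘(ℝ, E) x}
  {jc : ℝ → Π x : M, TangentSpace 𝓘(ℝ, E) x →L[ℝ] TangentSpace 𝓘(ℝ, E) x}

omit [VectorBundle ℝ ℂ δ] [ContMDiffVectorBundle ∞ ℂ δ 𝓘(ℝ, E)] in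
/-- `Ψ_{j_t,j_u} ∘ φ_{j_t}` and `φ_{j_u}` are isomorphisms onto the same line, hence
proportional. -/
theorem exists_morphism_factor (hn : Module.finrank ℝ E = 2 * n) (hr : IsCompatible Ω jref)
    (hJ : ∀ t, IsCompatible Ω (jc t)) (B : HalfFormBundle E δ n jref) (t u : ℝ) (x : M) :
    ∃ c : ℂ, ∀ z : δ x ⊗[ℂ] δ x, psi n (jc t x) (jc u x) (B.phi (jc t) x z) =
      c • B.phi (jc u) x z := by
  obtain ⟨c, hc⟩ := exists_eq_smul_phi hn hr (hJ u) B (mem_frameDom δ x)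
    (psi n (jc t x) (jc u x) (B.phi (jc t) x (frameAt δ x x ⊗ₜ frameAt δ x x))).2
  refine ⟨c, fun z => ?_⟩
  obtain ⟨a, rfl⟩ := exists_eq_smul_frame (mem_frameDom δ x) z
  have h : psi n (jc t x) (jc u x) (B.phi (jc t) x (frameAt δ x x ⊗ₜ frameAt δ x x)) =
      c • B.phi (jc u) x (frameAt δ x x ⊗ₜ frameAt δ x x) := Subtype.ext hc
  rw [map_smul, map_smul, h, map_smul, smul_comm]

/-- The scalar function `c` with `Ψ_{j_t, j_u} ∘ φ_{j_t} = c φ_{j_u}` is smooth in `(u, x)` and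
nowhere zero. -/
theorem contMDiffAt_morphism_factor (hn : Module.finrank ℝ E = 2 * n) (hr : IsCompatible Ω jref)
    (hJ : ∀ t, IsCompatible Ω (jc t))
    (hJs : ∀ (u₀ : ℝ) (x₀ : M), ContMDiffAt (𝓘(ℝ, ℝ).prod 𝓘(ℝ, E)) 𝓘(ℝ, E →L[ℝ] E) ∞
      (fun p : ℝ × M => endoCoord (jc p.1) x₀ p.2) (u₀, x₀))
    (B : HalfFormBundle E δ n jref) (t : ℝ) {c : ℝ × M → ℂ}
    (hc : ∀ (u : ℝ) (x : M) (z : δ x ⊗[ℂ] δ x),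
      psi n (jc t x) (jc u x) (B.phi (jc t) x z) = c (u, x) • B.phi (jc u) x z) (p₀ : ℝ × M) :
    ContMDiffAt (𝓘(ℝ, ℝ).prod 𝓘(ℝ, E)) 𝓘(ℝ, ℂ) ∞ c p₀ ∧ c p₀ ≠ 0 := by
  obtain ⟨u₀, x₀⟩ := p₀
  obtain ⟨v, hv⟩ := phi_frame_ne_zero hn hr (hJ t) B (mem_frameDom δ x₀)
  have ht : ContMDiffAt (𝓘(ℝ, ℝ).prod 𝓘(ℝ, E)) 𝓘(ℝ, E →L[ℝ] E) ∞
      (fun p : ℝ × M => endoCoord (jc t) x₀ p.2) (u₀, x₀) :=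
    ContMDiffAt.comp (u₀, x₀) (g := fun p : ℝ × M => endoCoord (jc p.1) x₀ p.2)
      (f := fun p : ℝ × M => (t, p.2)) (hJs t x₀) (contMDiffAt_const.prodMk contMDiffAt_snd)
  let a : ℝ × M → ℂ := fun p => (B.phi (jc t) p.2 (frameAt δ x₀ p.2 ⊗ₜ frameAt δ x₀ p.2) :
    CForm (TangentSpace 𝓘(ℝ, E) p.2) n) (fun i => ts x₀ p.2 (v i))
  -- `c` is the quotient of the smooth functions `a` and `b`, by `psi_midMap`
  let b : ℝ × M → ℂ := fun p => (B.phi (jc p.1) p.2 (frameAt δ x₀ p.2 ⊗ₜ frameAt δ x₀ p.2) :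
    CForm (TangentSpace 𝓘(ℝ, E) p.2) n) (fun i => ts x₀ p.2 (midCoord (jc t) (jc p.1) x₀ p.2 (v i)))
  have ha : ContMDiffAt (𝓘(ℝ, ℝ).prod 𝓘(ℝ, E)) 𝓘(ℝ, ℂ) ∞ a (u₀, x₀) :=
    contMDiffAt_phi hn hr B (y := Prod.snd) (p₀ := (u₀, x₀)) (J := fun _ => jc t) (fun _ => hJ t)
      ht contMDiffAt_snd (w := fun i _ => v i) (fun i => contMDiffAt_const)
  have hb : ContMDiffAt (𝓘(ℝ, ℝ).prod 𝓘(ℝ, E)) 𝓘(ℝ, ℂ) ∞ b (u₀, x₀) :=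
    contMDiffAt_phi hn hr B (y := Prod.snd) (p₀ := (u₀, x₀)) (J := fun p => jc p.1)
      (fun p => hJ p.1) (hJs u₀ x₀) contMDiffAt_snd
      (w := fun i p => midCoord (jc t) (jc p.1) x₀ p.2 (v i))
      (fun i => (contMDiffAt_midCoord (Ja := fun _ => jc t) (Jb := fun p => jc p.1)
        (y := Prod.snd) ht (hJs u₀ x₀)).clm_apply contMDiffAt_const)
  have hab : ∀ p : ℝ × M, p.2 ∈ (chartAt E x₀).source → a p = c p * b p := by
    rintro ⟨u, x⟩ hx
    have h1 := psi_midMap hn (hJ t) (hJ u) x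
      (B.phi (jc t) x (frameAt δ x₀ x ⊗ₜ frameAt δ x₀ x)) (fun i => ts x₀ x (v i))
    rw [hc] at h1
    have e : (fun i => midMap (jc t x) (jc u x) (ts (E := E) x₀ x (v i))) = fun i =>
        ts x₀ x (midCoord (jc t) (jc u) x₀ x (v i)) := funext fun i => (ts_midCoord hx _).symm
    rw [e] at h1
    exact h1.symm
  have ha0 : a (u₀, x₀) ≠ 0 := by
    have e : (fun i => ts (E := E) x₀ x₀ (v i)) = v := funext fun i => ts_self (E := E) x₀ (v i)
    change (B.phi (jc t) x₀ (frameAt δ x₀ x₀ ⊗ₜ frameAt δ x₀ x₀) :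
      CForm (TangentSpace 𝓘(ℝ, E) x₀) n) (fun i => ts x₀ x₀ (v i)) ≠ 0
    rw [e]
    exact hv
  have h0 := hab (u₀, x₀) (mem_chart_source E x₀)
  have hcb : c (u₀, x₀) ≠ 0 ∧ b (u₀, x₀) ≠ 0 := mul_ne_zero_iff.mp (h0 ▸ ha0)
  refine ⟨contMDiffAt_of_eq_mul ha hb hcb.2 ?_, hcb.1⟩
  filter_upwards [continuous_snd.continuousAt.eventually (source_mem_nhds (E := E) x₀)] with p hp
    using hab p hp

theorem psi_self (hn : Module.finrank ℝ E = 2 * n) {j : Π x : M, TangentSpace 𝓘(ℝ, E) x →L[ℝ]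
    TangentSpace 𝓘(ℝ, E) x} (hj : IsCompatible Ω j) (x : M) (α : formsN0 n (j x)) :
    psi n (j x) (j x) α = α := by
  refine Subtype.ext ?_
  ext v
  have h := psi_midMap hn hj hj x α v
  have e : (fun i => midMap (j x) (j x) (v i)) = v := by
    funext i
    rw [midMap_apply, hj.sq, sub_neg_eq_add, ← two_smul ℝ (v i), smul_smul]
    norm_num
  rwa [e] at h

/-- The continuous family `Ψ_u : δ_{j_t} → δ_{j_u}` of half-form bundle morphisms with
`Ψ_t = Id`, as multiplication by a smooth function `ψ`. -/
theorem exists_morphism_family (hn : Module.finrank ℝ E = 2 * n) (hr : IsCompatible Ω jref)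
    (hJ : ∀ t, IsCompatible Ω (jc t))
    (hJs : ∀ (u₀ : ℝ) (x₀ : M), ContMDiffAt (𝓘(ℝ, ℝ).prod 𝓘(ℝ, E)) 𝓘(ℝ, E →L[ℝ] E) ∞
      (fun p : ℝ × M => endoCoord (jc p.1) x₀ p.2) (u₀, x₀))
    (B : HalfFormBundle E δ n jref) (t : ℝ) :
    ∃ ψ : ℝ × M → ℂ, ContMDiff (𝓘(ℝ, ℝ).prod 𝓘(ℝ, E)) 𝓘(ℝ, ℂ) ∞ ψ ∧ (∀ p, ψ p ≠ 0) ∧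
      (∀ x, ψ (t, x) = 1) ∧ ∀ (u : ℝ) (x : M) (z : δ x ⊗[ℂ] δ x),
        psi n (jc t x) (jc u x) (B.phi (jc t) x z) = (ψ (u, x) ^ 2) • B.phi (jc u) x z := by
  choose c' hc' using fun (u : ℝ) (x : M) => exists_morphism_factor hn hr hJ B t u x
  let c : ℝ × M → ℂ := fun p => c' p.1 p.2
  have hc : ∀ (u : ℝ) (x : M) (z : δ x ⊗[ℂ] δ x),
      psi n (jc t x) (jc u x) (B.phi (jc t) x z) = c (u, x) • B.phi (jc u) x z := hc'
  have hcs := contMDiffAt_morphism_factor hn hr hJ hJs B t hc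
  have hct : ∀ x, c (t, x) = 1 := fun x => by
    obtain ⟨v, hv⟩ := phi_frame_ne_zero hn hr (hJ t) B (mem_frameDom δ x)
    have h1 := hc t x (frameAt δ x x ⊗ₜ frameAt δ x x)
    rw [psi_self hn (hJ t)] at h1
    have h2 := congrArg (fun α : formsN0 n (jc t x) => (α : CForm (TangentSpace 𝓘(ℝ, E) x) n) v) h1
    have h3 : (B.phi (jc t) x (frameAt δ x x ⊗ₜ frameAt δ x x) :
      CForm (TangentSpace 𝓘(ℝ, E) x) n) v = c (t, x) * (B.phi (jc t) x (frameAt δ x x ⊗ₜ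
        frameAt δ x x) : CForm (TangentSpace 𝓘(ℝ, E) x) n) v := h2
    exact (mul_eq_right₀ hv).mp h3.symm
  classical
  -- a discontinuous square root of `c`, equal to `1` at time `t`
  let r : ℝ × M → ℂ := fun p => if p.1 = t then 1 else c p ^ (2⁻¹ : ℂ)
  have hr2 : ∀ p, r p ^ 2 = c p := by
    rintro ⟨u, x⟩
    by_cases hu : u = t
    · subst hu
      simp [r, hct]
    · simp only [r, hu, if_false]
      exact Complex.cpow_ofNat_inv_pow _ 2
  obtain ⟨η, h1, h2, h3⟩ := exists_sign_continuousAt (V := fun _ => Set.univ) (θ := fun _ => r)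
    (q := fun _ => c) (g := fun _ _ _ => 1) (fun _ => isOpen_univ) (fun _ => Set.mem_univ _)
    (fun _ p _ => (hcs p).1.continuousAt.continuousWithinAt) (fun p => (hcs p).2)
    (fun _ p _ => hr2 p) (fun _ _ => continuousOn_const) (fun _ _ _ _ => (one_mul _).symm) t
    (fun _ => by
      have e : (fun x => r (t, x)) = fun _ => 1 := by funext x; simp [r]
      rw [e]
      exact continuousOn_const)
  have hsq : ∀ p, (η p * r p) ^ 2 = c p := fun p => by rw [mul_pow, h1, hr2, one_mul]
  refine ⟨fun p => η p * r p, fun p => ?_, fun p h => ?_, fun x => ?_, fun u x z => ?_⟩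
  · exact contMDiffAt_of_sq (h3 p) (hcs p).1 (hcs p).2 (Filter.Eventually.of_forall hsq)
  · refine (hcs p).2 ?_
    have h' : η p * r p = 0 := h
    rw [← hsq p, h']
    norm_num
  · simp [h2, r]
  · rw [hsq]
    exact hc u x z

end Morphisms

/-! ### The lift of the flow to the half-form bundles -/

/-- The identification of the fibres over two equal points. -/
def fibreCast {M : Type*} {δ : M → Type*} [∀ x, AddCommGroup (δ x)] [∀ x, Module ℂ (δ x)]
    {y x : M} (h : y = x) : δ y →ₗ[ℂ] δ x :=
  h ▸ LinearMap.id

section Lift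

variable {E : Type*} [NormedAddCommGroup E] [NormedSpace ℝ E] [FiniteDimensional ℝ E]
  {M : Type*} [TopologicalSpace M] [ChartedSpace E M] [IsManifold 𝓘(ℝ, E) ∞ M] [T2Space M]
  {δ : M → Type*} [TopologicalSpace (TotalSpace ℂ δ)] [∀ x, TopologicalSpace (δ x)]
  [∀ x, AddCommGroup (δ x)] [∀ x, Module ℂ (δ x)] [FiberBundle ℂ δ]
  [VectorBundle ℂ ℂ δ] [VectorBundle ℝ ℂ δ] [ContMDiffVectorBundle ∞ ℂ δ 𝓘(ℝ, E)]
  {n : ℕ} {Ω : Π x : M, TangentSpace 𝓘(ℝ, E) x →ₗ[ℝ] TangentSpace 𝓘(ℝ, E) x →ₗ[ℝ] ℝ}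
  {jref j : Π x : M, TangentSpace 𝓘(ℝ, E) x →L[ℝ] TangentSpace 𝓘(ℝ, E) x}
  {X : Π x : M, TangentSpace 𝓘(ℝ, E) x} {φ : ℝ → M → M}

/-- The coordinate of a family `Θ t x : δ_{φ_t(x)} → δ_x` in the frames centred at `i.2` and
`φ i.1 i.2`. -/
def liftCoord (Θ : Π (t : ℝ) (x : M), δ (φ t x) →ₗ[ℂ] δ x) (i p : ℝ × M) : ℂ :=
  coordAt δ i.2 p.2 (Θ p.1 p.2 (frameAt δ (φ i.1 i.2) (φ p.1 p.2)))

variable (δ φ) in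
/-- The points where the frames of `liftCoord` are defined. -/
def liftDom (i : ℝ × M) : Set (ℝ × M) :=
  {p | p.2 ∈ frameDom δ i.2 ∧ φ p.1 p.2 ∈ frameDom δ (φ i.1 i.2)}

variable (δ) in
omit [FiniteDimensional ℝ E] [IsManifold 𝓘(ℝ, E) ∞ M] [T2Space M] [∀ x, AddCommGroup (δ x)]
  [∀ x, Module ℂ (δ x)] [VectorBundle ℂ ℂ δ] [VectorBundle ℝ ℂ δ]
  [ContMDiffVectorBundle ∞ ℂ δ 𝓘(ℝ, E)] in
theorem liftDom_mem_nhds (hφ : IsFlow X φ) (i : ℝ × M) : liftDom δ φ i ∈ 𝓝 i :=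
  Filter.inter_mem (continuous_snd.continuousAt.preimage_mem_nhds (frameDom_mem_nhds δ i.2))
    (hφ.continuous.continuousAt.preimage_mem_nhds (frameDom_mem_nhds δ (φ i.1 i.2)))

theorem pullbackForm_mem (hφ : IsFlow X φ) (t : ℝ) (x : M)
    {α : CForm (TangentSpace 𝓘(ℝ, E) (φ t x)) n} (hα : α ∈ formsN0 n (j (φ t x))) :
    pullbackForm (φ t) x α ∈ formsN0 n (pullbackACS (φ t) j x) :=
  comp_mem_formsN0 (mfderiv_pullbackACS hφ t x) hα

omit [VectorBundle ℝ ℂ δ] [ContMDiffVectorBundle ∞ ℂ δ 𝓘(ℝ, E)] in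
/-- The squares of the coordinates of a lift: the functions `q` with
`φ_t^* (φ_j(b'²)) = q φ_{φ_t^* j}(b²)`. -/
theorem exists_liftSq (hn : Module.finrank ℝ E = 2 * n) (hr : IsCompatible Ω jref)
    (hφ : IsFlow X φ) (hJ : ∀ t, IsCompatible Ω (pullbackACS (φ t) j))
    (B : HalfFormBundle E δ n jref) :
    ∃ q : ℝ × M → ℝ × M → ℂ, ∀ i, ∀ p ∈ liftDom δ φ i,
      pullbackForm (φ p.1) p.2 (B.phi j (φ p.1 p.2) (frameAt δ (φ i.1 i.2) (φ p.1 p.2) ⊗ₜ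
        frameAt δ (φ i.1 i.2) (φ p.1 p.2))) =
      q i p • (B.phi (pullbackACS (φ p.1) j) p.2 (frameAt δ i.2 p.2 ⊗ₜ frameAt δ i.2 p.2) :
        CForm (TangentSpace 𝓘(ℝ, E) p.2) n) := by
  classical
  have h : ∀ i p : ℝ × M, ∃ c : ℂ, p ∈ liftDom δ φ i →
      pullbackForm (φ p.1) p.2 (B.phi j (φ p.1 p.2) (frameAt δ (φ i.1 i.2) (φ p.1 p.2) ⊗ₜ
        frameAt δ (φ i.1 i.2) (φ p.1 p.2))) =
      c • (B.phi (pullbackACS (φ p.1) j) p.2 (frameAt δ i.2 p.2 ⊗ₜ frameAt δ i.2 p.2) :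
        CForm (TangentSpace 𝓘(ℝ, E) p.2) n) := fun i p => by
    by_cases hp : p ∈ liftDom δ φ i
    · obtain ⟨c, hc⟩ := exists_eq_smul_phi hn hr (hJ p.1) B hp.1
        (pullbackForm_mem (j := j) hφ p.1 p.2
          (B.phi j (φ p.1 p.2) (frameAt δ (φ i.1 i.2) (φ p.1 p.2) ⊗ₜ
            frameAt δ (φ i.1 i.2) (φ p.1 p.2))).2)
      exact ⟨c, fun _ => hc⟩
    · exact ⟨0, fun h => absurd h hp⟩
  choose q hq using h
  exact ⟨q, fun i p hp => hq i p hp⟩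

/-- The squares `q i` of the coordinates of a lift are smooth and nonzero at the centre `i`. -/
theorem contMDiffAt_liftSq (hn : Module.finrank ℝ E = 2 * n) (hr : IsCompatible Ω jref)
    (hφ : IsFlow X φ) (hj : IsCompatible Ω j) (hJ : ∀ t, IsCompatible Ω (pullbackACS (φ t) j))
    (B : HalfFormBundle E δ n jref) {q : ℝ × M → ℝ × M → ℂ} (hq : ∀ i, ∀ p ∈ liftDom δ φ i,
      pullbackForm (φ p.1) p.2 (B.phi j (φ p.1 p.2) (frameAt δ (φ i.1 i.2) (φ p.1 p.2) ⊗ₜ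
        frameAt δ (φ i.1 i.2) (φ p.1 p.2))) =
      q i p • (B.phi (pullbackACS (φ p.1) j) p.2 (frameAt δ i.2 p.2 ⊗ₜ frameAt δ i.2 p.2) :
        CForm (TangentSpace 𝓘(ℝ, E) p.2) n)) (i : ℝ × M) :
    ContMDiffAt (𝓘(ℝ, ℝ).prod 𝓘(ℝ, E)) 𝓘(ℝ, ℂ) ∞ (q i) i ∧ q i i ≠ 0 := by
  obtain ⟨t₀, x₀⟩ := i
  obtain ⟨v', hv'⟩ := phi_frame_ne_zero hn hr hj B (mem_frameDom δ (φ t₀ x₀))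
  obtain ⟨e, he⟩ := exists_equiv_of_injective (E := E) (mfderiv 𝓘(ℝ, E) 𝓘(ℝ, E) (φ t₀) x₀)
    (hφ.mfderiv_injective t₀ x₀)
  let v : Fin n → E := fun i => e.symm (v' i)
  have hv : ∀ i, mfderiv 𝓘(ℝ, E) 𝓘(ℝ, E) (φ t₀) x₀ (v i) = v' i := fun i => by
    have h1 := congrArg (fun A : E →L[ℝ] E => A (v i)) he
    exact h1.symm.trans (e.apply_symm_apply _)
  let a : ℝ × M → ℂ := fun p =>
    (B.phi j (φ p.1 p.2) (frameAt δ (φ t₀ x₀) (φ p.1 p.2) ⊗ₜ frameAt δ (φ t₀ x₀) (φ p.1 p.2)) :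
      CForm (TangentSpace 𝓘(ℝ, E) (φ p.1 p.2)) n)
        (fun i => ts (φ t₀ x₀) (φ p.1 p.2) (diffCoord φ t₀ x₀ p (v i)))
  let b : ℝ × M → ℂ := fun p => (B.phi (pullbackACS (φ p.1) j) p.2
    (frameAt δ x₀ p.2 ⊗ₜ frameAt δ x₀ p.2) : CForm (TangentSpace 𝓘(ℝ, E) p.2) n)
      (fun i => ts x₀ p.2 (v i))
  have ha : ContMDiffAt (𝓘(ℝ, ℝ).prod 𝓘(ℝ, E)) 𝓘(ℝ, ℂ) ∞ a (t₀, x₀) :=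
    contMDiffAt_phi hn hr B (y := fun p : ℝ × M => φ p.1 p.2) (p₀ := (t₀, x₀)) (J := fun _ => j)
      (fun _ => hj) (ContMDiffAt.comp (t₀, x₀) (g := endoCoord j (φ t₀ x₀))
        (f := fun p : ℝ × M => φ p.1 p.2) (contMDiffAt_endoCoord (hj.smooth (φ t₀ x₀)))
        (hφ.smooth (t₀, x₀))) (hφ.smooth (t₀, x₀))
      (w := fun i p => diffCoord φ t₀ x₀ p (v i))
      (fun i => (contMDiffAt_diffCoord hφ.smooth t₀ x₀).clm_apply contMDiffAt_const)
  have hb : ContMDiffAt (𝓘(ℝ, ℝ).prod 𝓘(ℝ, E)) 𝓘(ℝ, ℂ) ∞ b (t₀, x₀) :=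
    contMDiffAt_phi hn hr B (y := Prod.snd) (p₀ := (t₀, x₀)) (J := fun p => pullbackACS (φ p.1) j)
      (fun p => hJ p.1) (contMDiffAt_endoCoord_pullbackACS hφ hj.smooth t₀ x₀) contMDiffAt_snd
      (w := fun i p => v i) (fun i => contMDiffAt_const)
  have hab : ∀ p ∈ liftDom δ φ (t₀, x₀), φ p.1 p.2 ∈ (chartAt E (φ t₀ x₀)).source →
      a p = q (t₀, x₀) p * b p := by
    intro p hp hps
    have h1 := congrArg (fun α : CForm (TangentSpace 𝓘(ℝ, E) p.2) n =>
      α (fun i => ts x₀ p.2 (v i))) (hq (t₀, x₀) p hp)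
    refine Eq.trans ?_ h1
    have e1 : (fun i => ts (E := E) (φ t₀ x₀) (φ p.1 p.2) (diffCoord φ t₀ x₀ p (v i))) =
        fun i => mfderiv 𝓘(ℝ, E) 𝓘(ℝ, E) (φ p.1) p.2 (ts x₀ p.2 (v i)) :=
      funext fun i => ts_tc hps _
    change (B.phi j (φ p.1 p.2) (frameAt δ (φ t₀ x₀) (φ p.1 p.2) ⊗ₜ
      frameAt δ (φ t₀ x₀) (φ p.1 p.2)) : CForm (TangentSpace 𝓘(ℝ, E) (φ p.1 p.2)) n)
        (fun i => ts (φ t₀ x₀) (φ p.1 p.2) (diffCoord φ t₀ x₀ p (v i))) = _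
    rw [e1]
    rfl
  have hm := liftDom_mem_nhds δ hφ (t₀, x₀)
  have ha0 : a (t₀, x₀) ≠ 0 := by
    have e1 : (fun i => ts (E := E) (φ t₀ x₀) (φ t₀ x₀) (diffCoord φ t₀ x₀ (t₀, x₀) (v i))) =
        v' := by
      funext i
      refine (ts_tc (mem_chart_source E _) _).trans ?_
      exact (congrArg (fun u : E => (mfderiv 𝓘(ℝ, E) 𝓘(ℝ, E) (φ t₀) x₀ u : E))
        (ts_self (E := E) x₀ (v i))).trans (hv i)
    change (B.phi j (φ t₀ x₀) (frameAt δ (φ t₀ x₀) (φ t₀ x₀) ⊗ₜ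
      frameAt δ (φ t₀ x₀) (φ t₀ x₀)) : CForm (TangentSpace 𝓘(ℝ, E) (φ t₀ x₀)) n)
        (fun i => ts (φ t₀ x₀) (φ t₀ x₀) (diffCoord φ t₀ x₀ (t₀, x₀) (v i))) ≠ 0
    rw [e1]
    exact hv'
  have h0 := hab (t₀, x₀) (mem_of_mem_nhds hm) (mem_chart_source E _)
  have hcb : q (t₀, x₀) (t₀, x₀) ≠ 0 ∧ b (t₀, x₀) ≠ 0 := mul_ne_zero_iff.mp (h0 ▸ ha0)
  refine ⟨contMDiffAt_of_eq_mul ha hb hcb.2 ?_, hcb.1⟩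
  filter_upwards [hm, Filter.Tendsto.eventually hφ.continuous.continuousAt
    (source_mem_nhds (E := E) (φ t₀ x₀))] with p h1 h2 using hab p h1 h2

omit [FiniteDimensional ℝ E] [T2Space M] [VectorBundle ℝ ℂ δ]
  [ContMDiffVectorBundle ∞ ℂ δ 𝓘(ℝ, E)] in
/-- The equation of a lift at `p` follows from its case on the square of the frame. -/
theorem square_of_liftCoord_sq (B : HalfFormBundle E δ n jref) {i p : ℝ × M}
    (hp : p ∈ liftDom δ φ i) {Θ : Π (t : ℝ) (x : M), δ (φ t x) →ₗ[ℂ] δ x}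
    (h : pullbackForm (φ p.1) p.2 (B.phi j (φ p.1 p.2) (frameAt δ (φ i.1 i.2) (φ p.1 p.2) ⊗ₜ
        frameAt δ (φ i.1 i.2) (φ p.1 p.2))) =
      (liftCoord Θ i p ^ 2) • (B.phi (pullbackACS (φ p.1) j) p.2
        (frameAt δ i.2 p.2 ⊗ₜ frameAt δ i.2 p.2) : CForm (TangentSpace 𝓘(ℝ, E) p.2) n))
    (β β' : δ (φ p.1 p.2)) :
    (B.phi (pullbackACS (φ p.1) j) p.2 (Θ p.1 p.2 β ⊗ₜ Θ p.1 p.2 β') :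
      CForm (TangentSpace 𝓘(ℝ, E) p.2) n) =
        pullbackForm (φ p.1) p.2 (B.phi j (φ p.1 p.2) (β ⊗ₜ β')) := by
  rw [phi_tmul B hp.1, map_eq_coord_smul hp.2 (Θ p.1 p.2) β,
    map_eq_coord_smul hp.2 (Θ p.1 p.2) β', map_smul, map_smul, phi_tmul B hp.2 β β']
  have h2 : ∀ (c : ℂ) (α : CForm (TangentSpace 𝓘(ℝ, E) (φ p.1 p.2)) n),
      pullbackForm (φ p.1) p.2 (c • α) = c • pullbackForm (φ p.1) p.2 α := fun _ _ => rfl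
  rw [h2, h, smul_smul]
  congr 1
  simp only [liftCoord, smul_eq_mul]
  ring

omit [VectorBundle ℝ ℂ δ] [ContMDiffVectorBundle ∞ ℂ δ 𝓘(ℝ, E)] [T2Space M] in
/-- The coordinates of any solution of the equation of a lift are square roots of `q`. -/
theorem liftCoord_sq_of_square (hn : Module.finrank ℝ E = 2 * n) (hr : IsCompatible Ω jref)
    (hJ : ∀ t, IsCompatible Ω (pullbackACS (φ t) j)) (B : HalfFormBundle E δ n jref) {i p : ℝ × M}
    (hp : p ∈ liftDom δ φ i) {Θ : Π (t : ℝ) (x : M), δ (φ t x) →ₗ[ℂ] δ x} {q : ℂ}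
    (hq : pullbackForm (φ p.1) p.2 (B.phi j (φ p.1 p.2) (frameAt δ (φ i.1 i.2) (φ p.1 p.2) ⊗ₜ
        frameAt δ (φ i.1 i.2) (φ p.1 p.2))) =
      q • (B.phi (pullbackACS (φ p.1) j) p.2
        (frameAt δ i.2 p.2 ⊗ₜ frameAt δ i.2 p.2) : CForm (TangentSpace 𝓘(ℝ, E) p.2) n))
    (h : ∀ β β' : δ (φ p.1 p.2),
      (B.phi (pullbackACS (φ p.1) j) p.2 (Θ p.1 p.2 β ⊗ₜ Θ p.1 p.2 β') :
      CForm (TangentSpace 𝓘(ℝ, E) p.2) n) =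
        pullbackForm (φ p.1) p.2 (B.phi j (φ p.1 p.2) (β ⊗ₜ β'))) :
    liftCoord Θ i p ^ 2 = q := by
  obtain ⟨v, hv⟩ := phi_frame_ne_zero hn hr (hJ p.1) B hp.1
  have h1 := h (frameAt δ (φ i.1 i.2) (φ p.1 p.2)) (frameAt δ (φ i.1 i.2) (φ p.1 p.2))
  rw [hq, phi_tmul B hp.1] at h1
  have h2 := congrArg (fun α : CForm (TangentSpace 𝓘(ℝ, E) p.2) n => α v) h1
  have h3 : liftCoord Θ i p * liftCoord Θ i p * (B.phi (pullbackACS (φ p.1) j) p.2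
      (frameAt δ i.2 p.2 ⊗ₜ frameAt δ i.2 p.2) : CForm (TangentSpace 𝓘(ℝ, E) p.2) n) v =
      q * (B.phi (pullbackACS (φ p.1) j) p.2
        (frameAt δ i.2 p.2 ⊗ₜ frameAt δ i.2 p.2) : CForm (TangentSpace 𝓘(ℝ, E) p.2) n) v := h2
  rw [sq]
  exact mul_right_cancel₀ hv h3

omit [FiniteDimensional ℝ E] [IsManifold 𝓘(ℝ, E) ∞ M] [T2Space M] [VectorBundle ℝ ℂ δ]
  [ContMDiffVectorBundle ∞ ℂ δ 𝓘(ℝ, E)] in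
theorem liftCoord_change (Θ : Π (t : ℝ) (x : M), δ (φ t x) →ₗ[ℂ] δ x) (i : ℝ × M) {k p : ℝ × M}
    (hp : p ∈ liftDom δ φ k) :
    liftCoord Θ i p = coordAt δ i.2 p.2 (frameAt δ k.2 p.2) *
      coordAt δ (φ k.1 k.2) (φ p.1 p.2) (frameAt δ (φ i.1 i.2) (φ p.1 p.2)) * liftCoord Θ k p := by
  unfold liftCoord
  rw [map_eq_coord_smul hp.2 (Θ p.1 p.2), map_smul, coordAt_change hp.1 i.2, smul_eq_mul]
  ring

/-- Any lift is smooth. -/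
theorem HalfFormBundle.IsLift.contMDiffAt_liftCoord (hn : Module.finrank ℝ E = 2 * n)
    (hr : IsCompatible Ω jref) (hφ : IsFlow X φ) (hj : IsCompatible Ω j)
    (hJ : ∀ t, IsCompatible Ω (pullbackACS (φ t) j)) {B : HalfFormBundle E δ n jref}
    {Θ : Π (t : ℝ) (x : M), δ (φ t x) →ₗ[ℂ] δ x} (hΘ : B.IsLift φ j Θ) (i : ℝ × M) :
    ContMDiffAt (𝓘(ℝ, ℝ).prod 𝓘(ℝ, E)) 𝓘(ℝ, ℂ) ∞ (liftCoord Θ i) i ∧ liftCoord Θ i i ≠ 0 := by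
  obtain ⟨q, hq⟩ := exists_liftSq hn hr hφ hJ B
  have hs := contMDiffAt_liftSq hn hr hφ hj hJ B hq i
  have hsq : ∀ p ∈ liftDom δ φ i, liftCoord Θ i p ^ 2 = q i p := fun p hp =>
    liftCoord_sq_of_square hn hr hJ B hp (hq i p hp) (hΘ.square p.1 p.2)
  have hm := liftDom_mem_nhds δ hφ i
  refine ⟨contMDiffAt_of_sq (hΘ.continuous i.1 i.2) hs.1 hs.2 ?_, fun h => hs.2 ?_⟩
  · filter_upwards [hm] with p hp using hsq p hp
  · rw [← hsq i (mem_of_mem_nhds hm), h]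
    norm_num

omit [FiniteDimensional ℝ E] [T2Space M] [VectorBundle ℂ ℂ δ] [VectorBundle ℝ ℂ δ]
  [ContMDiffVectorBundle ∞ ℂ δ 𝓘(ℝ, E)] in
/-- At time zero, where `φ_0 = id`, the identification of the fibres satisfies the equation of a
lift. -/
theorem fibreCast_square (B : HalfFormBundle E δ n jref) (ψ : M → M) (hψ : ψ = id) (x : M)
    (h : ψ x = x) (β β' : δ (ψ x)) :
    (B.phi (pullbackACS ψ j) x (fibreCast h β ⊗ₜ fibreCast h β') :
      CForm (TangentSpace 𝓘(ℝ, E) x) n) = pullbackForm ψ x (B.phi j (ψ x) (β ⊗ₜ β')) := by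
  subst hψ
  have h1 : pullbackACS (id : M → M) j = j := by
    funext y
    change (mfderiv 𝓘(ℝ, E) 𝓘(ℝ, E) (id : M → M) y).inverse ∘L j y ∘L
      mfderiv 𝓘(ℝ, E) 𝓘(ℝ, E) (id : M → M) y = j y
    rw [mfderiv_id]
    have h2 : (ContinuousLinearMap.id ℝ (TangentSpace 𝓘(ℝ, E) y)).inverse =
      ContinuousLinearMap.id ℝ (TangentSpace 𝓘(ℝ, E) y) := ContinuousLinearMap.inverse_id
    rw [h2]
    rfl
  have h3 : ∀ α : CForm (TangentSpace 𝓘(ℝ, E) x) n, pullbackForm (id : M → M) x α = α := by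
    intro α
    ext v
    change α (fun i => mfderiv 𝓘(ℝ, E) 𝓘(ℝ, E) (id : M → M) x (v i)) = α v
    rw [mfderiv_id]
    rfl
  rw [h1]
  exact (h3 _).symm

/-- Existence of the lift `φ_t^* : δ_j → δ_{φ_t^* j}`: square roots of the functions `q` of
`exists_liftSq` are chosen at each point, equal to the identity at time zero, and their signs are
then changed so as to make them continuous. -/
theorem exists_isLift (hn : Module.finrank ℝ E = 2 * n) (hr : IsCompatible Ω jref)
    (hφ : IsFlow X φ) (hj : IsCompatible Ω j) (hJ : ∀ t, IsCompatible Ω (pullbackACS (φ t) j))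
    (B : HalfFormBundle E δ n jref) :
    ∃ Θ : Π (t : ℝ) (x : M), δ (φ t x) →ₗ[ℂ] δ x, B.IsLift φ j Θ := by
  classical
  obtain ⟨q, hq⟩ := exists_liftSq hn hr hφ hJ B
  have hs := contMDiffAt_liftSq hn hr hφ hj hJ B hq
  have hmem : ∀ i, i ∈ liftDom δ φ i := fun i => mem_of_mem_nhds (liftDom_mem_nhds δ hφ i)
  -- a discontinuous choice of the lift, equal to the identity at time zero
  let Θ₀ : Π (t : ℝ) (x : M), δ (φ t x) →ₗ[ℂ] δ x := fun t x =>
    if h : φ t x = x ∧ t = 0 then fibreCast h.1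
    else (q (t, x) (t, x) ^ (2⁻¹ : ℂ)) •
      (coordAt δ (φ t x) (φ t x)).smulRight (frameAt δ x x)
  have hz : ∀ x, Θ₀ 0 x = fibreCast (hφ.zero x) := fun x => dif_pos ⟨hφ.zero x, rfl⟩
  have hsquare : ∀ (t : ℝ) (x : M) (β β' : δ (φ t x)),
      (B.phi (pullbackACS (φ t) j) x (Θ₀ t x β ⊗ₜ Θ₀ t x β') : CForm (TangentSpace 𝓘(ℝ, E) x) n) =
        pullbackForm (φ t) x (B.phi j (φ t x) (β ⊗ₜ β')) := by
    intro t x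
    by_cases ht : t = 0
    · subst ht
      rw [hz]
      exact fibreCast_square B (φ 0) (funext hφ.zero) x (hφ.zero x)
    · refine square_of_liftCoord_sq B (i := (t, x)) (p := (t, x)) (hmem (t, x)) ?_
      rw [hq (t, x) (t, x) (hmem (t, x))]
      congr 1
      have h1 : Θ₀ t x = (q (t, x) (t, x) ^ (2⁻¹ : ℂ)) •
        (coordAt δ (φ t x) (φ t x)).smulRight (frameAt δ x x) := dif_neg fun h => ht h.2
      have h2 : liftCoord Θ₀ (t, x) (t, x) = q (t, x) (t, x) ^ (2⁻¹ : ℂ) := by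
        simp [liftCoord, h1, coordAt_frameAt (mem_frameDom δ (φ t x)),
          coordAt_frameAt (mem_frameDom δ x)]
      rw [h2]
      exact (Complex.cpow_ofNat_inv_pow _ 2).symm
  have hsq : ∀ i, ∀ p ∈ liftDom δ φ i, liftCoord Θ₀ i p ^ 2 = q i p := fun i p hp =>
    liftCoord_sq_of_square hn hr hJ B hp (hq i p hp) (hsquare p.1 p.2)
  have hV : ∀ i, ∃ V ⊆ liftDom δ φ i, IsOpen V ∧ i ∈ V ∧ ContinuousOn (q i) V := fun i => by
    have h1 := (contMDiffAt_iff_contMDiffAt_nhds (n := 1) (by simp)).mp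
      ((hs i).1.of_le (by norm_cast))
    obtain ⟨V, hV, hVo, hiV⟩ := mem_nhds_iff.mp (Filter.inter_mem h1 (liftDom_mem_nhds δ hφ i))
    exact ⟨V, fun p hp => (hV hp).2, hVo, hiV,
      fun p hp => (ContMDiffAt.continuousAt (hV hp).1).continuousWithinAt⟩
  choose V hVd hVo hiV hVq using hV
  obtain ⟨η, h1, h2, h3⟩ := exists_sign_continuousAt (V := V) (θ := liftCoord Θ₀) (q := q)
    (g := fun i k p => coordAt δ i.2 p.2 (frameAt δ k.2 p.2) *
      coordAt δ (φ k.1 k.2) (φ p.1 p.2) (frameAt δ (φ i.1 i.2) (φ p.1 p.2))) hVo hiV hVq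
    (fun i => (hs i).2) (fun i p hp => hsq i p (hVd i hp))
    (fun i k => by
      refine ContinuousOn.mul ?_ ?_
      · exact (continuousOn_coordAt_frameAt i.2 k.2).comp continuous_snd.continuousOn
          fun p hp => ⟨(hVd i hp.1).1, (hVd k hp.2).1⟩
      · exact (continuousOn_coordAt_frameAt (φ k.1 k.2) (φ i.1 i.2)).comp
          hφ.continuous.continuousOn fun p hp => ⟨(hVd k hp.2).2, (hVd i hp.1).2⟩)
    (fun i k p hp => liftCoord_change Θ₀ i (hVd k hp.2)) 0
    (fun i => by
      have key : ∀ (y x : M) (h : y = x), coordAt δ i.2 x (fibreCast h (frameAt δ (φ i.1 i.2) y)) =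
          coordAt δ i.2 x (frameAt δ (φ i.1 i.2) x) := by
        rintro y _ rfl
        rfl
      have e : (fun x => liftCoord Θ₀ i (0, x)) = fun x =>
          coordAt δ i.2 x (frameAt δ (φ i.1 i.2) x) := by
        funext x
        change coordAt δ i.2 x (Θ₀ 0 x (frameAt δ (φ i.1 i.2) (φ 0 x))) = _
        rw [hz]
        exact key _ _ (hφ.zero x)
      rw [e]
      refine (continuousOn_coordAt_frameAt i.2 (φ i.1 i.2)).mono fun x hx => ?_
      have h := hVd i hx
      refine ⟨h.1, ?_⟩
      have h' := h.2
      simp only [hφ.zero] at h'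
      exact h')
  refine ⟨fun t x => η (t, x) • Θ₀ t x, ?_, ?_, ?_⟩
  · intro t x β β'
    rw [← hsquare, LinearMap.smul_apply, LinearMap.smul_apply, TensorProduct.smul_tmul_smul, ← sq,
      h1, one_smul]
  · intro x β
    have e : (η (0, x) • Θ₀ 0 x) β = fibreCast (hφ.zero x) β := by
      rw [h2, one_smul, hz]
    have key : ∀ (y : M) (h : y = x) (β : δ y),
        (⟨x, fibreCast h β⟩ : TotalSpace ℂ δ) = ⟨y, β⟩ := by
      rintro _ rfl β
      rfl
    exact (congrArg (fun b : δ x => (⟨x, b⟩ : TotalSpace ℂ δ)) e).trans (key _ (hφ.zero x) β)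
  · intro t₀ x₀
    refine (h3 (t₀, x₀)).congr (Filter.Eventually.of_forall fun p => ?_)
    simp [liftCoord]

/-- Two lifts differ by a sign that is continuous in time and equal to `1` at time zero. -/
theorem HalfFormBundle.IsLift.unique (hn : Module.finrank ℝ E = 2 * n) (hr : IsCompatible Ω jref)
    (hφ : IsFlow X φ) (hj : IsCompatible Ω j) (hJ : ∀ t, IsCompatible Ω (pullbackACS (φ t) j))
    {B : HalfFormBundle E δ n jref} {Θ Θ' : Π (t : ℝ) (x : M), δ (φ t x) →ₗ[ℂ] δ x}
    (hΘ : B.IsLift φ j Θ) (hΘ' : B.IsLift φ j Θ') : Θ' = Θ := by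
  obtain ⟨q, hq⟩ := exists_liftSq hn hr hφ hJ B
  have hs := contMDiffAt_liftSq hn hr hφ hj hJ B hq
  have hmem : ∀ i, i ∈ liftDom δ φ i := fun i => mem_of_mem_nhds (liftDom_mem_nhds δ hφ i)
  have hc := hΘ.contMDiffAt_liftCoord hn hr hφ hj hJ
  have hc' := hΘ'.contMDiffAt_liftCoord hn hr hφ hj hJ
  have hsq : ∀ i, ∀ p ∈ liftDom δ φ i, liftCoord Θ i p ^ 2 = q i p := fun i p hp =>
    liftCoord_sq_of_square hn hr hJ B hp (hq i p hp) (hΘ.square p.1 p.2)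
  have hsq' : ∀ i, ∀ p ∈ liftDom δ φ i, liftCoord Θ' i p ^ 2 = q i p := fun i p hp =>
    liftCoord_sq_of_square hn hr hJ B hp (hq i p hp) (hΘ'.square p.1 p.2)
  have hne := fun i => (hc i).2
  funext t x
  -- the ratio of the two lifts is a continuous function of time with values `±1`
  let r : ℝ → ℂ := fun t => liftCoord Θ' (t, x) (t, x) / liftCoord Θ (t, x) (t, x)
  have hr2 : ∀ t, r t ^ 2 = 1 := fun t => by
    change (liftCoord Θ' (t, x) (t, x) / liftCoord Θ (t, x) (t, x)) ^ 2 = 1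
    rw [div_pow, hsq' _ _ (hmem _), ← hsq _ _ (hmem _), div_self (pow_ne_zero 2 (hne _))]
  have hloc : ∀ t₀ : ℝ, ∀ t, (t, x) ∈ liftDom δ φ (t₀, x) →
      r t = liftCoord Θ' (t₀, x) (t, x) / liftCoord Θ (t₀, x) (t, x) := fun t₀ t ht => by
    change liftCoord Θ' (t, x) (t, x) / liftCoord Θ (t, x) (t, x) = _
    have e1 := liftCoord_change Θ (t, x) ht
    have e2 := liftCoord_change Θ' (t, x) ht
    have h0 := hne (t, x)
    rw [e1] at h0
    rw [e1, e2, mul_div_mul_left _ _ (left_ne_zero_of_mul h0)]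
  have hrc : Continuous r := continuous_iff_continuousAt.mpr fun t₀ => by
    have hct : ContinuousAt (fun t : ℝ => (t, x)) t₀ := by fun_prop
    have h1 : ContinuousAt (fun t => liftCoord Θ' (t₀, x) (t, x) / liftCoord Θ (t₀, x) (t, x)) t₀ :=
      (ContinuousAt.comp (g := liftCoord Θ' (t₀, x)) (f := fun t : ℝ => (t, x))
        (hc' (t₀, x)).1.continuousAt hct).div
      (ContinuousAt.comp (g := liftCoord Θ (t₀, x)) (f := fun t : ℝ => (t, x))
        (hc (t₀, x)).1.continuousAt hct) (hne _)
    refine h1.congr ?_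
    filter_upwards [hct.preimage_mem_nhds (liftDom_mem_nhds δ hφ (t₀, x))] with t ht
      using (hloc t₀ t ht).symm
  have hr0 : r 0 = 1 := by
    have e : Θ' 0 x = Θ 0 x := by
      ext β
      have h := (hΘ'.zero x β).trans (hΘ.zero x β).symm
      simpa using h
    change liftCoord Θ' (0, x) (0, x) / liftCoord Θ (0, x) (0, x) = 1
    have e' : liftCoord Θ' (0, x) (0, x) = liftCoord Θ (0, x) (0, x) := by
      simp only [liftCoord, e]
    rw [e', div_self (hne _)]
  have hr1 : r t = 1 := isPreconnected_univ.eq_of_sq_eq (f := r) (g := fun _ => 1)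
    hrc.continuousOn continuousOn_const (fun t _ => by simp [hr2]) (fun _ => one_ne_zero)
    (Set.mem_univ 0) hr0 (Set.mem_univ t)
  have h1 : liftCoord Θ' (t, x) (t, x) = liftCoord Θ (t, x) (t, x) := by
    have h2 := (div_eq_one_iff_eq (hne (t, x))).mp hr1
    exact h2
  ext β
  rw [map_eq_coord_smul (mem_frameDom δ (φ t x)) (Θ' t x) β,
    map_eq_coord_smul (mem_frameDom δ (φ t x)) (Θ t x) β,
    ← coordAt_smul_frameAt (mem_frameDom δ x) (Θ' t x (frameAt δ (φ t x) (φ t x))),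
    ← coordAt_smul_frameAt (mem_frameDom δ x) (Θ t x (frameAt δ (φ t x) (φ t x)))]
  change _ • liftCoord Θ' (t, x) (t, x) • _ = _ • liftCoord Θ (t, x) (t, x) • _
  rw [h1]

end Lift

/-! ### Parallel transport along the flow -/

section ParallelTransport

variable {E : Type*} [NormedAddCommGroup E] [NormedSpace ℝ E] [FiniteDimensional ℝ E]
  {M : Type*} [TopologicalSpace M] [ChartedSpace E M] [IsManifold 𝓘(ℝ, E) ∞ M] [T2Space M]
  {L : M → Type*} [TopologicalSpace (TotalSpace ℂ L)] [∀ x, TopologicalSpace (L x)]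
  [∀ x, AddCommGroup (L x)] [∀ x, Module ℂ (L x)] [FiberBundle ℂ L] [VectorBundle ℂ ℂ L]
  [∀ x, IsTopologicalAddGroup (L x)] [∀ x, ContinuousSMul ℝ (L x)]
  {nabla : CovariantDerivative 𝓘(ℝ, E) ℂ L}
  {X : Π x : M, TangentSpace 𝓘(ℝ, E) x} {φ : ℝ → M → M}
  {T : Π (t : ℝ) (x : M), L x ≃ₗ[ℂ] L (φ t x)}

omit [FiniteDimensional ℝ E] [IsManifold 𝓘(ℝ, E) ∞ M] [T2Space M] [VectorBundle ℂ ℂ L]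
  [∀ x, IsTopologicalAddGroup (L x)] [∀ x, ContinuousSMul ℝ (L x)] in
theorem coordAt_congr [VectorBundle ℂ ℂ L] {z y y' : M} {u : L y} {u' : L y'}
    (h : (⟨y, u⟩ : TotalSpace ℂ L) = ⟨y', u'⟩) : coordAt L z y u = coordAt L z y' u' :=
  congrArg (fun p : TotalSpace ℂ L => coordAt L z p.1 p.2) h

/-- Parallel transport along a flow line is multiplicative: both sides are parallel along the flow
line of `φ h x`, and agree initially. -/
theorem IsParallelTransport.coordAt_add (hT : IsParallelTransport nabla X φ T) (hφ : IsFlow X φ)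
    (t h : ℝ) (x : M) {ξ : L x} (hξ : ξ ≠ 0) (z : M) :
    coordAt L z (φ (t + h) x) (T (t + h) x ξ) =
      coordAt L z (φ t (φ h x)) (T t (φ h x) (T h x ξ)) := by
  have : CompleteSpace E := FiniteDimensional.complete ℝ E
  let y := φ h x
  let ζ : L y := T h x ξ
  have hζ : ζ ≠ 0 := fun h0 => hξ ((LinearEquiv.map_eq_zero_iff _).mp h0)
  have hadd : ∀ t, φ (t + h) x = φ t y := fun t => hφ.add t h x
  let a : M → ℝ → ℂ := fun z t => coordAt L z (φ (t + h) x) (T (t + h) x ξ)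
  let b : M → ℝ → ℂ := fun z t => coordAt L z (φ t y) (T t y ζ)
  have hb0 : ∀ z t, φ t y ∈ frameDom L z → b z t ≠ 0 := fun z t hz h0 => hζ <| by
    have h1 := (coordAt_eq_zero_iff hz _).mp h0
    exact (LinearEquiv.map_eq_zero_iff _).mp h1
  have hchange : ∀ z z' t, φ t y ∈ frameDom L z' →
      a z t = a z' t * coordAt L z (φ t y) (frameAt L z' (φ t y)) ∧
      b z t = b z' t * coordAt L z (φ t y) (frameAt L z' (φ t y)) := fun z z' t hz' => by
    refine ⟨?_, coordAt_change hz' z _⟩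
    have h1 := coordAt_change (L := L) (x₁ := z') (y := φ (t + h) x) (by rwa [hadd]) z
      (T (t + h) x ξ)
    rw [show a z t = _ from h1]
    congr 1
    rw [hadd]
  -- the ratio of the two sides does not depend on the frame; its derivative vanishes because both
  -- sides satisfy the same linear equation
  let r : ℝ → ℂ := fun t => a (φ t y) t / b (φ t y) t
  have hloc : ∀ z t, φ t y ∈ frameDom L z → a z t = r t * b z t := fun z t hz => by
    have hc := hchange z (φ t y) t (mem_frameDom L _)
    rw [hc.1, hc.2, ← mul_assoc, div_mul_cancel₀ _ (hb0 _ t (mem_frameDom L _))]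
  have hrd : ∀ t, HasDerivAt r 0 t := fun t₀ => by
    let z := φ t₀ y
    let κ := coordAt L z z (nabla.toFun (frameAt L z) z (X z))
    have hbd : HasDerivAt (b z) (-κ * b z t₀) t₀ := hT.parallel t₀ y ζ
    have had : HasDerivAt (a z) (-κ * a z t₀) t₀ := by
      have h1 := hT.parallel (t₀ + h) x ξ
      have key : ∀ z', z' = φ (t₀ + h) x →
          HasDerivAt (fun t => coordAt L z' (φ t x) (T t x ξ))
            (-(coordAt L z' z' (nabla.toFun (frameAt L z') z' (X z')))
              * coordAt L z' (φ (t₀ + h) x) (T (t₀ + h) x ξ)) (t₀ + h) := by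
        rintro _ rfl
        exact h1
      exact (key z (hadd t₀).symm).comp_add_const t₀ h
    have hbz : b z t₀ ≠ 0 := hb0 z t₀ (mem_frameDom L _)
    have hd := had.div hbd hbz
    have h0 : (-κ * a z t₀ * b z t₀ - a z t₀ * (-κ * b z t₀)) / b z t₀ ^ 2 = 0 := by
      rw [div_eq_zero_iff]; left; ring
    rw [h0] at hd
    refine hd.congr_of_eventuallyEq ?_
    have hc : ContinuousAt (fun t => φ t y) t₀ :=
      (hφ.continuous.comp (by fun_prop : Continuous fun t : ℝ => (t, y))).continuousAt
    filter_upwards [hc.preimage_mem_nhds (frameDom_mem_nhds L z)] with t ht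
    change r t = a z t / b z t
    rw [hloc z t ht, mul_div_cancel_right₀ _ (hb0 z t ht)]
  have hr0 : r 0 = 1 := by
    have key : ∀ s, s = h → ∀ z, coordAt L z (φ s x) (T s x ξ) = coordAt L z y ζ := by
      rintro _ rfl z; rfl
    have h1 : a (φ 0 y) 0 = b (φ 0 y) 0 :=
      (key (0 + h) (zero_add h) _).trans (coordAt_congr (hT.zero y ζ)).symm
    change a (φ 0 y) 0 / b (φ 0 y) 0 = 1
    rw [h1, div_self (hb0 _ 0 (mem_frameDom L _))]
  have hr1 : r t = 1 := (is_const_of_deriv_eq_zero (fun t => (hrd t).differentiableAt)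
    (fun t => (hrd t).deriv) t 0).trans hr0
  change a z t = b z t
  have hc := hchange z (φ t y) t (mem_frameDom L _)
  rw [hc.1, hc.2, hloc (φ t y) t (mem_frameDom L _), hr1, one_mul]

omit [FiniteDimensional ℝ E] [IsManifold 𝓘(ℝ, E) ∞ M] [T2Space M] in
/-- In the frame `e` centred at `x`, parallel transport of `e` along the flow line of `x` has
derivative `-θ` at time zero, where `∇_X e = θ e`. -/
theorem IsParallelTransport.hasDerivAt_zero (hT : IsParallelTransport nabla X φ T)
    (hφ : IsFlow X φ) (x : M) :
    HasDerivAt (fun h => coordAt L x (φ h x) (T h x (frameAt L x x)))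
      (-(coordAt L x x (nabla.toFun (frameAt L x) x (X x)))) 0 := by
  have key : ∀ z, z = φ 0 x → HasDerivAt (fun t => coordAt L z (φ t x) (T t x (frameAt L x x)))
      (-(coordAt L z z (nabla.toFun (frameAt L z) z (X z)))
        * coordAt L z (φ 0 x) (T 0 x (frameAt L x x))) 0 := by
    rintro _ rfl
    exact hT.parallel 0 x _
  have h := key x (hφ.zero x).symm
  rwa [coordAt_congr (hT.zero x _), coordAt_frameAt (mem_frameDom L x), mul_one] at h

end ParallelTransport

/-! ### Smoothness of the section -/

section Action

variable {E : Type*} [NormedAddCommGroup E] [NormedSpace ℝ E]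
  {M : Type*} [TopologicalSpace M] [ChartedSpace E M]
  {L : M → Type*} [TopologicalSpace (TotalSpace ℂ L)] [∀ x, TopologicalSpace (L x)]
  [∀ x, AddCommGroup (L x)] [∀ x, Module ℂ (L x)] [FiberBundle ℂ L] [VectorBundle ℂ ℂ L]
  [∀ x, IsTopologicalAddGroup (L x)] [∀ x, ContinuousSMul ℝ (L x)]
  {δ : M → Type*} [TopologicalSpace (TotalSpace ℂ δ)] [∀ x, TopologicalSpace (δ x)]
  [∀ x, AddCommGroup (δ x)] [∀ x, Module ℂ (δ x)] [FiberBundle ℂ δ] [VectorBundle ℂ ℂ δ]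
  {nabla : CovariantDerivative 𝓘(ℝ, E) ℂ L}
  {X : Π x : M, TangentSpace 𝓘(ℝ, E) x} {φ : ℝ → M → M}
  {T : Π (t : ℝ) (x : M), L x ≃ₗ[ℂ] L (φ t x)} {k : ℕ}

omit [∀ x, IsTopologicalAddGroup (L x)] [∀ x, ContinuousSMul ℝ (L x)] in
/-- The coordinate of the inverse of an isomorphism of lines is the inverse of its coordinate. -/
theorem coordAt_symm_frameAt {x₀ y z w : M} (hy : y ∈ frameDom L x₀) (hw : w ∈ frameDom L z)
    (A : L y ≃ₗ[ℂ] L w) : coordAt L x₀ y (A.symm (frameAt L z w)) =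
      (coordAt L z w (A (frameAt L x₀ y)))⁻¹ := by
  have h1 : A.symm (A (frameAt L x₀ y)) = frameAt L x₀ y := A.symm_apply_apply _
  rw [← coordAt_smul_frameAt hw (A (frameAt L x₀ y)), map_smul] at h1
  have h2 := congrArg (coordAt L x₀ y) h1
  rw [map_smul, coordAt_frameAt hy, smul_eq_mul] at h2
  exact eq_inv_of_mul_eq_one_right h2

omit [∀ x, IsTopologicalAddGroup (L x)] [∀ x, ContinuousSMul ℝ (L x)] in
theorem coordAt_expAut_symm {f : M → ℝ} {x₀ y z : M} {t : ℝ} (hy : y ∈ frameDom L x₀)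
    (hw : φ t y ∈ frameDom L z) :
    coordAt L x₀ y ((expAut f T t y).symm (frameAt L z (φ t y))) =
      Complex.exp (Complex.I * t * f y) * (coordAt L z (φ t y) (T t y (frameAt L x₀ y)))⁻¹ := by
  rw [coordAt_symm_frameAt hy hw]
  have h : expAut f T t y (frameAt L x₀ y) =
    Complex.exp (-(Complex.I * (t : ℂ) * (f y : ℂ))) • T t y (frameAt L x₀ y) := rfl
  rw [h, map_smul, smul_eq_mul, mul_inv, Complex.exp_neg, inv_inv]

omit [∀ x, IsTopologicalAddGroup (L x)] [∀ x, ContinuousSMul ℝ (L x)] in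
/-- The coordinate of `U_t s`, in the frames centred at `x₀` for the value and at `z` for the
argument. -/
theorem tensorCoord_action (Φ : Π (t : ℝ) (x : M), L x ≃ₗ[ℂ] L (φ t x))
    (Θ : Π (t : ℝ) (x : M), δ (φ t x) →ₗ[ℂ] δ x) (s : Π x : M, Fibre L δ k x) (t : ℝ) {x₀ y z : M}
    (hL : φ t y ∈ frameDom L z) (hδ : φ t y ∈ frameDom δ z) :
    tensorCoord L δ k x₀ y (action Φ Θ t s y) =
      tensorCoord L δ k z (φ t y) (s (φ t y)) *
        (coordAt L x₀ y ((Φ t y).symm (frameAt L z (φ t y))) ^ k *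
          coordAt δ x₀ y (Θ t y (frameAt δ z (φ t y)))) := by
  conv_lhs => rw [action, ← tensorCoord_smul_tensorFrame hL hδ (s (φ t y)), map_smul, map_smul,
    tensorFrame, TensorProduct.map_tmul, PiTensorProduct.map_tprod, tensorCoord_tprod_tmul]
  simp

/-- In local frames, `U_t s` is a product of smooth functions of `(t, x)`. -/
theorem isSmoothFamily_action (hT : IsParallelTransport nabla X φ T) (hφ : IsFlow X φ) {f : M → ℝ}
    (hf : ContMDiff 𝓘(ℝ, E) 𝓘(ℝ, ℝ) ∞ f) {Θ : Π (t : ℝ) (x : M), δ (φ t x) →ₗ[ℂ] δ x}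
    (hΘ : ∀ i, ContMDiffAt (𝓘(ℝ, ℝ).prod 𝓘(ℝ, E)) 𝓘(ℝ, ℂ) ∞ (liftCoord Θ i) i)
    {s : Π x : M, Fibre L δ k x} (hs : IsSmoothSection E s) :
    IsSmoothFamily E (fun t => action (expAut f T) Θ t s) := by
  intro t₀ x₀
  let z := φ t₀ x₀
  let τ : ℝ × M → ℂ := fun p => coordAt L z (φ p.1 p.2) (T p.1 p.2 (frameAt L x₀ p.2))
  have hτ : ContMDiffAt (𝓘(ℝ, ℝ).prod 𝓘(ℝ, E)) 𝓘(ℝ, ℂ) ∞ τ (t₀, x₀) := hT.smooth t₀ x₀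
  have hτ0 : τ (t₀, x₀) ≠ 0 := fun h => by
    have h1 := (coordAt_eq_zero_iff (mem_frameDom L z) _).mp h
    exact frameAt_ne_zero (mem_frameDom L x₀) ((LinearEquiv.map_eq_zero_iff _).mp h1)
  have hg : ContMDiffAt (𝓘(ℝ, ℝ).prod 𝓘(ℝ, E)) 𝓘(ℝ, ℂ) ∞
      (fun p : ℝ × M => tensorCoord L δ k z (φ p.1 p.2) (s (φ p.1 p.2))) (t₀, x₀) :=
    ContMDiffAt.comp (t₀, x₀) (g := fun y => tensorCoord L δ k z y (s y))
      (f := fun p : ℝ × M => φ p.1 p.2) (hs z) (hφ.smooth (t₀, x₀))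
  have hff : ContMDiffAt (𝓘(ℝ, ℝ).prod 𝓘(ℝ, E)) 𝓘(ℝ, ℝ) ∞ (fun p : ℝ × M => f p.2) (t₀, x₀) :=
    hf.contMDiffAt.comp (t₀, x₀) contMDiffAt_snd
  have hd : ContDiffAt ℝ ∞ (fun q : ((ℂ × ℂ) × ℂ) × ℝ × ℝ => q.1.1.1 *
      ((Complex.exp (Complex.I * (q.2.1 : ℂ) * (q.2.2 : ℂ)) * (q.1.1.2)⁻¹) ^ k * q.1.2))
      (((tensorCoord L δ k z z (s z), τ (t₀, x₀)), liftCoord Θ (t₀, x₀) (t₀, x₀)), t₀, f x₀) := by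
    have e1 : ContDiffAt ℝ ∞ (fun q : ((ℂ × ℂ) × ℂ) × ℝ × ℝ => q.1.1.2)
        (((tensorCoord L δ k z z (s z), τ (t₀, x₀)), liftCoord Θ (t₀, x₀) (t₀, x₀)), t₀, f x₀) := by
      fun_prop
    have e2 := e1.inv hτ0
    have e3 : ContDiff ℝ ∞ (fun r : ℝ => (r : ℂ)) := Complex.ofRealCLM.contDiff
    have e4 : ContDiff ℝ ∞ (fun q : ((ℂ × ℂ) × ℂ) × ℝ × ℝ =>
        Complex.exp (Complex.I * (q.2.1 : ℂ) * (q.2.2 : ℂ))) :=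
      ContDiff.cexp ((contDiff_const.mul (e3.comp (by fun_prop))).mul (e3.comp (by fun_prop)))
    have e5 : ContDiff ℝ ∞ (fun q : ((ℂ × ℂ) × ℂ) × ℝ × ℝ => q.1.1.1) := by fun_prop
    have e6 : ContDiff ℝ ∞ (fun q : ((ℂ × ℂ) × ℂ) × ℝ × ℝ => q.1.2) := by fun_prop
    exact e5.contDiffAt.mul (((e4.contDiffAt.mul e2).pow k).mul e6.contDiffAt)
  have hc := ContDiffAt.comp_contMDiffAt (x := (t₀, x₀)) (f := fun p : ℝ × M =>
    (((tensorCoord L δ k z (φ p.1 p.2) (s (φ p.1 p.2)), τ p), liftCoord Θ (t₀, x₀) p), p.1, f p.2))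
    hd (((hg.prodMk_space hτ).prodMk_space (hΘ (t₀, x₀))).prodMk_space
      (contMDiffAt_fst.prodMk_space hff))
  refine hc.congr_of_eventuallyEq ?_
  filter_upwards [continuous_snd.continuousAt.preimage_mem_nhds (frameDom_mem_nhds L x₀),
    hφ.continuous.continuousAt.preimage_mem_nhds (frameDom_mem_nhds L z),
    hφ.continuous.continuousAt.preimage_mem_nhds (frameDom_mem_nhds δ z)] with p h1 h2 h3
  rw [tensorCoord_action _ _ _ _ h2 h3, coordAt_expAut_symm h1 h2]
  rfl

end Action

/-! ### The half-form Lie derivative -/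

section LieFrame

variable {E : Type*} [NormedAddCommGroup E] [NormedSpace ℝ E] [FiniteDimensional ℝ E]
  {M : Type*} [TopologicalSpace M] [ChartedSpace E M] [IsManifold 𝓘(ℝ, E) ∞ M] [T2Space M]
  {δ : M → Type*} [TopologicalSpace (TotalSpace ℂ δ)] [∀ x, TopologicalSpace (δ x)]
  [∀ x, AddCommGroup (δ x)] [∀ x, Module ℂ (δ x)] [FiberBundle ℂ δ]
  [VectorBundle ℂ ℂ δ]
  {n : ℕ} {Ω : Π x : M, TangentSpace 𝓘(ℝ, E) x →ₗ[ℝ] TangentSpace 𝓘(ℝ, E) x →ₗ[ℝ] ℝ}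
  {jref j : Π x : M, TangentSpace 𝓘(ℝ, E) x →L[ℝ] TangentSpace 𝓘(ℝ, E) x}
  {X : Π x : M, TangentSpace 𝓘(ℝ, E) x} {φ : ℝ → M → M}

/-- Functoriality `φ_h^* φ_t^* α = φ_{t+h}^* α` of the pull-back of forms. -/
theorem pullbackForm_add (hφ : IsFlow X φ) (t h : ℝ) (x : M)
    (α : Π y : M, CForm (TangentSpace 𝓘(ℝ, E) y) n) :
    pullbackForm (φ h) x (pullbackForm (φ t) (φ h x) (α (φ t (φ h x)))) =
      pullbackForm (φ (t + h)) x (α (φ (t + h) x)) := by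
  have : CompleteSpace E := FiniteDimensional.complete ℝ E
  ext v
  have key : ∀ (w w' : M) (_ : w = w') (u u' : Fin n → E) (_ : u = u'), α w u = α w' u' := by
    rintro w _ rfl u _ rfl
    rfl
  exact key _ _ (hφ.add t h x).symm _ _ (funext fun i => (hφ.mfderiv_add t h x (v i)).symm)

/-- Comparison of the lifts at the times `t` and `t + h`. -/
theorem HalfFormBundle.IsLift.pullbackForm_phi {B : HalfFormBundle E δ n jref} (hφ : IsFlow X φ)
    {Θ : Π (t : ℝ) (x : M), δ (φ t x) →ₗ[ℂ] δ x} (hΘ : B.IsLift φ j Θ) {t h : ℝ} {x : M}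
    (hy : φ h x ∈ frameDom δ x) (h0 : liftCoord Θ (t, x) (t, φ h x) ≠ 0) :
    pullbackForm (φ h) x (B.phi (pullbackACS (φ t) j) (φ h x)
        (frameAt δ x (φ h x) ⊗ₜ frameAt δ x (φ h x))) =
      ((liftCoord Θ (t, x) (t + h, x) / liftCoord Θ (t, x) (t, φ h x)) ^ 2) •
        (B.phi (pullbackACS (φ (t + h)) j) x (frameAt δ x x ⊗ₜ frameAt δ x x) :
          CForm (TangentSpace 𝓘(ℝ, E) x) n) := by
  have h1 := hΘ.square t (φ h x) (frameAt δ (φ t x) (φ t (φ h x)))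
    (frameAt δ (φ t x) (φ t (φ h x)))
  have h2 := hΘ.square (t + h) x (frameAt δ (φ t x) (φ (t + h) x))
    (frameAt δ (φ t x) (φ (t + h) x))
  have h3 := pullbackForm_add hφ t h x
    (fun w => (B.phi j w (frameAt δ (φ t x) w ⊗ₜ frameAt δ (φ t x) w) :
      CForm (TangentSpace 𝓘(ℝ, E) w) n))
  simp only [← h1, ← h2] at h3
  rw [phi_tmul B hy, phi_tmul B (mem_frameDom δ x)] at h3
  have h4 : liftCoord Θ (t, x) (t, φ h x) ^ 2 • pullbackForm (φ h) x
      (B.phi (pullbackACS (φ t) j) (φ h x) (frameAt δ x (φ h x) ⊗ₜ frameAt δ x (φ h x))) =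
      liftCoord Θ (t, x) (t + h, x) ^ 2 •
        (B.phi (pullbackACS (φ (t + h)) j) x (frameAt δ x x ⊗ₜ frameAt δ x x) :
          CForm (TangentSpace 𝓘(ℝ, E) x) n) := by
    rw [sq, sq]
    exact h3
  rw [div_pow, div_eq_inv_mul, mul_smul, ← h4, smul_smul, inv_mul_cancel₀ (pow_ne_zero 2 h0),
    one_smul]

variable [VectorBundle ℝ ℂ δ] [ContMDiffVectorBundle ∞ ℂ δ 𝓘(ℝ, E)]

/-- The half-form Lie derivative of a frame is the difference of the logarithmic derivatives of the
lift of the flow and of the parallel family of half-form morphisms. -/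
theorem lieFrame_eq (hn : Module.finrank ℝ E = 2 * n) (hr : IsCompatible Ω jref)
    (hφ : IsFlow X φ) (hj : IsCompatible Ω j) (hJ : ∀ t, IsCompatible Ω (pullbackACS (φ t) j))
    (B : HalfFormBundle E δ n jref) (t : ℝ) (x : M) {ρ ψ : ℝ → ℂ} {ρ' ψ' : ℂ}
    (hρ : HasDerivAt ρ ρ' 0) (hρ0 : ρ 0 = 1) (hψ : HasDerivAt ψ ψ' t) (hψt : ψ t = 1)
    (hψ0 : ∀ u, ψ u ≠ 0)
    (hψsq : ∀ (u : ℝ) (z : δ x ⊗[ℂ] δ x), psi n (pullbackACS (φ t) j x) (pullbackACS (φ u) j x)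
      (B.phi (pullbackACS (φ t) j) x z) = (ψ u ^ 2) • B.phi (pullbackACS (φ u) j) x z)
    (hρsq : ∀ᶠ h in 𝓝 (0 : ℝ), pullbackForm (φ h) x (B.phi (pullbackACS (φ t) j) (φ h x)
        (frameAt δ x (φ h x) ⊗ₜ frameAt δ x (φ h x))) =
      (ρ h ^ 2) • (B.phi (pullbackACS (φ (t + h)) j) x (frameAt δ x x ⊗ₜ frameAt δ x x) :
          CForm (TangentSpace 𝓘(ℝ, E) x) n)) :
    B.lieFrame φ (pullbackACS (φ t) j) x = (ρ' - ψ') • frameAt δ x x := by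
  let J := pullbackACS (φ t) j
  let b : CForm (TangentSpace 𝓘(ℝ, E) x) n := B.phi J x (frameAt δ x x ⊗ₜ frameAt δ x x)
  let F : (Fin n → TangentSpace 𝓘(ℝ, E) x) → ℝ → ℂ := fun v h =>
    pullbackForm (φ h) x (B.phi J (φ h x) (frameAt δ x (φ h x) ⊗ₜ frameAt δ x (φ h x))) v
  let G : (Fin n → TangentSpace 𝓘(ℝ, E) x) → ℝ → ℂ := fun v h =>
    (B.phi (pullbackACS (φ (t + h)) j) x (frameAt δ x x ⊗ₜ frameAt δ x x) :
      CForm (TangentSpace 𝓘(ℝ, E) x) n) v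
  -- differentiability of the pull-back in `h`, needed for `lieForm`, which is defined by `deriv`
  have hG : ∀ v, DifferentiableAt ℝ (G v) 0 := fun v => by
    have h1 : ContMDiffAt 𝓘(ℝ, ℝ) 𝓘(ℝ, E →L[ℝ] E) ∞
        (fun h : ℝ => endoCoord (pullbackACS (φ (t + h)) j) x x) 0 := by
      have hb := contMDiffAt_endoCoord_pullbackACS hφ hj.smooth t x
      refine ContMDiffAt.comp_of_eq (x := (0 : ℝ)) (y := (t, x))
        (g := fun p : ℝ × M => endoCoord (pullbackACS (φ p.1) j) x p.2)
        (f := fun h : ℝ => (t + h, x)) hb ?_ (by simp)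
      exact (contDiff_const.add contDiff_id).contMDiff.contMDiffAt.prodMk contMDiffAt_const
    have h2 := contMDiffAt_phi hn hr B (y := fun _ : ℝ => x) (p₀ := (0 : ℝ))
      (J := fun h => pullbackACS (φ (t + h)) j) (fun h => hJ (t + h)) h1 contMDiffAt_const
      (w := fun i _ => v i) (fun i => contMDiffAt_const)
    have e : (fun i => ts (E := E) x x (v i)) = v := funext fun i => ts_self (E := E) x (v i)
    rw [e] at h2
    exact h2.contDiffAt.differentiableAt (by simp)
  have hFG : ∀ v, F v =ᶠ[𝓝 0] fun h => ρ h ^ 2 * G v h := fun v => by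
    filter_upwards [hρsq] with h hh
    exact congrArg (fun α : CForm (TangentSpace 𝓘(ℝ, E) x) n => α v) hh
  have hF : ∀ v, HasDerivAt (F v) (lieForm φ
      (fun y => (B.phi J y (frameAt δ x y ⊗ₜ frameAt δ x y) :
        CForm (TangentSpace 𝓘(ℝ, E) y) n)) x v) 0 := fun v => by
    have h1 : DifferentiableAt ℝ (fun h => ρ h ^ 2 * G v h) 0 :=
      (hρ.differentiableAt.pow 2).mul (hG v)
    exact (h1.congr_of_eventuallyEq (hFG v)).hasDerivAt
  -- `p_j φ_h^* φ_j(b²) = (ρ_h / ψ_{t+h})² φ_j(b²)`: the pull-back produces `ρ²`, and `p_j` on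
  -- `Λ^{n,0}` of the structure at time `t + h` is the inverse of `Ψ`
  have main : ∀ v : Fin n → TangentSpace 𝓘(ℝ, E) x, projN0 (J x) (lieForm φ
      (fun y => (B.phi J y (frameAt δ x y ⊗ₜ frameAt δ x y) :
        CForm (TangentSpace 𝓘(ℝ, E) y) n)) x) v = 2 * (ρ' - ψ') * b v := fun v => by
    have h1 : HasDerivAt (fun h => projN0 (J x) (fun w => F w h) v) (projN0 (J x) (lieForm φ
      (fun y => (B.phi J y (frameAt δ x y ⊗ₜ frameAt δ x y) :
        CForm (TangentSpace 𝓘(ℝ, E) y) n)) x) v) 0 := by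
      unfold projN0
      exact HasDerivAt.fun_sum fun S _ => (hF _).const_mul _
    have h2 : (fun h => projN0 (J x) (fun w => F w h) v) =ᶠ[𝓝 0]
        fun h => ρ h ^ 2 * (ψ (t + h) ^ 2)⁻¹ * b v := by
      filter_upwards [hρsq] with h hh
      have e1 : (fun w => F w h) = fun w => ρ h ^ 2 * G w h := by
        funext w
        exact congrArg (fun α : CForm (TangentSpace 𝓘(ℝ, E) x) n => α w) hh
      have e2 : projN0 (J x) (fun w => ρ h ^ 2 * G w h) v =
          ρ h ^ 2 * projN0 (J x) (fun w => G w h) v := by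
        unfold projN0
        rw [Finset.mul_sum]
        exact Finset.sum_congr rfl fun S _ => by ring
      have e3 : projN0 (J x) (fun w => G w h) v =
          G (fun i => midMap (J x) (pullbackACS (φ (t + h)) j x) (v i)) h :=
        projN0_eq_comp_midMap (B.phi (pullbackACS (φ (t + h)) j) x
          (frameAt δ x x ⊗ₜ frameAt δ x x)).2 v
      have e4 : ψ (t + h) ^ 2 * G (fun i => midMap (J x) (pullbackACS (φ (t + h)) j x) (v i)) h =
          b v := by
        have h3 := psi_midMap hn (hJ t) (hJ (t + h)) x
          (B.phi J x (frameAt δ x x ⊗ₜ frameAt δ x x)) v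
        rw [hψsq] at h3
        exact h3
      rw [e1, e2, e3, ← e4, mul_assoc, inv_mul_cancel_left₀ (pow_ne_zero 2 (hψ0 _))]
    have hψ1 : HasDerivAt (fun h => ψ (t + h)) ψ' 0 := by
      have h3 : HasDerivAt ψ ψ' (t + 0) := by rwa [add_zero]
      exact h3.comp_const_add t 0
    have h3 : HasDerivAt (fun h => ρ h ^ 2 * (ψ (t + h) ^ 2)⁻¹ * b v)
        (2 * (ρ' - ψ') * b v) 0 := by
      have h4 := (((hρ.fun_pow 2).fun_mul ((hψ1.fun_pow 2).fun_inv
        (pow_ne_zero 2 (hψ0 _))))).mul_const (b v)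
      refine h4.congr_deriv ?_
      simp only [hρ0, add_zero, hψt]
      push_cast
      ring
    exact (h1.congr_of_eventuallyEq h2.symm).unique h3
  have hd : ∀ (d : δ x) (v : Fin n → TangentSpace 𝓘(ℝ, E) x),
      (B.phi J x (frameAt δ x x ⊗ₜ d) : CForm (TangentSpace 𝓘(ℝ, E) x) n) v =
        coordAt δ x x d * b v := fun d v => by
    rw [phi_tmul B (mem_frameDom δ x), coordAt_frameAt (mem_frameDom δ x), one_mul]
    rfl
  have hex : ∃ d : δ x, ∀ v : Fin n → TangentSpace 𝓘(ℝ, E) x,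
      projN0 (J x) (lieForm φ
        (fun y => (B.phi J y (frameAt δ x y ⊗ₜ frameAt δ x y) :
          CForm (TangentSpace 𝓘(ℝ, E) y) n)) x) v =
      2 * (B.phi J x (frameAt δ x x ⊗ₜ d) : CForm (TangentSpace 𝓘(ℝ, E) x) n) v := by
    refine ⟨(ρ' - ψ') • frameAt δ x x, fun v => ?_⟩
    rw [main, hd ((ρ' - ψ') • frameAt δ x x) v, map_smul, coordAt_frameAt (mem_frameDom δ x),
      smul_eq_mul, mul_one, mul_assoc]
  have hlie : B.lieFrame φ J x = hex.choose := dif_pos hex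
  have hs := hex.choose_spec
  obtain ⟨v, hv⟩ := phi_frame_ne_zero hn hr (hJ t) B (mem_frameDom δ x)
  have h1 := hs v
  rw [main, hd hex.choose v, mul_assoc, ← hlie] at h1
  have h2 : ρ' - ψ' = coordAt δ x x (B.lieFrame φ J x) :=
    mul_right_cancel₀ (b := b v) hv (mul_left_cancel₀ two_ne_zero h1)
  rw [h2]
  exact (coordAt_smul_frameAt (mem_frameDom δ x) _).symm

end LieFrame

/-! ### The derivative of the section along the curve of complex structures -/

/-- Division by `c` in the factor `δ` divides the tensor by `c`. -/
theorem map_smulOfNeZero_symm {M : Type*} {L δ : M → Type*} [∀ x, AddCommGroup (L x)]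
    [∀ x, Module ℂ (L x)] [∀ x, AddCommGroup (δ x)] [∀ x, Module ℂ (δ x)] {k : ℕ} {x : M} (c : ℂ)
    (hc : c ≠ 0) (z : Fibre L δ k x) :
    TensorProduct.map LinearMap.id
      (LinearEquiv.smulOfNeZero ℂ (δ x) c hc).symm.toLinearMap z = c⁻¹ • z := by
  induction z using TensorProduct.induction_on with
  | zero => simp
  | add a b ha hb => rw [map_add, ha, hb, smul_add]
  | tmul a b =>
    have h : (LinearEquiv.smulOfNeZero ℂ (δ x) c hc).symm b = c⁻¹ • b := by
      rw [LinearEquiv.symm_apply_eq]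
      change b = c • c⁻¹ • b
      rw [smul_inv_smul₀ hc]
    rw [TensorProduct.map_tmul, LinearMap.id_apply, LinearEquiv.coe_coe, h,
      TensorProduct.tmul_smul]

section Derivative

variable {E : Type*} [NormedAddCommGroup E] [NormedSpace ℝ E] [FiniteDimensional ℝ E]
  {M : Type*} [TopologicalSpace M] [ChartedSpace E M] [IsManifold 𝓘(ℝ, E) ∞ M] [T2Space M]
  {Ω : Π x : M, TangentSpace 𝓘(ℝ, E) x →ₗ[ℝ] TangentSpace 𝓘(ℝ, E) x →ₗ[ℝ] ℝ}
  {L : M → Type*} [TopologicalSpace (TotalSpace ℂ L)] [∀ x, TopologicalSpace (L x)]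
  [∀ x, AddCommGroup (L x)] [∀ x, Module ℂ (L x)] [FiberBundle ℂ L] [VectorBundle ℂ ℂ L]
  [∀ x, IsTopologicalAddGroup (L x)] [∀ x, ContinuousSMul ℝ (L x)]
  {δ : M → Type*} [TopologicalSpace (TotalSpace ℂ δ)] [∀ x, TopologicalSpace (δ x)]
  [∀ x, AddCommGroup (δ x)] [∀ x, Module ℂ (δ x)] [FiberBundle ℂ δ] [VectorBundle ℂ ℂ δ]
  {nabla : CovariantDerivative 𝓘(ℝ, E) ℂ L}
  {X : Π x : M, TangentSpace 𝓘(ℝ, E) x} {φ : ℝ → M → M} {f : M → ℝ}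
  {T : Π (t : ℝ) (x : M), L x ≃ₗ[ℂ] L (φ t x)} {k : ℕ} {n : ℕ}
  {jref : Π x : M, TangentSpace 𝓘(ℝ, E) x →L[ℝ] TangentSpace 𝓘(ℝ, E) x}

/-- The action at time `t + h` at the point `x`, in terms of the action at time `t` at `φ_h(x)`. -/
theorem tensorCoord_action_add (hT : IsParallelTransport nabla X φ T) (hφ : IsFlow X φ)
    (hfφ : ∀ t x, f (φ t x) = f x) (Θ : Π (t : ℝ) (x : M), δ (φ t x) →ₗ[ℂ] δ x)
    (s : Π x : M, Fibre L δ k x) {t h : ℝ} {x : M} (hL : φ h x ∈ frameDom L x)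
    (hzL : φ t (φ h x) ∈ frameDom L (φ t x)) (hzδ : φ t (φ h x) ∈ frameDom δ (φ t x))
    (h0 : liftCoord Θ (t, x) (t, φ h x) ≠ 0) :
    tensorCoord L δ k x x (action (expAut f T) Θ (t + h) s x) =
      tensorCoord L δ k x (φ h x) (action (expAut f T) Θ t s (φ h x)) *
        ((Complex.exp (Complex.I * h * f x) *
          (coordAt L x (φ h x) (T h x (frameAt L x x)))⁻¹) ^ k *
          (liftCoord Θ (t, x) (t + h, x) / liftCoord Θ (t, x) (t, φ h x))) := by
  have : CompleteSpace E := FiniteDimensional.complete ℝ E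
  have hadd := hφ.add t h x
  have hzL' : φ (t + h) x ∈ frameDom L (φ t x) := by rwa [hadd]
  have hzδ' : φ (t + h) x ∈ frameDom δ (φ t x) := by rwa [hadd]
  rw [tensorCoord_action (expAut f T) Θ s (t + h) hzL' hzδ',
    tensorCoord_action (expAut f T) Θ s t hzL hzδ,
    coordAt_expAut_symm (mem_frameDom L x) hzL', coordAt_expAut_symm hL hzL, hfφ]
  have e1 := hT.coordAt_add hφ t h x (frameAt_ne_zero (mem_frameDom L x)) (φ t x)
  have e2 : coordAt L (φ t x) (φ t (φ h x)) (T t (φ h x) (T h x (frameAt L x x))) =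
      coordAt L x (φ h x) (T h x (frameAt L x x)) *
        coordAt L (φ t x) (φ t (φ h x)) (T t (φ h x) (frameAt L x (φ h x))) := by
    have e3 := map_eq_coord_smul hL (coordAt L (φ t x) (φ t (φ h x)) ∘ₗ (T t (φ h x)).toLinearMap)
      (T h x (frameAt L x x))
    exact e3
  have e4 : tensorCoord L δ k (φ t x) (φ (t + h) x) (s (φ (t + h) x)) =
      tensorCoord L δ k (φ t x) (φ t (φ h x)) (s (φ t (φ h x))) := by rw [hadd]
  have e5 : Complex.exp (Complex.I * ((t + h : ℝ) : ℂ) * f x) =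
      Complex.exp (Complex.I * h * f x) * Complex.exp (Complex.I * t * f x) := by
    rw [← Complex.exp_add]
    congr 1
    push_cast
    ring
  rw [e1, e2, e4, e5]
  change _ * (_ * liftCoord Θ (t, x) (t + h, x)) =
    _ * (_ * liftCoord Θ (t, x) (t, φ h x)) * _
  have key : ∀ G a b τ σ θ₁ θ₂ : ℂ, θ₂ ≠ 0 → G * ((a * b * (τ * σ)⁻¹) ^ k * θ₁) =
      G * ((b * σ⁻¹) ^ k * θ₂) * ((a * τ⁻¹) ^ k * (θ₁ / θ₂)) := by
    intro G a b τ σ θ₁ θ₂ h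
    have e : a * b * (τ * σ)⁻¹ = (b * σ⁻¹) * (a * τ⁻¹) := by rw [mul_inv]; ring
    have e' : θ₁ = θ₂ * (θ₁ / θ₂) := (mul_div_cancel₀ _ h).symm
    rw [e, mul_pow]
    nth_rewrite 1 [e']
    ring
  exact key _ _ _ _ _ _ _ h0

omit [FiniteDimensional ℝ E] [T2Space M] in
/-- The coordinate of `(∇_X ⊗ Id + Id ⊗ D_X) s`. -/
theorem tensorDerivative_eq (B : HalfFormBundle E δ n jref)
    (j : Π x : M, TangentSpace 𝓘(ℝ, E) x →L[ℝ] TangentSpace 𝓘(ℝ, E) x)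
    (s : Π x : M, Fibre L δ k x) (x : M) {d : ℂ} (hd : B.lieFrame φ j x = d • frameAt δ x x) :
    tensorDerivative nabla B X φ j s x =
      (mvfderiv 𝓘(ℝ, E) (fun y => tensorCoord L δ k x y (s y)) x (X x) +
        tensorCoord L δ k x x (s x) *
          (k * coordAt L x x (nabla.toFun (frameAt L x) x (X x)) + d)) • tensorFrame L δ k x x := by
  have h1 : B.lie X φ j (frameAt δ x) x = d • frameAt δ x x := by
    have h2 : (fun y => coordAt δ x y (frameAt δ x y)) =ᶠ[𝓝 x] fun _ => (1 : ℂ) := by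
      filter_upwards [frameDom_mem_nhds δ x] with y hy using coordAt_frameAt hy
    have h3 : mvfderiv 𝓘(ℝ, E) (fun y => coordAt δ x y (frameAt δ x y)) x (X x) = 0 := by
      have h4 : HasMFDerivAt 𝓘(ℝ, E) 𝓘(ℝ, ℂ) (fun y => coordAt δ x y (frameAt δ x y)) x 0 :=
        (hasMFDerivAt_const (1 : ℂ) x).congr_of_eventuallyEq h2
      have h5 : mvfderiv 𝓘(ℝ, E) (fun y => coordAt δ x y (frameAt δ x y)) x = 0 := h4.mfderiv
      rw [h5]
      rfl
    rw [HalfFormBundle.lie, h3, zero_smul, zero_add, coordAt_frameAt (mem_frameDom δ x), one_smul,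
      hd]
  have h2 : ∀ i : Fin k, PiTensorProduct.tprod ℂ (Function.update (fun _ : Fin k => frameAt L x x) i
      (nabla.toFun (frameAt L x) x (X x))) = coordAt L x x (nabla.toFun (frameAt L x) x (X x)) •
        PiTensorProduct.tprod ℂ (fun _ : Fin k => frameAt L x x) := fun i => by
    conv_lhs => rw [← coordAt_smul_frameAt (mem_frameDom L x)
      (nabla.toFun (frameAt L x) x (X x)), MultilinearMap.map_update_smul]
    rw [Function.update_eq_self]
  rw [tensorDerivative, h1, Finset.sum_congr rfl fun i _ => h2 i, Finset.sum_const,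
    Finset.card_univ, Fintype.card_fin, ← Nat.cast_smul_eq_nsmul ℂ, smul_smul,
    ← TensorProduct.smul_tmul', TensorProduct.tmul_smul]
  change _ • tensorFrame L δ k x x + _ • (_ • tensorFrame L δ k x x + d • tensorFrame L δ k x x) = _
  rw [← add_smul, smul_smul, ← add_smul]

end Derivative

section Evolution

variable {E : Type*} [NormedAddCommGroup E] [NormedSpace ℝ E] [FiniteDimensional ℝ E]
  {M : Type*} [TopologicalSpace M] [ChartedSpace E M] [IsManifold 𝓘(ℝ, E) ∞ M] [T2Space M]
  {Ω : Π x : M, TangentSpace 𝓘(ℝ, E) x →ₗ[ℝ] TangentSpace 𝓘(ℝ, E) x →ₗ[ℝ] ℝ}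
  {L : M → Type*} [TopologicalSpace (TotalSpace ℂ L)] [∀ x, TopologicalSpace (L x)]
  [∀ x, AddCommGroup (L x)] [∀ x, Module ℂ (L x)] [FiberBundle ℂ L] [VectorBundle ℂ ℂ L]
  [∀ x, IsTopologicalAddGroup (L x)] [∀ x, ContinuousSMul ℝ (L x)]
  {δ : M → Type*} [TopologicalSpace (TotalSpace ℂ δ)] [∀ x, TopologicalSpace (δ x)]
  [∀ x, AddCommGroup (δ x)] [∀ x, Module ℂ (δ x)] [FiberBundle ℂ δ] [VectorBundle ℂ ℂ δ]
  {nabla : CovariantDerivative 𝓘(ℝ, E) ℂ L}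
  {X : Π x : M, TangentSpace 𝓘(ℝ, E) x} {φ : ℝ → M → M} {f : M → ℝ}
  {T : Π (t : ℝ) (x : M), L x ≃ₗ[ℂ] L (φ t x)} {k : ℕ} {n : ℕ}
  {jref j : Π x : M, TangentSpace 𝓘(ℝ, E) x →L[ℝ] TangentSpace 𝓘(ℝ, E) x}

/-- The derivative at `x` of the coordinate of `U_u s`, for a lift whose logarithmic derivative
(relative to time `t`) is `ρ'`. -/
theorem hasDerivAt_tensorCoord_action (hT : IsParallelTransport nabla X φ T) (hφ : IsFlow X φ)
    (hfφ : ∀ t x, f (φ t x) = f x) {Θ : Π (t : ℝ) (x : M), δ (φ t x) →ₗ[ℂ] δ x}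
    {s : Π x : M, Fibre L δ k x} (hs : IsSmoothFamily E (fun t => action (expAut f T) Θ t s))
    (t : ℝ) (x : M) (hΘ0 : ∀ᶠ h in 𝓝 (0 : ℝ), liftCoord Θ (t, x) (t, φ h x) ≠ 0)
    {ρ' : ℂ} (hρ0 : liftCoord Θ (t, x) (t + 0, x) / liftCoord Θ (t, x) (t, φ 0 x) = 1)
    (hρ : HasDerivAt (fun h => liftCoord Θ (t, x) (t + h, x) / liftCoord Θ (t, x) (t, φ h x))
      ρ' 0) :
    HasDerivAt (fun u => tensorCoord L δ k x x (action (expAut f T) Θ u s x))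
      (mvfderiv 𝓘(ℝ, E) (fun y => tensorCoord L δ k x y (action (expAut f T) Θ t s y)) x (X x) +
        tensorCoord L δ k x x (action (expAut f T) Θ t s x) *
          (k * (Complex.I * f x + coordAt L x x (nabla.toFun (frameAt L x) x (X x))) + ρ')) t := by
  let g : M → ℂ := fun y => tensorCoord L δ k x y (action (expAut f T) Θ t s y)
  let κ : ℂ := coordAt L x x (nabla.toFun (frameAt L x) x (X x))
  let τ : ℝ → ℂ := fun h => coordAt L x (φ h x) (T h x (frameAt L x x))
  have hτ : HasDerivAt τ (-κ) 0 := hT.hasDerivAt_zero hφ x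
  have hτ0 : τ 0 = 1 :=
    (coordAt_congr (hT.zero x _)).trans (coordAt_frameAt (mem_frameDom L x))
  have hg : MDifferentiableAt 𝓘(ℝ, E) 𝓘(ℝ, ℂ) g x := by
    have h1 : ContMDiffAt 𝓘(ℝ, E) 𝓘(ℝ, ℂ) ∞ g x :=
      ContMDiffAt.comp x (g := fun p : ℝ × M =>
        tensorCoord L δ k x p.2 (action (expAut f T) Θ p.1 s p.2)) (f := fun y => (t, y)) (hs t x)
        (contMDiffAt_const.prodMk contMDiffAt_id)
    exact h1.mdifferentiableAt (by simp)
  have hgφ : HasDerivAt (fun h => g (φ h x)) (mvfderiv 𝓘(ℝ, E) g x (X x)) 0 := by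
    have key : ∀ z, z = x → MDifferentiableAt 𝓘(ℝ, E) 𝓘(ℝ, ℂ) g z ∧
        mvfderiv 𝓘(ℝ, E) g z (X z) = mvfderiv 𝓘(ℝ, E) g x (X x) := by
      rintro _ rfl
      exact ⟨hg, rfl⟩
    have hk := key (φ 0 x) (hφ.zero x)
    rw [← hk.2]
    exact hasDerivAt_comp_curve (hφ.integral x 0) hk.1
  have hexp : HasDerivAt (fun h : ℝ => Complex.exp (Complex.I * h * f x)) (Complex.I * f x) 0 := by
    have h1 : HasDerivAt (fun h : ℝ => Complex.I * (h : ℂ) * f x) (Complex.I * f x) 0 := by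
      have h2 : HasDerivAt (fun h : ℝ => (h : ℂ)) 1 0 := Complex.ofRealCLM.hasDerivAt
      simpa using (h2.const_mul Complex.I).mul_const (f x : ℂ)
    have h3 := h1.cexp
    simpa using h3
  have hev : (fun h => tensorCoord L δ k x x (action (expAut f T) Θ (t + h) s x)) =ᶠ[𝓝 0]
      fun h => g (φ h x) * ((Complex.exp (Complex.I * h * f x) * (τ h)⁻¹) ^ k *
        (liftCoord Θ (t, x) (t + h, x) / liftCoord Θ (t, x) (t, φ h x))) := by
    have hc : ContinuousAt (fun h : ℝ => φ h x) 0 :=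
      (hφ.continuous.comp (by fun_prop : Continuous fun h : ℝ => (h, x))).continuousAt
    have hc2 : ContinuousAt (fun h : ℝ => φ t (φ h x)) 0 :=
      (hφ.continuous.comp (by fun_prop : Continuous fun y : M => (t, y))).continuousAt.comp hc
    have m1 : frameDom L x ∈ 𝓝 (φ 0 x) := by rw [hφ.zero]; exact frameDom_mem_nhds L x
    have m2 : frameDom L (φ t x) ∈ 𝓝 (φ t (φ 0 x)) := by
      rw [hφ.zero]; exact frameDom_mem_nhds L _
    have m3 : frameDom δ (φ t x) ∈ 𝓝 (φ t (φ 0 x)) := by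
      rw [hφ.zero]; exact frameDom_mem_nhds δ _
    filter_upwards [hc.preimage_mem_nhds m1, hc2.preimage_mem_nhds m2, hc2.preimage_mem_nhds m3,
      hΘ0] with h h1 h2 h3 h4
    exact tensorCoord_action_add hT hφ hfφ Θ s h1 h2 h3 h4
  have hτ0' : τ 0 ≠ 0 := by rw [hτ0]; exact one_ne_zero
  have hprod := hgφ.fun_mul (((hexp.fun_mul (hτ.fun_inv hτ0')).fun_pow k).fun_mul hρ)
  have h0 : HasDerivAt (fun h => tensorCoord L δ k x x (action (expAut f T) Θ (t + h) s x))
      (mvfderiv 𝓘(ℝ, E) g x (X x) + g x * (k * (Complex.I * f x + κ) + ρ')) 0 := by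
    refine (hprod.congr_of_eventuallyEq hev).congr_deriv ?_
    rw [hρ0, hτ0, hφ.zero]
    simp
  have h1 := HasDerivAt.comp_sub_const t t
    (f := fun h => tensorCoord L δ k x x (action (expAut f T) Θ (t + h) s x)) (by rwa [sub_self])
  simpa using h1

variable [VectorBundle ℝ ℂ δ] [ContMDiffVectorBundle ∞ ℂ δ 𝓘(ℝ, E)]

/-- The evolution equation `(1/ik) ∇_{∂_t} s = Op_k(f) s` for `s_t = U_t s`. In the frame at `x` the
logarithmic derivative of the lift, `ρ'`, enters `d/dt U_t s`, and the logarithmic derivative of the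
parallel family, `ψ'`, is subtracted by `∇_{∂_t}`; the difference is the coefficient of `D_X`. -/
theorem hasCovDerivAt_action (hn : Module.finrank ℝ E = 2 * n) (hr : IsCompatible Ω jref)
    (hj : IsCompatible Ω j) (hJ : ∀ t, IsCompatible Ω (pullbackACS (φ t) j))
    (B : HalfFormBundle E δ n jref) (hk : 1 ≤ k)
    (hT : IsParallelTransport nabla X φ T) (hφ : IsFlow X φ)
    (hfφ : ∀ t x, f (φ t x) = f x) {Θ : Π (t : ℝ) (x : M), δ (φ t x) →ₗ[ℂ] δ x}
    (hΘ : B.IsLift φ j Θ) {s : Π x : M, Fibre L δ k x}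
    (hs : IsSmoothFamily E (fun t => action (expAut f T) Θ t s)) (t : ℝ) :
    ∃ v : Π x : M, Fibre L δ k x,
      HasCovDerivAt B (fun u => pullbackACS (φ u) j) (fun t => action (expAut f T) Θ t s) t v ∧
      ∀ x : M, (1 / (Complex.I * (k : ℂ))) • v x =
        opK nabla B f X φ (pullbackACS (φ t) j) (action (expAut f T) Θ t s) x := by
  obtain ⟨ψ, hψs, hψ0, hψt, hψsq⟩ := exists_morphism_family hn hr hJ
    (contMDiffAt_endoCoord_pullbackACS hφ hj.smooth) B t
  have hΘs := hΘ.contMDiffAt_liftCoord hn hr hφ hj hJ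
  have hψd : ∀ x, DifferentiableAt ℝ (fun u => ψ (u, x)) t := fun x => by
    have h1 : ContMDiff 𝓘(ℝ, ℝ) 𝓘(ℝ, ℂ) ∞ (fun u => ψ (u, x)) :=
      hψs.comp (contMDiff_id.prodMk contMDiff_const)
    exact (h1 t).contDiffAt.differentiableAt (by simp)
  have hρd : ∀ x, DifferentiableAt ℝ
      (fun h => liftCoord Θ (t, x) (t + h, x) / liftCoord Θ (t, x) (t, φ h x)) 0 := fun x => by
    have h1 : ContMDiffAt 𝓘(ℝ, ℝ) 𝓘(ℝ, ℂ) ∞ (fun h : ℝ => liftCoord Θ (t, x) (t + h, x)) 0 := by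
      refine ContMDiffAt.comp_of_eq (x := (0 : ℝ)) (y := (t, x)) (g := liftCoord Θ (t, x))
        (f := fun h : ℝ => (t + h, x)) (hΘs (t, x)).1 ?_ (by simp)
      exact (contDiff_const.add contDiff_id).contMDiff.contMDiffAt.prodMk contMDiffAt_const
    have h2 : ContMDiffAt 𝓘(ℝ, ℝ) 𝓘(ℝ, ℂ) ∞ (fun h : ℝ => liftCoord Θ (t, x) (t, φ h x)) 0 := by
      refine ContMDiffAt.comp_of_eq (x := (0 : ℝ)) (y := (t, x)) (g := liftCoord Θ (t, x))
        (f := fun h : ℝ => (t, φ h x)) (hΘs (t, x)).1 ?_ (by simp [hφ.zero])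
      exact contMDiffAt_const.prodMk
        (hφ.smooth.comp (contMDiff_id.prodMk contMDiff_const)).contMDiffAt
    refine (h1.contDiffAt.differentiableAt (by simp)).div (h2.contDiffAt.differentiableAt (by simp))
      ?_
    rw [hφ.zero]
    exact (hΘs (t, x)).2
  have hΘ0 : ∀ x, ∀ᶠ h in 𝓝 (0 : ℝ), liftCoord Θ (t, x) (t, φ h x) ≠ 0 := fun x => by
    have hc : ContinuousAt (fun h : ℝ => (t, φ h x)) 0 :=
      (continuous_const.prodMk
        (hφ.continuous.comp (by fun_prop : Continuous fun h : ℝ => (h, x)))).continuousAt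
    have h1 := (hΘs (t, x)).1.continuousAt.eventually_ne (hΘs (t, x)).2
    have h2 : ∀ᶠ p in 𝓝 (t, φ 0 x), liftCoord Θ (t, x) p ≠ 0 := by rwa [hφ.zero]
    exact hc.eventually h2
  have hρ0 : ∀ x, liftCoord Θ (t, x) (t + 0, x) / liftCoord Θ (t, x) (t, φ 0 x) = 1 := fun x => by
    rw [hφ.zero, add_zero, div_self (hΘs (t, x)).2]
  let ρ' : M → ℂ := fun x =>
    deriv (fun h => liftCoord Θ (t, x) (t + h, x) / liftCoord Θ (t, x) (t, φ h x)) 0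
  let ψ' : M → ℂ := fun x => deriv (fun u => ψ (u, x)) t
  let κ : M → ℂ := fun x => coordAt L x x (nabla.toFun (frameAt L x) x (X x))
  let g : M → ℂ := fun x => tensorCoord L δ k x x (action (expAut f T) Θ t s x)
  let g' : M → ℂ := fun x =>
    mvfderiv 𝓘(ℝ, E) (fun y => tensorCoord L δ k x y (action (expAut f T) Θ t s y)) x (X x)
  -- all sections are expressed in the frame `e^k ⊗ b` centred at the point `x` itself
  have hframe : ∀ (u : ℝ) (x : M), action (expAut f T) Θ u s x =
      tensorCoord L δ k x x (action (expAut f T) Θ u s x) • tensorFrame L δ k x x := fun u x =>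
    (tensorCoord_smul_tensorFrame (mem_frameDom L x) (mem_frameDom δ x) _).symm
  have hlie : ∀ x, B.lieFrame φ (pullbackACS (φ t) j) x = (ρ' x - ψ' x) • frameAt δ x x := fun x =>
    lieFrame_eq hn hr hφ hj hJ B t x (hρd x).hasDerivAt (hρ0 x) (hψd x).hasDerivAt (hψt x)
      (fun u => hψ0 (u, x)) (fun u z => hψsq u x z) (by
        have hc : ContinuousAt (fun h : ℝ => φ h x) 0 :=
          (hφ.continuous.comp (by fun_prop : Continuous fun h : ℝ => (h, x))).continuousAt
        have m : frameDom δ x ∈ 𝓝 (φ 0 x) := by rw [hφ.zero]; exact frameDom_mem_nhds δ x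
        filter_upwards [hc.preimage_mem_nhds m, hΘ0 x] with h h1 h2
        exact hΘ.pullbackForm_phi hφ h1 h2)
  refine ⟨fun x => (g' x + g x * (k * (Complex.I * f x + κ x) + ρ' x) - ψ' x * g x) •
    tensorFrame L δ k x x, ⟨fun u x => LinearEquiv.smulOfNeZero ℂ (δ x) (ψ (u, x)) (hψ0 (u, x)),
      ?_, ?_, ?_, ?_, ?_⟩, ?_⟩
  · intro u x
    refine TensorProduct.ext' fun a b => ?_
    have h1 := hψsq u x (a ⊗ₜ b)
    refine Eq.trans ?_ h1.symm
    change B.phi (pullbackACS (φ u) j) x ((ψ (u, x) • a) ⊗ₜ (ψ (u, x) • b)) = _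
    rw [TensorProduct.smul_tmul_smul, map_smul, sq]
  · intro x
    ext b
    change ψ (t, x) • b = b
    rw [hψt, one_smul]
  · intro u₀ x₀
    refine hψs.continuous.continuousAt.congr ?_
    filter_upwards [continuous_snd.continuousAt.preimage_mem_nhds (frameDom_mem_nhds δ x₀)]
      with p hp
    change ψ p = coordAt δ x₀ p.2 (ψ (p.1, p.2) • frameAt δ x₀ p.2)
    rw [map_smul, coordAt_frameAt hp, smul_eq_mul, mul_one]
  · intro u₀ x₀
    refine contMDiffAt_of_eq_mul (hs u₀ x₀) (hψs (u₀, x₀)) (hψ0 _)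
      (Filter.Eventually.of_forall fun p => ?_)
    change _ = tensorCoord L δ k x₀ p.2 (TensorProduct.map LinearMap.id
      (LinearEquiv.smulOfNeZero ℂ (δ p.2) (ψ (p.1, p.2)) (hψ0 _)).symm.toLinearMap _) * ψ p
    rw [map_smulOfNeZero_symm, map_smul, smul_eq_mul, mul_comm, mul_inv_cancel_left₀ (hψ0 _)]
  · intro x l
    have hS := hasDerivAt_tensorCoord_action hT hφ hfφ hs t x (hΘ0 x) (hρ0 x) (hρd x).hasDerivAt
    have e : (fun u => l (TensorProduct.map LinearMap.id
        (LinearEquiv.smulOfNeZero ℂ (δ x) (ψ (u, x)) (hψ0 _)).symm.toLinearMap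
          (action (expAut f T) Θ u s x))) = fun u => (ψ (u, x))⁻¹ *
            tensorCoord L δ k x x (action (expAut f T) Θ u s x) * l (tensorFrame L δ k x x) := by
      funext u
      rw [map_smulOfNeZero_symm, map_smul, smul_eq_mul, mul_assoc]
      congr 1
      conv_lhs => rw [hframe u x, map_smul, smul_eq_mul]
    have hd := (((hψd x).hasDerivAt.fun_inv (hψ0 (t, x))).fun_mul hS).mul_const
      (l (tensorFrame L δ k x x))
    refine (e ▸ hd).congr_deriv ?_
    rw [map_smul, smul_eq_mul, hψt]
    simp only [g', g, κ, ρ', ψ']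
    ring
  · intro x
    have hk0 : (k : ℂ) ≠ 0 := Nat.cast_ne_zero.mpr (by omega)
    have e : (f x : ℂ) • action (expAut f T) Θ t s x = (f x * g x) • tensorFrame L δ k x x := by
      conv_lhs => rw [hframe t x]
      rw [smul_smul]
    rw [opK, e, tensorDerivative_eq B _ _ x (hlie x), smul_smul, smul_smul, ← add_smul]
    congr 1
    change 1 / (Complex.I * k) * (g' x + g x * (k * (Complex.I * f x + κ x) + ρ' x) - ψ' x * g x) =
      f x * g x + 1 / (Complex.I * k) * (g' x + g x * (k * κ x + (ρ' x - ψ' x)))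
    have hI := Complex.I_ne_zero
    field_simp
    ring

end Evolution

end HalfForm

end

theorem mainTheorem9
    {E : Type*} [NormedAddCommGroup E] [NormedSpace ℝ E] [FiniteDimensional ℝ E]
    {M : Type*} [TopologicalSpace M] [ChartedSpace E M] [IsManifold 𝓘(ℝ, E) ∞ M]
    [CompactSpace M] [T2Space M]
    (n : ℕ) (hn : Module.finrank ℝ E = 2 * n)
    (Ω : Π x : M, TangentSpace 𝓘(ℝ, E) x →ₗ[ℝ] TangentSpace 𝓘(ℝ, E) x →ₗ[ℝ] ℝ)
    (hΩ : HalfForm.IsSymplectic Ω)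
    -- the prequantization bundle
    {L : M → Type*} [TopologicalSpace (TotalSpace ℂ L)] [∀ x, TopologicalSpace (L x)]
    [∀ x, AddCommGroup (L x)] [∀ x, Module ℂ (L x)] [FiberBundle ℂ L] [VectorBundle ℂ ℂ L]
    [∀ x, IsTopologicalAddGroup (L x)] [∀ x, ContinuousSMul ℝ (L x)]
    [VectorBundle ℝ ℂ L] [ContMDiffVectorBundle ∞ ℂ L 𝓘(ℝ, E)]
    (h : Π x : M, L x →ₗ⋆[ℂ] L x →ₗ[ℂ] ℂ) (nabla : CovariantDerivative 𝓘(ℝ, E) ℂ L)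
    (hL : HalfForm.IsPrequantum Ω h nabla)
    -- the reference half-form bundle
    {δ : M → Type*} [TopologicalSpace (TotalSpace ℂ δ)] [∀ x, TopologicalSpace (δ x)]
    [∀ x, AddCommGroup (δ x)] [∀ x, Module ℂ (δ x)] [FiberBundle ℂ δ] [VectorBundle ℂ ℂ δ]
    [VectorBundle ℝ ℂ δ] [ContMDiffVectorBundle ∞ ℂ δ 𝓘(ℝ, E)]
    (jref : Π x : M, TangentSpace 𝓘(ℝ, E) x →L[ℝ] TangentSpace 𝓘(ℝ, E) x)
    (hjref : HalfForm.IsCompatible Ω jref)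
    (B : HalfForm.HalfFormBundle E δ n jref)
    (k : ℕ) (hk : 1 ≤ k)
    -- the Hamiltonian, its flow, and the parallel transport of `L` along the flow
    (f : M → ℝ) (hf : ContMDiff 𝓘(ℝ, E) 𝓘(ℝ, ℝ) ∞ f)
    (X : Π x : M, TangentSpace 𝓘(ℝ, E) x) (hX : HalfForm.IsHamiltonianField Ω f X)
    (φ : ℝ → M → M) (hφ : HalfForm.IsFlow X φ)
    (T : Π (t : ℝ) (x : M), L x ≃ₗ[ℂ] L (φ t x))
    (hT : HalfForm.IsParallelTransport nabla X φ T)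
    (j₀ : Π x : M, TangentSpace 𝓘(ℝ, E) x →L[ℝ] TangentSpace 𝓘(ℝ, E) x)
    (hj₀ : HalfForm.IsCompatible Ω j₀) :
    -- the curve `j_t = φ_t^* j₀` lies in the space of compatible positive structures
    (∀ t : ℝ, HalfForm.IsCompatible Ω (HalfForm.pullbackACS (φ t) j₀)) ∧
    -- the lift of `φ_t` to half-form bundles, hence the action of `exp(tf)`, is well defined
    (∃! Θ : Π (t : ℝ) (x : M), δ (φ t x) →ₗ[ℂ] δ x, B.IsLift φ j₀ Θ) ∧
    ∀ Θ : Π (t : ℝ) (x : M), δ (φ t x) →ₗ[ℂ] δ x, B.IsLift φ j₀ Θ →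
      ∀ s₀ : Π x : M, HalfForm.Fibre L δ k x, HalfForm.IsSmoothSection E s₀ →
        -- the section `s_t = U_t s₀`
        let s : ℝ → Π x : M, HalfForm.Fibre L δ k x :=
          fun t => HalfForm.action (HalfForm.expAut f T) Θ t s₀
        HalfForm.IsSmoothFamily E s ∧
        ∀ t : ℝ, ∃ v : Π x : M, HalfForm.Fibre L δ k x,
          HalfForm.HasCovDerivAt B (fun u => HalfForm.pullbackACS (φ u) j₀) s t v ∧
          ∀ x : M, (1 / (Complex.I * (k : ℂ))) • v x =
            HalfForm.opK nabla B f X φ (HalfForm.pullbackACS (φ t) j₀) (s t) x := by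
  have hJ := fun t => HalfForm.IsCompatible.pullbackACS hΩ hf hX hφ hj₀ t
  refine ⟨hJ, ?_, fun Θ hΘ s₀ hs₀ => ?_⟩
  · obtain ⟨Θ, hΘ⟩ := HalfForm.exists_isLift hn hjref hφ hj₀ hJ B
    exact ⟨Θ, hΘ, fun Θ' hΘ' => hΘ.unique hn hjref hφ hj₀ hJ hΘ'⟩
  · have hs : HalfForm.IsSmoothFamily E
        (fun t => HalfForm.action (HalfForm.expAut f T) Θ t s₀) :=
      HalfForm.isSmoothFamily_action hT hφ hf
        (fun i => (hΘ.contMDiffAt_liftCoord hn hjref hφ hj₀ hJ i).1) hs₀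
    exact ⟨hs, fun t => HalfForm.hasCovDerivAt_action hn hjref hj₀ hJ B hk hT hφ
      (HalfForm.hamiltonian_flow hΩ hf hX hφ) hΘ hs t⟩
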